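/- Let $G=(V,E)$ be a finite connected undirected graph (loops and parallel edges allowed) with $n$ vertices and $m$ edges. Regard cycles of $G$ as subsets of $E$ (a loop is a cycle of length one, two parallel edges form a cycle of length two), write $\chi_A\in\mathbb Z^E$ for the indicator vector of $A\subseteq E$, and let the cycle lattice of $G$ be the set of all integer linear combinations of the vectors $\chi_C$, $C$ a cycle of $G$. A lattice cycle basis of $G$ is a set of cycles whose indicator vectors form a $\mathbb Z$-basis of the cycle lattice. For a spanning tree $T\subseteq E$ and $e\in E\setminus T$, let $\mathrm{ci}(e,T)$ denote the fundamental cycle of $e$, that is, the unique cycle contained in $T\cup\{e\}$. A lattice cycle basis is semi-fundamental with respect to $T$ if it contains all fundamental cycles $\mathrm{ci}(e,T)$, $e\in E\setminus T$, and each of its other members is a symmetric difference $\mathrm{ci}(e,T)\,\triangle\,\mathrm{ci}(f,T)$ with distinct $e,f\in E\setminus T$ such that $\mathrm{ci}(e,T)$ and $\mathrm{ci}(f,T)$ have an edge of $T$ in common. Then: 1. $G$ has a lattice cycle basis. 2. For every spanning tree $T$ of $G$, there is a lattice cycle basis of $G$ that is semi-fundamental with respect to $T$. 3. There is an algorithm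 that, given $G$ as an adjacency list, computes a lattice cycle basis of $G$ (each cycle being output as the list of its edges) in time $O(mn)$. There is also an algorithm that, given $G$ and a spanning tree $T$ of $G$, computes a lattice cycle basis that is semi-fundamental with respect to $T$ in time $O(mn)$. Here time is the number of steps of a random access machine with registers and arrays of natural numbers, whose unit-cost instructions are: setting a register to a constant, copying a register, adding or subtracting one, reading and writing array cells, and comparing two registers. The bound $O(mn)$ means at most $c\,(mn+1)$ steps, with a constant $c$ that depends only on the algorithm. -/

import Mathlib

open scoped Graph

universe u v

namespace CycleLattice

/-! ### Cycles and spanning trees of a multigraph (loops and parallel edges are allowed) -/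

section Graphs

variable {α : Type u} {β : Type v}

/-- `G` is connected: it has a vertex, and any two vertices are joined by a walk. -/
def IsConnected (G : Graph α β) : Prop :=
  V(G).Nonempty ∧ ∀ x ∈ V(G), ∀ y ∈ V(G), Relation.ReflTransGen G.Adj x y

/-- `C` is the edge set of a cycle `v 0, e 0, v 1, e 1, …, v k, e k, v 0` of length `k + 1`, with
distinct vertices and distinct edges (the addition in `Fin (k + 1)` is cyclic). A loop is a cycle
of length one, and two parallel edges form a cycle of length two. -/
def IsCycle (G : Graph α β) (C : Set β) : Prop :=
  ∃ (k : ℕ) (v : Fin (k + 1) → α) (e : Fin (k + 1) → β),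
    Function.Injective v ∧ Function.Injective e ∧
      (∀ i, G.IsLink (e i) (v i) (v (i + 1))) ∧ C = Set.range e

/-- `T` is the edge set of a spanning tree of `G`: the subgraph with all vertices of `G` and with
edge set `T` is connected, and it contains no cycle. -/
structure IsSpanningTree (G : Graph α β) (T : Set β) : Prop where
  subset : T ⊆ E(G)
  connected : IsConnected (G.restrict T)
  acyclic : ∀ C ⊆ T, ¬ IsCycle G C

/-- The characteristic vector of a set of edges, with integer entries. -/
noncomputable def indVec (A : Set β) : β → ℤ := A.indicator 1

/-- The cycle lattice of `G`: all integer linear combinations of characteristic vectors of cycles.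
All of its elements vanish outside of `E(G)`. -/
def cycleLattice (G : Graph α β) : Submodule ℤ (β → ℤ) :=
  Submodule.span ℤ (indVec '' {C | IsCycle G C})

/-- A lattice cycle basis of `G`: a set of cycles of `G` whose characteristic vectors form a basis
of the cycle lattice of `G`. -/
structure IsLatticeCycleBasis (G : Graph α β) (B : Set (Set β)) : Prop where
  isCycle : ∀ C ∈ B, IsCycle G C
  linearIndependent : LinearIndependent ℤ (fun C : B => indVec (C : Set β))
  span_eq : Submodule.span ℤ (indVec '' B) = cycleLattice G

/-- `C` is the fundamental cycle of the edge `e ∉ T` with respect to the spanning tree `T`. -/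
structure IsFundamentalCycle (G : Graph α β) (T : Set β) (e : β) (C : Set β) : Prop where
  mem : e ∈ E(G)
  notMem : e ∉ T
  isCycle : IsCycle G C
  subset : C ⊆ insert e T

/-- `C` is a semi-fundamental cycle with respect to the spanning tree `T`: the symmetric difference
of the fundamental cycles of two distinct edges outside of `T`, where these two fundamental
cycles have at least one edge of `T` in common. -/
def IsSemiFundamentalCycle (G : Graph α β) (T : Set β) (C : Set β) : Prop :=
  ∃ (e f : β) (C₁ C₂ : Set β), e ≠ f ∧ IsFundamentalCycle G T e C₁ ∧ IsFundamentalCycle G T f C₂ ∧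
    (C₁ ∩ C₂ ∩ T).Nonempty ∧ C = symmDiff C₁ C₂

/-- A lattice cycle basis that is semi-fundamental with respect to the spanning tree `T`: it
contains all fundamental cycles, and all of its other members are semi-fundamental cycles. -/
structure IsSemiFundamentalBasis (G : Graph α β) (T : Set β) (B : Set (Set β)) : Prop where
  isLatticeCycleBasis : IsLatticeCycleBasis G B
  fundamental_mem : ∀ e C, IsFundamentalCycle G T e C → C ∈ B
  mem_cases : ∀ C ∈ B, (∃ e, IsFundamentalCycle G T e C) ∨ IsSemiFundamentalCycle G T C

end Graphs

/-! ### The machine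

A random access machine with registers and arrays of natural numbers. A program is a finite
text, so that it names a fixed finite number of registers and arrays. The only arithmetic is to
add or subtract one, so a run of `t` steps makes no number grow by more than `t` beyond the numbers
in the input and in the program: one step is a constant number of operations on words of
logarithmic length. -/

/-- A memory state: register `x` holds `reg x`, and cell `i` of array `a` holds `arr a i`. -/
structure State where
  reg : ℕ → ℕ
  arr : ℕ → ℕ → ℕ

/-- Elementary instructions. Registers and arrays are denoted by their numbers. -/
inductive Instr where
  /-- `x := k` for a constant `k` -/
  | const (x k : ℕ)
  /-- `x := y` -/
  | copy (x y : ℕ)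
  /-- `x := x + 1` -/
  | incr (x : ℕ)
  /-- `x := x - 1`, where `0 - 1 = 0` -/
  | decr (x : ℕ)
  /-- `x := a[y]` -/
  | load (x a y : ℕ)
  /-- `a[x] := y` -/
  | store (a x y : ℕ)

/-- `s.setReg x k` is `s` with the number `k` written into register `x`. -/
def State.setReg (s : State) (x k : ℕ) : State :=
  { s with reg := Function.update s.reg x k }

/-- The effect of an elementary instruction. -/
def Instr.apply : Instr → State → State
  | .const x k, s => s.setReg x k
  | .copy x y, s => s.setReg x (s.reg y)
  | .incr x, s => s.setReg x (s.reg x + 1)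
  | .decr x, s => s.setReg x (s.reg x - 1)
  | .load x a y, s => s.setReg x (s.arr a (s.reg y))
  | .store a x y, s =>
      { s with arr := Function.update s.arr a (Function.update (s.arr a) (s.reg x) (s.reg y)) }

/-- Tests compare the contents of two registers. -/
inductive Test where
  | eq (x y : ℕ)
  | ne (x y : ℕ)
  | lt (x y : ℕ)
  | le (x y : ℕ)

/-- The outcome of a test. -/
def Test.holds : Test → State → Prop
  | .eq x y, s => s.reg x = s.reg y
  | .ne x y, s => s.reg x ≠ s.reg y
  | .lt x y, s => s.reg x < s.reg y
  | .le x y, s => s.reg x ≤ s.reg y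

/-- Programs: instructions, sequential composition, branching, and while loops. -/
inductive Program where
  | instr (c : Instr)
  | seq (p q : Program)
  | ite (b : Test) (p q : Program)
  | loop (b : Test) (p : Program)

/-- `Runs p s t s'`: started in the memory state `s`, the program `p` halts in the memory state `s'`
after exactly `t` steps. Every instruction and every evaluation of a test is one step. -/
inductive Runs : Program → State → ℕ → State → Prop where
  | instr (c : Instr) (s : State) : Runs (.instr c) s 1 (c.apply s)
  | seq {p q : Program} {s s₁ s₂ : State} {t₁ t₂ : ℕ} :
      Runs p s t₁ s₁ → Runs q s₁ t₂ s₂ → Runs (.seq p q) s (t₁ + t₂) s₂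
  | ite_true {b : Test} {p q : Program} {s s' : State} {t : ℕ} :
      b.holds s → Runs p s t s' → Runs (.ite b p q) s (t + 1) s'
  | ite_false {b : Test} {p q : Program} {s s' : State} {t : ℕ} :
      ¬ b.holds s → Runs q s t s' → Runs (.ite b p q) s (t + 1) s'
  | loop_true {b : Test} {p : Program} {s s₁ s₂ : State} {t₁ t₂ : ℕ} :
      b.holds s → Runs p s t₁ s₁ → Runs (.loop b p) s₁ t₂ s₂ →
        Runs (.loop b p) s (t₁ + t₂ + 1) s₂
  | loop_false {b : Test} {p : Program} {s : State} :
      ¬ b.holds s → Runs (.loop b p) s 1 s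

/-! ### Input and output -/

/-- A family of lists stored in two arrays: the `i`-th list consists of the cells `a[j]` with
`off[i] ≤ j < off[i + 1]`, in this order. -/
def State.list (s : State) (off a i : ℕ) : List ℕ :=
  (List.range' (s.arr off i) (s.arr off (i + 1) - s.arr off i)).map (s.arr a)

/-- The memory state `s` holds the graph `G` with vertices `0, …, n - 1` and edges `0, …, m - 1`,
as an adjacency list, and the set `T` of edges. Registers `0` and `1` hold `n` and `m`, arrays
`0` and `1` hold the two ends of each edge, arrays `2` and `3` hold for each vertex the list of
its incident edges (in any order), array `4` marks the edges of `T`, and all other registers and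
arrays are blank. For `T = ∅`, the input is just the graph. -/
structure IsInput (n m : ℕ) (G : Graph ℕ ℕ) (T : Set ℕ) (s : State) : Prop where
  vertexSet_eq : V(G) = Set.Iio n
  edgeSet_eq : E(G) = Set.Iio m
  reg_zero : s.reg 0 = n
  reg_one : s.reg 1 = m
  ends : ∀ e < m, G.IsLink e (s.arr 0 e) (s.arr 1 e)
  offset_zero : s.arr 2 0 = 0
  offset_mono : ∀ v < n, s.arr 2 v ≤ s.arr 2 (v + 1)
  incident_nodup : ∀ v < n, (s.list 2 3 v).Nodup
  mem_incident : ∀ v < n, ∀ e, e ∈ s.list 2 3 v ↔ G.Inc e v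
  mark : ∀ e, s.arr 4 e = T.indicator 1 e
  reg_blank : ∀ x, 2 ≤ x → s.reg x = 0
  arr_blank : ∀ a, 5 ≤ a → ∀ i, s.arr a i = 0

/-- The memory state `s` holds the set `B` of sets of edges: register `2` holds the number of members
of `B`, and arrays `5` and `6` list the elements of each member, without repetitions of members
or of elements. -/
structure IsOutput (s : State) (B : Set (Set ℕ)) : Prop where
  elements_nodup : ∀ i < s.reg 2, (s.list 5 6 i).Nodup
  members_inj : Set.InjOn (fun i => {e | e ∈ s.list 5 6 i}) (Set.Iio (s.reg 2))
  eq_image : B = (fun i => {e | e ∈ s.list 5 6 i}) '' Set.Iio (s.reg 2)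

end CycleLattice

/-! Fix a spanning tree `T` and name each tree edge by its lower end. A cycle `C` meets every
fundamental cut in an even number of edges. So a tree edge `j` lies in `C` exactly when the number
c_j of non-tree edges of `C` whose fundamental cycles pass `j` is odd. Hence χ_C = Σ χ_ci(e) − 2y,
summed over the non-tree edges e of C, where y is supported on T and y_j = ⌊c_j / 2⌋. The function y
depends only on the set `cov` of fundamental cycles through j, and it vanishes where this set has at
most one element. Let Λ be the lattice of all such functions on T. If ci(e) and ci(f) share a tree
edge, then ci(e) △ ci(f) is a cycle, with vector χ_ci(e) + χ_ci(f) − 2χ_{ci(e) ∩ ci(f)}. It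
therefore suffices to find pairs whose intersections ci(e) ∩ ci(f) form a ℤ-basis of Λ; this is
`Good`, and `Models.isSemiFundamentalBasis` draws the conclusion.

The pairs are found by inserting the non-tree edges one at a time. Inserting e splits the classes of
tree edges (those with equal `cov`) along the path of e. The rank of Λ grows by one for each class
that meets this path and either is passed by exactly one earlier path, or is passed by at least two
and also has a member off the path. The set `reps e` picks one tree edge from each of these. Two
paths in a tree traverse their common part in consistent directions (`sgn_mul_sgn`), so on `reps e`
the intersection of ci(f) and ci(e) is, up to sign and the orientation given by e, the signed path
between the ends of f in the tree whose nodes are the components of T minus `reps e`. Earlier edges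
f that form a spanning tree on these components thus give vectors that generate all unit vectors on
`reps e` over ℤ (`Merge.single_mem`), and cuts show that they are independent
(`Merge.indep_insert`). Such edges f exist because the earlier edges connect the components
(`const_of_reps`); they are chosen greedily, as in Kruskal's algorithm (`Merge`).

For the running time, refining the classes costs O(n) per edge. Only edges with a representative
need the further O(m + n) scan of the earlier edges. Each of them produces a new pair, each pair
costs O(n), and there are at most n pairs since their intersections are independent functions on at
most n tree edges (`Good.card_le`). The tree itself is grown in n passes over the edges, and n ≤ m +
1 absorbs the terms in n². Existence for an arbitrary finite graph is read off from the correctness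
of the program after a renaming of vertices and edges. -/

namespace CycleLattice

/-- A rooted tree on the vertices `0, …, n - 1` with root `0`, in which the parent of a vertex is
smaller than the vertex, together with a multigraph with edges `0, …, m - 1` on the same vertices
which contains it: `X e` and `Y e` are the ends of the edge `e`, and `pe i` is the tree edge between
`i` and its parent `par i`. -/
structure TreeData where
  n : ℕ
  m : ℕ
  par : ℕ → ℕ
  pe : ℕ → ℕ
  X : ℕ → ℕ
  Y : ℕ → ℕ
  n_pos : 0 < n
  par_lt : ∀ i, 0 < i → par i < i
  pe_lt : ∀ i, 0 < i → i < n → pe i < m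
  X_lt : ∀ e < m, X e < n
  Y_lt : ∀ e < m, Y e < n
  ends_pe : ∀ i, 0 < i → i < n →
    X (pe i) = i ∧ Y (pe i) = par i ∨ X (pe i) = par i ∧ Y (pe i) = i

/-! ### Ancestors, paths and signs in a rooted tree. -/

namespace TreeData

variable (D : TreeData)

/-- The vertices other than the root on the path from the root to `i`. -/
def anc : ℕ → Finset ℕ
  | 0 => ∅
  | i + 1 => insert (i + 1) (anc (D.par (i + 1)))
termination_by i => i
decreasing_by exact D.par_lt _ (Nat.succ_pos _)

@[simp] lemma anc_zero : D.anc 0 = ∅ := by rw [anc]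

lemma anc_of_pos {i : ℕ} (hi : 0 < i) : D.anc i = insert i (D.anc (D.par i)) := by
  obtain ⟨k, rfl⟩ := Nat.exists_eq_succ_of_ne_zero hi.ne'
  rw [anc]

lemma mem_anc_bounds {i j : ℕ} (h : j ∈ D.anc i) : 0 < j ∧ j ≤ i := by
  induction i using Nat.strong_induction_on with
  | _ i ih =>
    rcases Nat.eq_zero_or_pos i with rfl | hi
    · simp at h
    · rw [D.anc_of_pos hi, Finset.mem_insert] at h
      rcases h with rfl | h
      · exact ⟨hi, le_rfl⟩
      · have := ih _ (D.par_lt i hi) h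
        have := D.par_lt i hi
        omega

lemma self_mem_anc {i : ℕ} (hi : 0 < i) : i ∈ D.anc i := by
  rw [D.anc_of_pos hi]; exact Finset.mem_insert_self _ _

lemma notMem_anc_par {i : ℕ} (hi : 0 < i) : i ∉ D.anc (D.par i) := fun h => by
  have := D.mem_anc_bounds h
  have := D.par_lt i hi
  omega

lemma mem_anc_par {i j : ℕ} (hi : 0 < i) : j ∈ D.anc (D.par i) ↔ j ∈ D.anc i ∧ j ≠ i := by
  rw [D.anc_of_pos hi, Finset.mem_insert]
  constructor
  · intro h
    exact ⟨Or.inr h, fun h' => D.notMem_anc_par hi (h' ▸ h)⟩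
  · rintro ⟨h | h, h'⟩
    · exact absurd h h'
    · exact h

lemma anc_subset {i k : ℕ} (h : i ∈ D.anc k) : D.anc i ⊆ D.anc k := by
  induction k using Nat.strong_induction_on with
  | _ k ih =>
    rcases Nat.eq_zero_or_pos k with rfl | hk
    · simp at h
    · by_cases hik : i = k
      · rw [hik]
      · refine (ih _ (D.par_lt k hk) ((D.mem_anc_par hk).2 ⟨h, hik⟩)).trans ?_
        intro j hj
        exact ((D.mem_anc_par hk).1 hj).1

/-- The ancestors of a vertex form a chain; parents being smaller than children, the numerical order
on it is the order by depth. -/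
lemma anc_chain {i j k : ℕ} (hi : i ∈ D.anc k) (hj : j ∈ D.anc k) (hij : i ≤ j) :
    i ∈ D.anc j := by
  induction k using Nat.strong_induction_on with
  | _ k ih =>
    rcases Nat.eq_zero_or_pos k with rfl | hk
    · simp at hi
    · by_cases hjk : j = k
      · rwa [hjk]
      · by_cases hik : i = k
        · have := (D.mem_anc_bounds hj).2
          omega
        · exact ih _ (D.par_lt k hk) ((D.mem_anc_par hk).2 ⟨hi, hik⟩)
            ((D.mem_anc_par hk).2 ⟨hj, hjk⟩)

/-- The tree path between the ends of the edge `e`, given by the lower ends of its edges. -/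
def path (e : ℕ) : Finset ℕ := symmDiff (D.anc (D.X e)) (D.anc (D.Y e))

lemma mem_path {e j : ℕ} : j ∈ D.path e ↔
    j ∈ D.anc (D.X e) ∧ j ∉ D.anc (D.Y e) ∨ j ∈ D.anc (D.Y e) ∧ j ∉ D.anc (D.X e) := by
  rw [path, Finset.mem_symmDiff]

lemma path_bounds {e j : ℕ} (he : e < D.m) (h : j ∈ D.path e) : 0 < j ∧ j < D.n := by
  rw [mem_path] at h
  have hX := D.X_lt e he
  have hY := D.Y_lt e he
  rcases h with h | h
  · have := D.mem_anc_bounds h.1; omega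
  · have := D.mem_anc_bounds h.1; omega

lemma path_pe {i : ℕ} (hi : 0 < i) (hn : i < D.n) : D.path (D.pe i) = {i} := by
  ext j
  rw [mem_path, Finset.mem_singleton]
  have h1 := D.self_mem_anc hi
  rcases D.ends_pe i hi hn with ⟨h, h'⟩ | ⟨h, h'⟩ <;> rw [h, h', D.mem_anc_par hi] <;>
    constructor
  · rintro (h2 | h2) <;> tauto
  · rintro rfl; tauto
  · rintro (h2 | h2) <;> tauto
  · rintro rfl; tauto

lemma pe_inj {i j : ℕ} (hi : 0 < i) (hin : i < D.n) (hj : 0 < j) (hjn : j < D.n)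
    (h : D.pe i = D.pe j) : i = j := by
  have := D.path_pe hi hin
  rw [h, D.path_pe hj hjn] at this
  exact (Finset.singleton_injective this).symm

/-- `1` if `j` is an ancestor of `x`, and `0` otherwise. -/
def ind (x j : ℕ) : ℤ := if j ∈ D.anc x then 1 else 0

/-- The orientation of the tree edge `j` with respect to the path of the edge `e`. -/
def sgn (e j : ℕ) : ℤ := D.ind (D.X e) j - D.ind (D.Y e) j

lemma sgn_ne_zero_iff {e j : ℕ} : D.sgn e j ≠ 0 ↔ j ∈ D.path e := by
  rw [mem_path, sgn, ind, ind]
  by_cases h1 : j ∈ D.anc (D.X e) <;> by_cases h2 : j ∈ D.anc (D.Y e) <;> simp [h1, h2]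

lemma sgn_eq_zero {e j : ℕ} (h : j ∉ D.path e) : D.sgn e j = 0 := by
  by_contra h'; exact h (D.sgn_ne_zero_iff.1 h')

lemma sgn_sq {e j : ℕ} (h : j ∈ D.path e) : D.sgn e j * D.sgn e j = 1 := by
  rw [mem_path] at h
  rw [sgn, ind, ind]
  rcases h with h | h <;> simp [h.1, h.2]

lemma sgn_eq_or {e j : ℕ} (h : j ∈ D.path e) : D.sgn e j = 1 ∨ D.sgn e j = -1 :=
  mul_self_eq_one_iff.1 (D.sgn_sq h)

/-- The path of `e` consists of two branches with constant sign on each. For `i ≤ j` on the path,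
both are on the same branch exactly when `i` is an ancestor of `j`. This criterion does not involve
`e`, so the sign changes of two paths agree on their common part. -/
lemma sgn_eq_ite {e i j : ℕ} (hi : i ∈ D.path e) (hj : j ∈ D.path e) (hij : i ≤ j) :
    D.sgn e i = if i ∈ D.anc j then D.sgn e j else -D.sgn e j := by
  rw [mem_path] at hi hj
  have a1 : i ∈ D.anc (D.X e) → j ∈ D.anc (D.X e) → i ∈ D.anc j :=
    fun h h' => D.anc_chain h h' hij
  have a2 : i ∈ D.anc (D.Y e) → j ∈ D.anc (D.Y e) → i ∈ D.anc j :=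
    fun h h' => D.anc_chain h h' hij
  have b1 : i ∈ D.anc j → j ∈ D.anc (D.X e) → i ∈ D.anc (D.X e) :=
    fun h h' => D.anc_subset h' h
  have b2 : i ∈ D.anc j → j ∈ D.anc (D.Y e) → i ∈ D.anc (D.Y e) :=
    fun h h' => D.anc_subset h' h
  simp only [sgn, ind]
  rcases hi with ⟨p1, p2⟩ | ⟨p1, p2⟩ <;> rcases hj with ⟨q1, q2⟩ | ⟨q1, q2⟩ <;>
    by_cases h : i ∈ D.anc j <;> simp [p1, p2, q1, q2, h] <;> tauto

lemma sgn_mul_consistent {e f i j : ℕ} (hie : i ∈ D.path e) (hif : i ∈ D.path f)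
    (hje : j ∈ D.path e) (hjf : j ∈ D.path f) (hij : i ≤ j) :
    D.sgn e i * D.sgn f i = D.sgn e j * D.sgn f j := by
  rw [D.sgn_eq_ite hie hje hij, D.sgn_eq_ite hif hjf hij]
  split_ifs <;> ring

/-- Two tree paths traverse their common part in the same direction throughout or in opposite
directions throughout. This makes unsigned intersections accessible to telescoping sums of signed
paths. -/
lemma sgn_mul_sgn (e f : ℕ) : ∃ ε : ℤ, (ε = 1 ∨ ε = -1) ∧
    ∀ j, D.sgn e j * D.sgn f j = ε * if j ∈ D.path f ∩ D.path e then 1 else 0 := by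
  by_cases h : ∃ i, i ∈ D.path f ∩ D.path e
  · obtain ⟨i, hi⟩ := h
    rw [Finset.mem_inter] at hi
    refine ⟨D.sgn e i * D.sgn f i, ?_, fun j => ?_⟩
    · rcases D.sgn_eq_or hi.1 with h | h <;> rcases D.sgn_eq_or hi.2 with h' | h' <;>
        simp [h, h']
    · split_ifs with hj
      · rw [Finset.mem_inter] at hj
        rw [mul_one]
        rcases le_total i j with hij | hij
        · exact (D.sgn_mul_consistent hi.2 hi.1 hj.2 hj.1 hij).symm
        · exact D.sgn_mul_consistent hj.2 hj.1 hi.2 hi.1 hij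
      · rw [mul_zero]
        rw [Finset.mem_inter, not_and_or] at hj
        rcases hj with hj | hj <;> simp [D.sgn_eq_zero hj]
  · refine ⟨1, Or.inl rfl, fun j => ?_⟩
    have hj : j ∉ D.path f ∩ D.path e := fun h' => h ⟨j, h'⟩
    rw [if_neg hj]
    rw [Finset.mem_inter, not_and_or] at hj
    rcases hj with hj | hj <;> simp [D.sgn_eq_zero hj]

/-- A telescoping sum along the path to the root. -/
lemma sum_anc {M : Type*} [AddCommGroup M] (g : ℕ → M) (x : ℕ) :
    ∑ j ∈ D.anc x, (g j - g (D.par j)) = g x - g 0 := by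
  induction x using Nat.strong_induction_on with
  | _ x ih =>
    rcases Nat.eq_zero_or_pos x with rfl | hx
    · simp
    · rw [D.anc_of_pos hx, Finset.sum_insert (D.notMem_anc_par hx), ih _ (D.par_lt x hx)]
      abel

lemma sum_ind (g : ℕ → ℤ) {x : ℕ} {R : Finset ℕ}
    (hR : ∀ j ∈ D.anc x, j ∉ R → g j = g (D.par j)) :
    ∑ j ∈ R, D.ind x j * (g j - g (D.par j)) = g x - g 0 := by
  rw [← D.sum_anc g x]
  simp only [ind, ite_mul, one_mul, zero_mul]
  rw [← Finset.sum_filter]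
  refine Finset.sum_subset ?_ ?_
  · intro j hj
    exact (Finset.mem_filter.1 hj).2
  · intro j hj hj'
    rw [Finset.mem_filter] at hj'
    rw [hR j hj (fun h => hj' ⟨h, hj⟩), sub_self]

/-- The increments of `g` along the path of `e` add up to the difference of the values at its ends;
only tree edges at which `g` changes contribute, and `R` contains all of these. -/
lemma sum_sgn (g : ℕ → ℤ) {e : ℕ} {R : Finset ℕ} (he : e < D.m)
    (hR : ∀ j, 0 < j → j < D.n → j ∉ R → g j = g (D.par j)) :
    ∑ j ∈ R, D.sgn e j * (g j - g (D.par j)) = g (D.X e) - g (D.Y e) := by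
  have hX := D.X_lt e he
  have hY := D.Y_lt e he
  simp only [sgn, sub_mul, Finset.sum_sub_distrib]
  rw [D.sum_ind g, D.sum_ind g]
  · ring
  · intro j hj
    have := D.mem_anc_bounds hj
    exact hR j (by omega) (by omega)
  · intro j hj
    have := D.mem_anc_bounds hj
    exact hR j (by omega) (by omega)

end TreeData

/-! ### Classes of tree edges, their representatives, and connectivity. -/

namespace TreeData

variable (D : TreeData)

/-- `e` is an edge of the tree. -/
def IsTree (e : ℕ) : Prop := ∃ i, 0 < i ∧ i < D.n ∧ D.pe i = e

/-- The edges `f < k` outside of the tree whose path contains the tree edge `j`. -/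
noncomputable def cov (k j : ℕ) : Finset ℕ :=
  @Finset.filter _ (fun f => ¬ D.IsTree f ∧ j ∈ D.path f) (Classical.decPred _) (Finset.range k)

lemma mem_cov {k j f : ℕ} : f ∈ D.cov k j ↔ f < k ∧ ¬ D.IsTree f ∧ j ∈ D.path f := by
  simp only [cov, Finset.mem_filter, Finset.mem_range]

/-- One representative from each class of tree edges that arises, when the edge `e` is added, from
a class of tree edges which at least one earlier path passes, unless the path of `e` contains the
whole class and at least two earlier paths pass it. -/
noncomputable def reps (e : ℕ) : Finset ℕ :=
  @Finset.filter _ (fun i => (D.cov e i).Nonempty ∧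
    ((D.cov e i).card = 1 ∨ ∃ i', 0 < i' ∧ i' < D.n ∧ i' ∉ D.path e ∧ D.cov e i' = D.cov e i) ∧
    ∀ i' ∈ D.path e, i' < i → D.cov e i' ≠ D.cov e i) (Classical.decPred _) (D.path e)

lemma mem_reps {e i : ℕ} : i ∈ D.reps e ↔ i ∈ D.path e ∧ (D.cov e i).Nonempty ∧
    ((D.cov e i).card = 1 ∨ ∃ i', 0 < i' ∧ i' < D.n ∧ i' ∉ D.path e ∧ D.cov e i' = D.cov e i) ∧
    ∀ i' ∈ D.path e, i' < i → D.cov e i' ≠ D.cov e i := by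
  simp only [reps, Finset.mem_filter]

lemma reps_inj {e i j : ℕ} (hi : i ∈ D.reps e) (hj : j ∈ D.reps e)
    (h : D.cov e i = D.cov e j) : i = j := by
  rw [mem_reps] at hi hj
  rcases lt_trichotomy i j with hij | hij | hij
  · exact absurd h (hj.2.2.2 i hi.1 hij)
  · exact hij
  · exact absurd h.symm (hi.2.2.2 j hj.1 hij)

/-- Both conditions depend only on the class, so its smallest member on the path of `e` is a
representative. -/
lemma exists_rep {e i : ℕ} (hi : i ∈ D.path e) (h1 : (D.cov e i).Nonempty)
    (h2 : (D.cov e i).card = 1 ∨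
      ∃ i', 0 < i' ∧ i' < D.n ∧ i' ∉ D.path e ∧ D.cov e i' = D.cov e i) :
    ∃ j ∈ D.reps e, D.cov e j = D.cov e i := by
  classical
  have hex : ∃ j, j ∈ D.path e ∧ D.cov e j = D.cov e i := ⟨i, hi, rfl⟩
  obtain ⟨hj, hji⟩ := Nat.find_spec hex
  refine ⟨Nat.find hex, D.mem_reps.2 ⟨hj, by rwa [hji], by rwa [hji], fun i' hi' hlt heq => ?_⟩, hji⟩
  exact Nat.find_min hex hlt ⟨hi', heq.trans hji⟩

lemma ind_eq_or (x j : ℕ) : D.ind x j = 0 ∨ D.ind x j = 1 := by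
  rw [ind]; split_ifs <;> simp

lemma ind_sub_par {x i : ℕ} (hx : 0 < x) (h : i ≠ x) : D.ind x i = D.ind (D.par x) i := by
  simp [ind, D.mem_anc_par hx, h]

lemma mem_path_iff_ind {e j : ℕ} : j ∈ D.path e ↔ D.ind (D.X e) j ≠ D.ind (D.Y e) j := by
  rw [← D.sgn_ne_zero_iff, sgn, sub_ne_zero]

/-- A function on the vertices that changes only along the path of `e` is constant on the side of
a tree edge `j` outside of this path that does not contain the path. -/
lemma far_const {e j : ℕ} (hj : j ∉ D.path e) (g : ℕ → ℤ)
    (hg : ∀ i, 0 < i → i < D.n → i ∉ D.path e → g i = g (D.par i)) {u v : ℕ} (hun : u < D.n)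
    (hvn : v < D.n) (hu : D.ind u j ≠ D.ind (D.X e) j) (hv : D.ind v j ≠ D.ind (D.X e) j) :
    g u = g v := by
  rw [mem_path] at hj
  -- If `j` lies above both ends of `e`, the side away from the path is the complement of the
  -- subtree at `j` and contains the root; otherwise `j` lies above neither end, and that side is
  -- the subtree at `j`. Accordingly values are compared with `g 0` or with `g j`.
  by_cases hX : j ∈ D.anc (D.X e)
  · have hY : j ∈ D.anc (D.Y e) := by tauto
    suffices key : ∀ w < D.n, D.ind w j ≠ D.ind (D.X e) j → g w = g 0 by
      rw [key u hun hu, key v hvn hv]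
    intro w hwn hw
    have hjw : j ∉ D.anc w := by
      intro h; apply hw; simp [ind, h, hX]
    rw [← sub_eq_zero, ← D.sum_anc g w]
    refine Finset.sum_eq_zero fun i hi => ?_
    have hb := D.mem_anc_bounds hi
    rw [sub_eq_zero]
    refine hg i hb.1 (by omega) fun hip => ?_
    have hji : j ∉ D.anc i := fun h => hjw (D.anc_subset hi h)
    rw [mem_path] at hip
    rcases hip with ⟨h1, h2⟩ | ⟨h1, h2⟩
    · rcases le_total i j with hij | hij
      · exact h2 (D.anc_subset hY (D.anc_chain h1 hX hij))
      · exact hji (D.anc_chain hX h1 hij)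
    · rcases le_total i j with hij | hij
      · exact h2 (D.anc_subset hX (D.anc_chain h1 hY hij))
      · exact hji (D.anc_chain hY h1 hij)
  · have hY : j ∉ D.anc (D.Y e) := by tauto
    suffices key : ∀ w < D.n, j ∈ D.anc w → g w = g j by
      rw [key u hun, key v hvn]
      · by_contra h; apply hv; simp [ind, h, hX]
      · by_contra h; apply hu; simp [ind, h, hX]
    intro w
    induction w using Nat.strong_induction_on with
    | _ w ih =>
      intro hwn hw
      by_cases hjw : j = w
      · rw [hjw]
      · have hw0 : 0 < w := by have := D.mem_anc_bounds hw; omega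
        have hpar := D.par_lt w hw0
        rw [hg w hw0 hwn, ih _ hpar (by omega) ((D.mem_anc_par hw0).2 ⟨hw, hjw⟩)]
        rw [mem_path]
        rintro (h | h)
        · exact hX (D.anc_subset h.1 hw)
        · exact hY (D.anc_subset h.1 hw)

/-- The position of the tree edge `z` on the path of `e`. -/
def pos (e z : ℕ) : ℤ := if z ∈ D.anc (D.X e) then -z else z

lemma pos_inj {e z w : ℕ} (hz : z ∈ D.path e) (hw : w ∈ D.path e)
    (h : D.pos e z = D.pos e w) : z = w := by
  have h1 : 0 < z := by
    rw [mem_path] at hz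
    rcases hz with hz | hz <;> exact (D.mem_anc_bounds hz.1).1
  have h2 : 0 < w := by
    rw [mem_path] at hw
    rcases hw with hz | hz <;> exact (D.mem_anc_bounds hz.1).1
  unfold pos at h
  split_ifs at h <;> omega

/-- The sides of the tree edges on the path of `e` that contain the first end of `e` are nested. -/
lemma side_nested {e z w v : ℕ} (hz : z ∈ D.path e) (hw : w ∈ D.path e)
    (h : D.pos e z < D.pos e w) (hv : D.ind v z = D.ind (D.X e) z) :
    D.ind v w = D.ind (D.X e) w := by
  have hz' := D.mem_path.1 hz
  have hw' := D.mem_path.1 hw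
  -- On the way from `X e` to `Y e` the labels decrease along the first branch and increase along
  -- the second, so `pos` increases all the way.
  simp only [pos] at h
  simp only [ind] at hv ⊢
  by_cases h1 : z ∈ D.anc (D.X e) <;> by_cases h2 : w ∈ D.anc (D.X e) <;>
    simp only [h1, h2, if_true, if_false] at h hv ⊢
  · have hzv : z ∈ D.anc v := by by_contra h; simp [h] at hv
    rw [if_pos]
    exact D.anc_subset hzv (D.anc_chain h2 h1 (by omega))
  · have hzv : z ∈ D.anc v := by by_contra h; simp [h] at hv
    have h3 : w ∈ D.anc (D.Y e) := by tauto
    have h4 : z ∉ D.anc (D.Y e) := by tauto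
    rw [if_neg]
    intro hwv
    rcases le_total z w with hzw | hzw
    · exact h4 (D.anc_subset h3 (D.anc_chain hzv hwv hzw))
    · exact h2 (D.anc_subset h1 (D.anc_chain hwv hzv hzw))
  · omega
  · have hzv : z ∉ D.anc v := by by_contra h; simp [h] at hv
    have h3 : w ∈ D.anc (D.Y e) := by tauto
    have h4 : z ∈ D.anc (D.Y e) := by tauto
    rw [if_neg]
    intro hwv
    exact hzv (D.anc_subset hwv (D.anc_chain h4 h3 (by omega)))

/-- The edge `z` separates the ends of `f`, so they can be named with `p` on the side of `X e`. The
last clause transfers equalities between values at the ends, whichever end `p` is. -/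
lemma exists_ends {e f z : ℕ} (hf : f < D.m) (hz : z ∈ D.path f) : ∃ p q, p < D.n ∧ q < D.n ∧
    D.ind p z = D.ind (D.X e) z ∧ D.ind q z ≠ D.ind (D.X e) z ∧
    (∀ w, w ∈ D.path f ↔ D.ind p w ≠ D.ind q w) ∧
    ∀ g : ℕ → ℤ, g (D.X f) = g (D.Y f) → g p = g q := by
  have hX := D.X_lt f hf
  have hY := D.Y_lt f hf
  rw [mem_path_iff_ind] at hz
  by_cases h : D.ind (D.X f) z = D.ind (D.X e) z
  · exact ⟨D.X f, D.Y f, hX, hY, h, fun h' => hz (h.trans h'.symm),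
      fun w => D.mem_path_iff_ind, fun g h => h⟩
  · refine ⟨D.Y f, D.X f, hY, hX, ?_, h, fun w => D.mem_path_iff_ind.trans ne_comm,
      fun g h => h.symm⟩
    rcases D.ind_eq_or (D.X f) z with h1 | h1 <;> rcases D.ind_eq_or (D.Y f) z with h2 | h2 <;>
      rcases D.ind_eq_or (D.X e) z with h3 | h3 <;> simp_all

/-- The earlier edges connect the components that arise when the representatives are removed from
the tree. -/
theorem const_of_reps {e : ℕ} (he : e < D.m) (g : ℕ → ℤ)
    (h1 : ∀ j, 0 < j → j < D.n → j ∉ D.reps e → g j = g (D.par j))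
    (h2 : ∀ f < e, ¬ D.IsTree f → g (D.X f) = g (D.Y f)) :
    ∀ j, 0 < j → j < D.n → g j = g (D.par j) := by
  by_contra! hcon
  obtain ⟨j₀, hj₀, hj₀n, hj₀g⟩ := hcon
  -- These are the tree edges where `g` changes. Going from `X e` to `Y e`, let `z₁` and `z₂` be the
  -- first two of them: `g` equals `g (X e)` on the near side of `z₁` (`hin`) and differs from it
  -- between `z₁` and `z₂` (`hout`).
  set Z := (D.reps e).filter fun j => g j ≠ g (D.par j) with hZ
  have memZ : ∀ {z}, z ∈ Z ↔ z ∈ D.reps e ∧ g z ≠ g (D.par z) := by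
    intro z; rw [hZ, Finset.mem_filter]
  have hZp : ∀ {z}, z ∈ Z → z ∈ D.path e := fun hz => (D.mem_reps.1 (memZ.1 hz).1).1
  have hZn : Z.Nonempty := by
    refine ⟨j₀, memZ.2 ⟨?_, hj₀g⟩⟩
    by_contra h
    exact hj₀g (h1 j₀ hj₀ hj₀n h)
  have hg : ∀ i, 0 < i → i < D.n → i ∉ Z → g i = g (D.par i) := by
    intro i hi hin hiZ
    by_cases h : i ∈ D.reps e
    · by_contra h'; exact hiZ (memZ.2 ⟨h, h'⟩)
    · exact h1 i hi hin h
  have hXe := D.X_lt e he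
  have hform : ∀ v < D.n, g v - g (D.X e) =
      ∑ j ∈ Z, (D.ind v j - D.ind (D.X e) j) * (g j - g (D.par j)) := by
    have hh : ∀ v < D.n, ∑ j ∈ Z, D.ind v j * (g j - g (D.par j)) = g v - g 0 := by
      intro v hv
      refine D.sum_ind g fun j hj hjZ => ?_
      have := D.mem_anc_bounds hj
      exact hg j this.1 (by omega) hjZ
    intro v hv
    simp only [sub_mul, Finset.sum_sub_distrib]
    rw [hh v hv, hh _ hXe]
    ring
  obtain ⟨z₁, hz₁, hmin₁⟩ := Finset.exists_min_image Z (D.pos e) hZn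
  have hlt₁ : ∀ z ∈ Z, z ≠ z₁ → D.pos e z₁ < D.pos e z := by
    intro z hz hne
    refine lt_of_le_of_ne (hmin₁ z hz) fun h => hne (D.pos_inj (hZp hz) (hZp hz₁) h.symm)
  have hin : ∀ v < D.n, D.ind v z₁ = D.ind (D.X e) z₁ → g v = g (D.X e) := by
    intro v hv h
    rw [← sub_eq_zero, hform v hv]
    refine Finset.sum_eq_zero fun j hj => ?_
    by_cases hjz : j = z₁
    · rw [hjz, h, sub_self, zero_mul]
    · rw [D.side_nested (hZp hz₁) (hZp hj) (hlt₁ j hj hjz) h, sub_self, zero_mul]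
  have hout : ∀ v < D.n, D.ind v z₁ ≠ D.ind (D.X e) z₁ →
      (∀ z ∈ Z, z ≠ z₁ → D.ind v z = D.ind (D.X e) z) → g v ≠ g (D.X e) := by
    intro v hv h h' heq
    rw [← sub_eq_zero, hform v hv, Finset.sum_eq_single z₁] at heq
    · rcases mul_eq_zero.1 heq with h3 | h3
      · exact h (sub_eq_zero.1 h3)
      · exact (memZ.1 hz₁).2 (sub_eq_zero.1 h3)
    · intro z hz hne
      rw [h' z hz hne, sub_self, zero_mul]
    · intro h; exact absurd hz₁ h
  have hends : ∀ f ∈ D.cov e z₁, ∃ p q, p < D.n ∧ q < D.n ∧ D.ind p z₁ = D.ind (D.X e) z₁ ∧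
      D.ind q z₁ ≠ D.ind (D.X e) z₁ ∧ (∀ w, w ∈ D.path f ↔ D.ind p w ≠ D.ind q w) ∧
      g p = g (D.X e) ∧ g q = g (D.X e) := by
    intro f hf
    obtain ⟨hfe, hft, hfz⟩ := D.mem_cov.1 hf
    obtain ⟨p, q, hp, hq, h3, h4, h5, h6⟩ := D.exists_ends (e := e) (hfe.trans he) hfz
    have := hin p hp h3
    exact ⟨p, q, hp, hq, h3, h4, h5, this, (h6 g (h2 f hfe hft)).symm.trans this⟩
  -- Some earlier edge passes `z₁`. If `z₁` were the only change of `g`, the two ends of that edge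
  -- would have different values.
  obtain ⟨f₁, hf₁⟩ := (D.mem_reps.1 (memZ.1 hz₁).1).2.1
  have hZ2 : (Z.erase z₁).Nonempty := by
    by_contra hne
    rw [Finset.not_nonempty_iff_eq_empty] at hne
    obtain ⟨p, q, hp, hq, h3, h4, h5, h6, h7⟩ := hends f₁ hf₁
    refine hout q hq h4 (fun z hz hz' => ?_) h7
    have : z ∈ Z.erase z₁ := Finset.mem_erase.2 ⟨hz', hz⟩
    simp [hne] at this
  obtain ⟨z₂, hz₂', hmin₂⟩ := Finset.exists_min_image (Z.erase z₁) (D.pos e) hZ2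
  obtain ⟨hz₂₁, hz₂⟩ := Finset.mem_erase.1 hz₂'
  have hnest : ∀ v, D.ind v z₂ = D.ind (D.X e) z₂ →
      ∀ z ∈ Z, z ≠ z₁ → D.ind v z = D.ind (D.X e) z := by
    intro v hv z hz hne
    by_cases hzz : z = z₂
    · rw [hzz, hv]
    · refine D.side_nested (hZp hz₂) (hZp hz) (lt_of_le_of_ne
        (hmin₂ z (Finset.mem_erase.2 ⟨hne, hz⟩)) fun h => ?_) hv
      exact hzz (D.pos_inj (hZp hz) (hZp hz₂) h.symm)
  -- An earlier edge through `z₁` has the value `g (X e)` at both ends, so its further end is not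
  -- between `z₁` and `z₂`: it passes `z₂` too.
  have hsub : D.cov e z₁ ⊆ D.cov e z₂ := by
    intro f hf
    obtain ⟨hfe, hft, hfz⟩ := D.mem_cov.1 hf
    obtain ⟨p, q, hp, hq, h3, h4, h5, h6, h7⟩ := hends f hf
    refine D.mem_cov.2 ⟨hfe, hft, (h5 z₂).2 fun h => ?_⟩
    refine hout q hq h4 (hnest q ?_) h7
    rw [← h]
    exact D.side_nested (hZp hz₁) (hZp hz₂) (hlt₁ z₂ hz₂ hz₂₁) h3
  have hne : D.cov e z₁ ≠ D.cov e z₂ := fun h =>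
    hz₂₁ (D.reps_inj (memZ.1 hz₂).1 (memZ.1 hz₁).1 h.symm)
  obtain ⟨f₂, hf₂, hf₂'⟩ : ∃ f, f ∈ D.cov e z₂ ∧ f ∉ D.cov e z₁ := by
    by_contra! h
    exact hne (Finset.Subset.antisymm hsub h)
  -- The inclusion of `cov e z₁` in `cov e z₂` is proper and `cov e z₁` is nonempty, so at least two
  -- earlier paths pass `z₂`. Hence `z₂` is a representative because of a member `j` of its class
  -- off the path of `e`. Both `f₁` and `f₂` pass `j`.
  obtain ⟨j, hj0, hjn, hjp, hjc⟩ := (D.mem_reps.1 (memZ.1 hz₂).1).2.2.1.resolve_left (by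
    intro h
    refine hne (Finset.eq_of_subset_of_card_le hsub ?_)
    rw [h]
    exact Finset.card_pos.2 ⟨f₁, hf₁⟩)
  obtain ⟨p, q, hp, hq, h3, h4, h5, h6, h7⟩ := hends f₁ hf₁
  obtain ⟨hf₂e, hf₂t, hf₂z⟩ := D.mem_cov.1 hf₂
  obtain ⟨p₂, q₂, hp₂, hq₂, k3, k4, k5, k6⟩ := D.exists_ends (e := e) (hf₂e.trans he) hf₂z
  have kg := k6 g (h2 f₂ hf₂e hf₂t)
  have hz₂p := D.side_nested (hZp hz₁) (hZp hz₂) (hlt₁ z₂ hz₂ hz₂₁) h3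
  have hz₂q : D.ind q z₂ ≠ D.ind (D.X e) z₂ := fun h => hout q hq h4 (hnest q h) h7
  have kq1 : D.ind q₂ z₁ ≠ D.ind (D.X e) z₁ := fun h =>
    k4 (D.side_nested (hZp hz₁) (hZp hz₂) (hlt₁ z₂ hz₂ hz₂₁) h)
  have kp1 : D.ind p₂ z₁ ≠ D.ind (D.X e) z₁ := by
    intro h
    exact hf₂' (D.mem_cov.2 ⟨hf₂e, hf₂t, (k5 z₁).2 fun h' => kq1 (h' ▸ h)⟩)
  have kgp : g p₂ ≠ g (D.X e) := hout p₂ hp₂ kp1 (hnest p₂ k3)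
  have hjf₁ : D.ind p j ≠ D.ind q j :=
    (h5 j).1 (D.mem_cov.1 (hjc ▸ hsub hf₁ : f₁ ∈ D.cov e j)).2.2
  have hjf₂ : D.ind p₂ j ≠ D.ind q₂ j :=
    (k5 j).1 (D.mem_cov.1 (hjc ▸ hf₂ : f₂ ∈ D.cov e j)).2.2
  have hfar : ∀ a b, D.ind a j ≠ D.ind b j →
      D.ind a j ≠ D.ind (D.X e) j ∨ D.ind b j ≠ D.ind (D.X e) j := by
    intro a b h
    by_contra! h'
    exact h (h'.1.trans h'.2.symm)
  have hpath : ∀ z ∈ D.path e, ∀ i, 0 < i → i < D.n → i ∉ D.path e →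
      D.ind i z = D.ind (D.par i) z := fun z hz i hi _ hip =>
    D.ind_sub_par hi fun h => hip (h ▸ hz)
  have far₁ := fun {u v} => D.far_const (u := u) (v := v) hjp (fun x => D.ind x z₁)
    (hpath z₁ (hZp hz₁))
  have far₂ := fun {u v} => D.far_const (u := u) (v := v) hjp (fun x => D.ind x z₂)
    (hpath z₂ (hZp hz₂))
  have far₃ := fun {u v} => D.far_const (u := u) (v := v) hjp g
    (fun i hi hin hip => hg i hi hin fun h => hip (hZp h))
  -- Each of `f₁` and `f₂` has an end on the side of `j` away from the path, and this side is split
  -- neither by `z₁` nor by `z₂`, nor by a change of `g`. Since `p` is before `z₁`, `p₂` between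
  -- `z₁` and `z₂`, and `q`, `q₂` beyond `z₂`, only `q` and `q₂` could be there together. Then `g q₂
  -- = g q = g (X e)`, although `g q₂ = g p₂` differs from `g (X e)`.
  rcases hfar p q hjf₁ with hpf | hqf <;> rcases hfar p₂ q₂ hjf₂ with hpf₂ | hqf₂
  · exact kp1 ((far₁ hp₂ hp hpf₂ hpf).trans h3)
  · exact k4 ((far₂ hq₂ hp hqf₂ hpf).trans hz₂p)
  · exact hz₂q ((far₂ hq hp₂ hqf hpf₂).trans k3)
  · exact kgp (kg.trans ((far₃ hq₂ hq hqf₂ hqf).trans h7))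

end TreeData

/-- Applied to a linear relation, `φ` leaves only the term of `a`, whose coefficient must vanish
because ℤ has no zero divisors. -/
lemma LinearIndepOn.insert_of_functional {ι M : Type*} [DecidableEq ι] [AddCommGroup M] {v : ι → M}
    {S : Finset ι} (hS : LinearIndepOn ℤ v (S : Set ι)) {a : ι} (φ : M →ₗ[ℤ] ℤ)
    (ha : φ (v a) ≠ 0) (h : ∀ b ∈ S, φ (v b) = 0) :
    LinearIndepOn ℤ v ((insert a S : Finset ι) : Set ι) := by
  rw [linearIndepOn_finset_iff] at hS ⊢
  have haS : a ∉ S := fun h' => ha (h a h')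
  intro c hc
  rw [Finset.sum_insert haS] at hc
  have h1 := congrArg φ hc
  rw [map_add, map_sum, map_zero, Finset.sum_eq_zero, add_zero, map_smul, smul_eq_mul] at h1
  · have hca : c a = 0 := (mul_eq_zero.1 h1).resolve_right ha
    rw [hca, zero_smul, zero_add] at hc
    intro i hi
    rcases Finset.mem_insert.1 hi with rfl | hi
    · exact hca
    · exact hS c hc i hi
  · intro b hb
    rw [map_smul, h b hb, smul_zero]

/-! ### Lattice bases formed by intersections of paths. -/

namespace TreeData

variable (D : TreeData)

/-- The indicator function of the common part of two paths. -/
def both (p : ℕ × ℕ) (j : ℕ) : ℤ := if j ∈ D.path p.1 ∩ D.path p.2 then 1 else 0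

/-- `S` is a set of pairs of edges `f < e < k` outside of the tree whose paths intersect, such that
the indicator functions of the intersections form a basis of the lattice of all functions on the
tree edges that depend only on the set of paths of edges `< k` passing a tree edge, and vanish when
there is at most one such path. -/
structure Good (k : ℕ) (S : Finset (ℕ × ℕ)) : Prop where
  lt : ∀ p ∈ S, p.1 < p.2 ∧ p.2 < k
  nontree : ∀ p ∈ S, ¬ D.IsTree p.1 ∧ ¬ D.IsTree p.2
  inter : ∀ p ∈ S, (D.path p.1 ∩ D.path p.2).Nonempty
  indep : LinearIndepOn ℤ D.both (S : Set (ℕ × ℕ))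
  span : ∀ y : ℕ → ℤ, (∀ j, y j ≠ 0 → 0 < j ∧ j < D.n ∧ 2 ≤ (D.cov k j).card) →
    (∀ i j, 0 < i → i < D.n → 0 < j → j < D.n → D.cov k i = D.cov k j → y i = y j) →
    y ∈ Submodule.span ℤ (D.both '' (S : Set (ℕ × ℕ)))

lemma good_zero : D.Good 0 ∅ where
  lt := by simp
  nontree := by simp
  inter := by simp
  indep := by simp
  span := by
    intro y hy _
    have : y = 0 := by
      ext j
      by_contra h
      have h2 := (hy j h).2.2
      have : D.cov 0 j = ∅ := by
        ext f; simp [mem_cov]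
      rw [this] at h2
      simp at h2
    rw [this]
    exact Submodule.zero_mem _

variable {D}

lemma cov_succ_of_isTree {e : ℕ} (h : D.IsTree e) (j : ℕ) : D.cov (e + 1) j = D.cov e j := by
  ext f
  rw [mem_cov, mem_cov]
  constructor
  · rintro ⟨h1, h2, h3⟩
    refine ⟨lt_of_le_of_ne (by omega) ?_, h2, h3⟩
    rintro rfl
    exact h2 h
  · rintro ⟨h1, h2, h3⟩
    exact ⟨by omega, h2, h3⟩

lemma cov_succ_of_notMem {e j : ℕ} (h : j ∉ D.path e) : D.cov (e + 1) j = D.cov e j := by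
  ext f
  rw [mem_cov, mem_cov]
  constructor
  · rintro ⟨h1, h2, h3⟩
    refine ⟨lt_of_le_of_ne (by omega) ?_, h2, h3⟩
    rintro rfl
    exact h h3
  · rintro ⟨h1, h2, h3⟩
    exact ⟨by omega, h2, h3⟩

lemma cov_succ_of_mem {e j : ℕ} (ht : ¬ D.IsTree e) (h : j ∈ D.path e) :
    D.cov (e + 1) j = insert e (D.cov e j) := by
  ext f
  rw [Finset.mem_insert, mem_cov, mem_cov]
  constructor
  · rintro ⟨h1, h2, h3⟩
    by_cases hfe : f = e
    · exact Or.inl hfe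
    · exact Or.inr ⟨by omega, h2, h3⟩
  · rintro (rfl | ⟨h1, h2, h3⟩)
    · exact ⟨by omega, ht, h⟩
    · exact ⟨by omega, h2, h3⟩

lemma notMem_cov_self (e j : ℕ) : e ∉ D.cov e j := fun h =>
  lt_irrefl _ (D.mem_cov.1 h).1

lemma Good.succ_of_isTree {e : ℕ} {S : Finset (ℕ × ℕ)} (h : D.Good e S) (he : D.IsTree e) :
    D.Good (e + 1) S where
  lt p hp := by have := h.lt p hp; omega
  nontree := h.nontree
  inter := h.inter
  indep := h.indep
  span := by simpa only [cov_succ_of_isTree he] using h.span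

/-- The intersections are supported on the `n` coordinates below `n`, so independence bounds their
number by the rank. The running time depends on this bound. -/
lemma Good.card_le {k : ℕ} {S : Finset (ℕ × ℕ)} (hk : k ≤ D.m) (h : D.Good k S) :
    S.card ≤ D.n := by
  let ρ : (Fin D.n → ℤ) →ₗ[ℤ] (ℕ → ℤ) :=
    { toFun := fun y j => if hj : j < D.n then y ⟨j, hj⟩ else 0
      map_add' := by intro x y; ext j; by_cases hj : j < D.n <;> simp [hj]
      map_smul' := by intro x y; ext j; by_cases hj : j < D.n <;> simp [hj] }
  have h1 : LinearIndependent ℤ (fun p : S => fun j : Fin D.n => D.both p j) := by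
    refine LinearIndependent.of_comp ρ ?_
    have h2 : (ρ ∘ fun p : S => fun j : Fin D.n => D.both p j) = fun p : S => D.both p := by
      funext p
      ext j
      by_cases hj : j < D.n
      · simp [ρ, hj]
      · have : j ∉ D.path p.1.1 ∩ D.path p.1.2 := by
          intro hj'
          have := h.lt p.1 p.2
          exact hj (D.path_bounds (by omega) (Finset.mem_inter.1 hj').2).2
        simp [ρ, hj, both, this]
    rw [h2]
    exact h.indep
  have := h1.fintype_card_le_finrank
  simpa using this

/-- The part of the indicator function of the path of `f` on the representatives for `e`. -/
noncomputable def repVec (D : TreeData) (e f j : ℕ) : ℤ :=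
  if j ∈ D.reps e then if j ∈ D.path f then 1 else 0 else 0

/-- The signed part of the path from `u` to `v` on the representatives for `e`. -/
noncomputable def repDiff (D : TreeData) (e u v j : ℕ) : ℤ :=
  if j ∈ D.reps e then D.sgn e j * (D.ind u j - D.ind v j) else 0

/-- The state of the computation of the pairs for the edge `e`, after the edges smaller than `f`:
`κ` labels the components of the tree without the representatives, together with the edges chosen
so far, and `S'` consists of the set `S` and of the pairs chosen so far. -/
structure Merge (D : TreeData) (e : ℕ) (S : Finset (ℕ × ℕ)) (f : ℕ) (κ : ℕ → ℕ)
    (S' : Finset (ℕ × ℕ)) : Prop where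
  subset : S ⊆ S'
  new : ∀ p ∈ S', p ∈ S ∨ p.2 = e ∧ p.1 < f ∧ ¬ D.IsTree p.1 ∧
    (D.path p.1 ∩ D.path p.2).Nonempty
  tree : ∀ i, 0 < i → i < D.n → i ∉ D.reps e → κ i = κ (D.par i)
  merged : ∀ f' < f, ¬ D.IsTree f' → κ (D.X f') = κ (D.Y f')
  conn : ∀ u v, u < D.n → v < D.n → κ u = κ v →
    D.repDiff e u v ∈ Submodule.span ℤ (D.repVec e '' {f' | (f', e) ∈ S'})
  indep : LinearIndepOn ℤ D.both (S' : Set (ℕ × ℕ))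

/-- The label of a vertex is the top vertex of its component, that is, the nearest representative
above it or the root. A vertex and its label have the same representatives above them, so no
representative separates vertices with equal labels. -/
lemma Merge.init {e : ℕ} {S : Finset (ℕ × ℕ)} (h : D.Good e S) (κ : ℕ → ℕ)
    (hκ : ∀ i, i < D.n → κ i = if i = 0 ∨ i ∈ D.reps e then i else κ (D.par i)) :
    Merge D e S 0 κ S where
  subset := Finset.Subset.refl _
  new p hp := Or.inl hp
  tree i hi hin hir := by
    rw [hκ i hin, if_neg]
    rintro (h | h)
    · omega
    · exact hir h
  merged f' hf' := absurd hf' (by omega)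
  conn u v hu hv huv := by
    have key : ∀ w, w < D.n → ∀ j ∈ D.reps e, D.ind w j = D.ind (κ w) j := by
      intro w
      induction w using Nat.strong_induction_on with
      | _ w ih =>
        intro hw j hj
        rw [hκ w hw]
        split_ifs with hc
        · rfl
        · push Not at hc
          have hw0 : 0 < w := by omega
          have := D.par_lt w hw0
          rw [← ih _ this (by omega) j hj]
          exact D.ind_sub_par hw0 fun h' => hc.2 (h' ▸ hj)
    have : D.repDiff e u v = 0 := by
      ext j
      rw [repDiff]
      split_ifs with hj
      · rw [key u hu j hj, key v hv j hj, huv, sub_self, mul_zero]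
        rfl
      · rfl
    rw [this]
    exact Submodule.zero_mem _
  indep := h.indep

lemma Merge.skip {e f : ℕ} {S S' : Finset (ℕ × ℕ)} {κ : ℕ → ℕ} (h : Merge D e S f κ S')
    (hf : ¬ D.IsTree f → κ (D.X f) = κ (D.Y f)) : Merge D e S (f + 1) κ S' where
  subset := h.subset
  new p hp := (h.new p hp).imp_right fun h' => ⟨h'.1, by omega, h'.2.2⟩
  tree := h.tree
  merged f' hf' ht := by
    rcases Nat.lt_succ_iff_lt_or_eq.1 hf' with h' | rfl
    · exact h.merged f' h' ht
    · exact hf ht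
  conn := h.conn
  indep := h.indep

/-- Up to one global sign, the intersection with the path of `f`, oriented along `e`, is the signed
path of `f`; hence `sum_sgn` can evaluate sums over intersections. -/
lemma sgn_mul_both (e f : ℕ) : ∃ ε : ℤ, (ε = 1 ∨ ε = -1) ∧
    ∀ j ∈ D.path e, D.sgn e j * D.both (f, e) j = ε * D.sgn f j := by
  obtain ⟨ε, hε, h⟩ := D.sgn_mul_sgn e f
  refine ⟨ε, hε, fun j hj => ?_⟩
  have h1 := h j
  have h2 := D.sgn_sq hj
  rw [both]
  have hε2 : ε * ε = 1 := by rcases hε with rfl | rfl <;> norm_num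
  calc D.sgn e j * (if j ∈ D.path f ∩ D.path e then 1 else 0)
      = ε * D.sgn e j * (ε * if j ∈ D.path f ∩ D.path e then 1 else 0) := by
        linear_combination (-(D.sgn e j * (if j ∈ D.path f ∩ D.path e then 1 else 0))) * hε2
    _ = ε * D.sgn f j := by rw [← h1]; linear_combination ε * D.sgn f j * h2

/-- By the definition of `reps`, a representative passed by more than one earlier path has a member
of its class off the path of `e`. In all other cases `0` is a dummy value. -/
lemma exists_alt (e j : ℕ) : ∃ j', j ∈ D.reps e → (D.cov e j).card ≠ 1 →
    0 < j' ∧ j' < D.n ∧ j' ∉ D.path e ∧ D.cov e j' = D.cov e j := by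
  by_cases h : j ∈ D.reps e
  · rcases (D.mem_reps.1 h).2.2.1 with h' | ⟨j', h'⟩
    · exact ⟨0, fun _ h'' => absurd h' h''⟩
    · exact ⟨j', fun _ _ => h'⟩
  · exact ⟨0, fun h' => absurd h' h⟩

lemma reps_subset {e j : ℕ} (h : j ∈ D.reps e) : j ∈ D.path e := (D.mem_reps.1 h).1

lemma both_eq_of_cov {e i j : ℕ} {p : ℕ × ℕ} (h1 : p.1 < e) (h2 : p.2 < e) (h3 : ¬ D.IsTree p.1)
    (h4 : ¬ D.IsTree p.2) (h : D.cov e i = D.cov e j) : D.both p i = D.both p j := by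
  have a := congrArg (fun s => p.1 ∈ s) h
  have b := congrArg (fun s => p.2 ∈ s) h
  simp only [mem_cov, h1, h2, h3, h4, not_false_eq_true, true_and] at a b
  simp only [both, Finset.mem_inter, a, b]

/-- A tree edge in the intersection is passed by the paths of two distinct edges. -/
lemma both_eq_zero_of_cov {e j : ℕ} {p : ℕ × ℕ} (h0 : p.1 < p.2) (h2 : p.2 < e)
    (h3 : ¬ D.IsTree p.1) (h4 : ¬ D.IsTree p.2) (h : (D.cov e j).card = 1) : D.both p j = 0 := by
  rw [both, if_neg]
  intro hj
  rw [Finset.mem_inter] at hj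
  obtain ⟨a, ha⟩ := Finset.card_eq_one.1 h
  have h5 : p.1 ∈ D.cov e j := D.mem_cov.2 ⟨by omega, h3, hj.1⟩
  have h6 : p.2 ∈ D.cov e j := D.mem_cov.2 ⟨by omega, h4, hj.2⟩
  rw [ha, Finset.mem_singleton] at h5 h6
  omega

lemma both_eq_zero {f e j : ℕ} (h : j ∉ D.path e) : D.both (f, e) j = 0 := by
  rw [both, if_neg]
  intro h'
  exact h (Finset.mem_inter.1 h').2

/-- Labels change only across representatives, so these carry the whole telescoping sum. -/
lemma Merge.sum_sgn {e f : ℕ} {S S' : Finset (ℕ × ℕ)} {κ : ℕ → ℕ} (h : Merge D e S f κ S')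
    (φ : ℕ → ℤ) {f' : ℕ} (hf : f' < D.m) :
    ∑ j ∈ D.reps e, D.sgn f' j * (φ (κ j) - φ (κ (D.par j))) =
      φ (κ (D.X f')) - φ (κ (D.Y f')) :=
  D.sum_sgn (fun v => φ (κ v)) hf fun j h0 hn hj => by rw [h.tree j h0 hn hj]

/-- The functional is a cut. The representative `j` is weighted by the change across `j` of the
indicator `g` of the component of `X f`, and it is applied to `y j - y (alt j)`, or to `y j` if a
single earlier path passes `j`. These differences vanish for the pairs in `S`. Intersections with
the path of `e` vanish at `alt j`, so by telescoping the value on `(f', e)` is, up to sign, the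
difference of `g ∘ κ` at the ends of `f'`. This is zero for the chosen `f' < f`, whose ends are
already merged, and `1` or `-1` for `f`. -/
lemma Merge.indep_insert {e f : ℕ} {S S' : Finset (ℕ × ℕ)} {κ : ℕ → ℕ} (hS : D.Good e S)
    (h : Merge D e S f κ S') (he : e < D.m) (hfe : f < e)
    (hne : κ (D.X f) ≠ κ (D.Y f)) :
    LinearIndepOn ℤ D.both ((insert (f, e) S' : Finset (ℕ × ℕ)) : Set (ℕ × ℕ)) := by
  choose alt halt using exists_alt (D := D) e
  set g : ℕ → ℤ := fun c => if c = κ (D.X f) then 1 else 0 with hg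
  let φ : (ℕ → ℤ) →ₗ[ℤ] ℤ := ∑ j ∈ D.reps e, (D.sgn e j * (g (κ j) - g (κ (D.par j)))) •
    ((LinearMap.proj j : (ℕ → ℤ) →ₗ[ℤ] ℤ) -
      if (D.cov e j).card = 1 then 0 else LinearMap.proj (alt j))
  have hφ : ∀ y, φ y = ∑ j ∈ D.reps e, (D.sgn e j * (g (κ j) - g (κ (D.par j)))) *
      (y j - if (D.cov e j).card = 1 then 0 else y (alt j)) := by
    intro y
    simp only [φ, LinearMap.sum_apply, LinearMap.smul_apply, LinearMap.sub_apply,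
      LinearMap.proj_apply, smul_eq_mul]
    refine Finset.sum_congr rfl fun j _ => ?_
    split_ifs <;> simp
  have hnew : ∀ f', f' < D.m → ∃ ε : ℤ, (ε = 1 ∨ ε = -1) ∧
      φ (D.both (f', e)) = ε * (g (κ (D.X f')) - g (κ (D.Y f'))) := by
    intro f' hf'
    obtain ⟨ε, hε, h1⟩ := sgn_mul_both (D := D) e f'
    refine ⟨ε, hε, ?_⟩
    rw [hφ, ← h.sum_sgn g hf', Finset.mul_sum]
    refine Finset.sum_congr rfl fun j hj => ?_
    have : (if (D.cov e j).card = 1 then 0 else D.both (f', e) (alt j)) = 0 := by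
      split_ifs with hc
      · rfl
      · exact both_eq_zero (halt j hj hc).2.2.1
    rw [this, sub_zero]
    linear_combination (g (κ j) - g (κ (D.par j))) * h1 j (reps_subset hj)
  refine LinearIndepOn.insert_of_functional h.indep φ ?_ ?_
  · obtain ⟨ε, hε, h1⟩ := hnew f (hfe.trans he)
    have h2 : g (κ (D.X f)) = 1 := by simp [hg]
    have h3 : g (κ (D.Y f)) = 0 := by simp [hg, hne.symm]
    rw [h1, h2, h3]
    rcases hε with rfl | rfl <;> norm_num
  · rintro ⟨p, q⟩ hp
    rcases h.new _ hp with hpS | ⟨hpe, hpf, hpt, -⟩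
    · rw [hφ]
      refine Finset.sum_eq_zero fun j hj => ?_
      have hlt := hS.lt _ hpS
      have hnt := hS.nontree _ hpS
      simp only at hlt hnt
      rw [mul_eq_zero]
      right
      split_ifs with hc
      · rw [both_eq_zero_of_cov hlt.1 hlt.2 hnt.1 hnt.2 hc, sub_zero]
      · rw [both_eq_of_cov (by simp; omega) hlt.2 hnt.1 hnt.2 (halt j hj hc).2.2.2, sub_self]
    · simp only at hpe hpf hpt
      subst hpe
      obtain ⟨ε, hε, h1⟩ := hnew p (by omega)
      rw [h1, h.merged p hpf hpt, sub_self, mul_zero]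

lemma Merge.step {e f : ℕ} {S S' : Finset (ℕ × ℕ)} {κ : ℕ → ℕ} (hS : D.Good e S)
    (h : Merge D e S f κ S') (he : e < D.m) (hfe : f < e) (hf : ¬ D.IsTree f)
    (hne : κ (D.X f) ≠ κ (D.Y f)) :
    Merge D e S (f + 1) (fun v => if κ v = κ (D.X f) then κ (D.Y f) else κ v)
      (insert (f, e) S') where
  subset := h.subset.trans (Finset.subset_insert _ _)
  new p hp := by
    rcases Finset.mem_insert.1 hp with rfl | hp
    · refine Or.inr ⟨rfl, Nat.lt_succ_self _, hf, ?_⟩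
      -- If the paths were disjoint, the path of `f` would meet no representative, and the ends of
      -- `f` would have equal labels.
      by_contra hcon
      have h1 := h.sum_sgn (fun c => (c : ℤ)) (hfe.trans he)
      rw [Finset.sum_eq_zero] at h1
      · apply hne; omega
      · intro j hj
        rw [D.sgn_eq_zero, zero_mul]
        intro hjf
        exact hcon ⟨j, Finset.mem_inter.2 ⟨hjf, reps_subset hj⟩⟩
    · exact (h.new p hp).imp_right fun h' => ⟨h'.1, by omega, h'.2.2⟩
  tree i hi hin hir := by
    simp only [h.tree i hi hin hir]
  merged f' hf' ht := by
    rcases Nat.lt_succ_iff_lt_or_eq.1 hf' with h' | rfl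
    · simp only [h.merged f' h' ht]
    · simp
  conn u v hu hv huv := by
    set M := Submodule.span ℤ (D.repVec e '' {f' | (f', e) ∈ insert (f, e) S'}) with hM
    have hle : Submodule.span ℤ (D.repVec e '' {f' | (f', e) ∈ S'}) ≤ M :=
      Submodule.span_mono (Set.image_mono fun f' hf' => Finset.mem_insert_of_mem hf')
    have hold : ∀ u v, u < D.n → v < D.n → κ u = κ v → D.repDiff e u v ∈ M :=
      fun u v hu hv huv => hle (h.conn u v hu hv huv)
    have hadd : ∀ u v w, D.repDiff e u v + D.repDiff e v w = D.repDiff e u w := by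
      intro u v w
      ext j
      simp only [Pi.add_apply, repDiff]
      split_ifs
      · ring
      · ring
    have hneg : ∀ u v, D.repDiff e u v ∈ M → D.repDiff e v u ∈ M := by
      intro u v h'
      have : D.repDiff e v u = - D.repDiff e u v := by
        ext j
        simp only [Pi.neg_apply, repDiff]
        split_ifs <;> ring
      rw [this]
      exact M.neg_mem h'
    have hX := D.X_lt f (hfe.trans he)
    have hY := D.Y_lt f (hfe.trans he)
    -- Up to sign, the signed path between the ends of `f` is the new generator. Signed paths
    -- between the two merged components are routed through `f`.
    have hf' : D.repDiff e (D.X f) (D.Y f) ∈ M := by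
      obtain ⟨ε, hε, h1⟩ := sgn_mul_both (D := D) e f
      have : D.repDiff e (D.X f) (D.Y f) = ε • D.repVec e f := by
        ext j
        rw [Pi.smul_apply, repDiff, repVec, smul_eq_mul]
        split_ifs with hj hjf
        · have h2 := h1 j (reps_subset hj)
          have h3 := D.sgn_sq (reps_subset hj)
          have h4 : D.both (f, e) j = 1 := by
            rw [both, if_pos (Finset.mem_inter.2 ⟨hjf, reps_subset hj⟩)]
          have hε2 : ε * ε = 1 := by rcases hε with rfl | rfl <;> norm_num
          change D.sgn e j * D.sgn f j = _
          rw [h4] at h2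
          linear_combination (-ε * D.sgn e j) * h2 + ε * h3 - D.sgn e j * D.sgn f j * hε2
        · change D.sgn e j * D.sgn f j = _
          rw [D.sgn_eq_zero hjf, mul_zero, mul_zero]
        · simp
      rw [this]
      exact M.smul_mem _ (Submodule.subset_span ⟨f, Finset.mem_insert_self _ _, rfl⟩)
    split_ifs at huv with h1 h2 h2
    · exact hold u v hu hv (h1.trans h2.symm)
    · have := M.add_mem (hold u _ hu hX h1) (M.add_mem hf' (hold _ v hY hv huv))
      rwa [hadd, hadd] at this
    · have := M.add_mem (hold u _ hu hY huv) (M.add_mem (hneg _ _ hf') (hold _ v hX hv h2.symm))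
      rwa [hadd, hadd] at this
    · exact hold u v hu hv huv
  indep := h.indep_insert hS he hfe hne

end TreeData

/-! ### The chosen intersections generate the refined lattice. -/

namespace TreeData

variable {D : TreeData}

/-- Once all earlier edges have been used, `const_of_reps` leaves only one component. -/
lemma Merge.eq_par {e : ℕ} {S S' : Finset (ℕ × ℕ)} {κ : ℕ → ℕ} (h : Merge D e S e κ S')
    (he : e < D.m) {j : ℕ} (hj : 0 < j) (hjn : j < D.n) : κ j = κ (D.par j) := by
  have := D.const_of_reps he (fun v => (κ v : ℤ))
    (fun i hi hin hir => by rw [h.tree i hi hin hir])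
    (fun f hf hft => by rw [h.merged f hf hft]) j hj hjn
  exact_mod_cast this

/-- The ends of the tree edge `j` finally have equal labels, and the signed path between them is `j`
alone. That unit vectors are reached with integer coefficients is what makes the result a lattice
basis and not merely a basis over ℚ. -/
lemma Merge.single_mem {e : ℕ} {S S' : Finset (ℕ × ℕ)} {κ : ℕ → ℕ} (h : Merge D e S e κ S')
    (he : e < D.m) {j : ℕ} (hj : j ∈ D.reps e) :
    Pi.single j 1 ∈ Submodule.span ℤ (D.repVec e '' {f | (f, e) ∈ S'}) := by
  have hb := D.path_bounds he (reps_subset hj)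
  have hpar := D.par_lt j hb.1
  have h1 := h.conn j (D.par j) hb.2 (by omega) (h.eq_par he hb.1 hb.2)
  have h2 : (Pi.single j 1 : ℕ → ℤ) = D.sgn e j • D.repDiff e j (D.par j) := by
    ext i
    rw [Pi.smul_apply, smul_eq_mul, repDiff]
    by_cases hij : i = j
    · subst hij
      rw [Pi.single_eq_same, if_pos hj, ← mul_assoc, D.sgn_sq (reps_subset hj), one_mul]
      simp [ind, D.self_mem_anc hb.1, D.notMem_anc_par hb.1]
    · rw [Pi.single_eq_of_ne hij, D.ind_sub_par hb.1 hij, sub_self, mul_zero, ite_self, mul_zero]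
  rw [h2]
  exact Submodule.smul_mem _ _ h1

/-- Without a new pair the span would be zero, although it contains the unit vector of a
representative. The cost of scanning all earlier edges is charged to the new pair. -/
lemma Merge.exists_new {e : ℕ} {S S' : Finset (ℕ × ℕ)} {κ : ℕ → ℕ} (hS : D.Good e S)
    (h : Merge D e S e κ S') (he : e < D.m) (hne : (D.reps e).Nonempty) :
    S.card < S'.card := by
  obtain ⟨j, hj⟩ := hne
  refine Finset.card_lt_card (Finset.ssubset_iff_subset_ne.2 ⟨h.subset, fun heq => ?_⟩)
  have h1 := h.single_mem he hj
  have h2 : {f | (f, e) ∈ S'} = ∅ := by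
    ext f
    simp only [Set.mem_ofPred_eq, Set.mem_empty_iff_false, iff_false]
    intro hf
    rw [← heq] at hf
    exact lt_irrefl _ (hS.lt _ hf).2
  rw [h2, Set.image_empty, Submodule.span_empty, Submodule.mem_bot] at h1
  have := congrFun h1 j
  simp at this

/-- The functions that occur in the span of the intersections with the path of `e`. -/
lemma span_both_props {e : ℕ} {S : Set ℕ} (hS : ∀ f ∈ S, f < e ∧ ¬ D.IsTree f) {z : ℕ → ℤ}
    (hz : z ∈ Submodule.span ℤ (D.both '' ((fun f => (f, e)) '' S))) :
    (∀ j, j ∉ D.path e ∨ D.cov e j = ∅ → z j = 0) ∧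
    ∀ i ∈ D.path e, ∀ j ∈ D.path e, D.cov e i = D.cov e j → z i = z j := by
  induction hz using Submodule.span_induction with
  | mem x hx =>
    obtain ⟨_, ⟨f, hf, rfl⟩, rfl⟩ := hx
    obtain ⟨hfe, hft⟩ := hS f hf
    constructor
    · rintro j (hj | hj)
      · exact both_eq_zero hj
      · rw [both, if_neg]
        intro hj'
        have : f ∈ D.cov e j := D.mem_cov.2 ⟨hfe, hft, (Finset.mem_inter.1 hj').1⟩
        rw [hj] at this
        simp at this
    · intro i hi j hj hij
      have a := congrArg (fun s => f ∈ s) hij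
      simp only [mem_cov, hfe, hft, not_false_eq_true, true_and] at a
      simp only [both, Finset.mem_inter, a, hi, hj]
  | zero => simp
  | add x y _ _ hx hy =>
    constructor
    · intro j hj
      rw [Pi.add_apply, hx.1 j hj, hy.1 j hj, add_zero]
    · intro i hi j hj hij
      rw [Pi.add_apply, Pi.add_apply, hx.2 i hi j hj hij, hy.2 i hi j hj hij]
  | smul c x _ hx =>
    constructor
    · intro j hj
      rw [Pi.smul_apply, hx.1 j hj, smul_zero]
    · intro i hi j hj hij
      rw [Pi.smul_apply, Pi.smul_apply, hx.2 i hi j hj hij]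

/-- The same integer combination of the full intersections extends a combination of their
restrictions to the representatives. -/
lemma exists_of_mem_span_repVec {e : ℕ} {S : Set ℕ} {δ : ℕ → ℤ}
    (h : δ ∈ Submodule.span ℤ (D.repVec e '' S)) :
    ∃ z ∈ Submodule.span ℤ (D.both '' ((fun f => (f, e)) '' S)), ∀ j ∈ D.reps e, z j = δ j := by
  induction h using Submodule.span_induction with
  | mem x hx =>
    obtain ⟨f, hf, rfl⟩ := hx
    refine ⟨_, Submodule.subset_span ⟨(f, e), ⟨f, hf, rfl⟩, rfl⟩, fun j hj => ?_⟩
    rw [both, repVec, if_pos hj]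
    simp [reps_subset hj]
  | zero => exact ⟨0, Submodule.zero_mem _, fun _ _ => rfl⟩
  | add x y _ _ hx hy =>
    obtain ⟨a, ha, ha'⟩ := hx
    obtain ⟨b, hb, hb'⟩ := hy
    exact ⟨a + b, Submodule.add_mem _ ha hb, fun j hj => by
      rw [Pi.add_apply, Pi.add_apply, ha' j hj, hb' j hj]⟩
  | smul c x _ hx =>
    obtain ⟨a, ha, ha'⟩ := hx
    exact ⟨c • a, Submodule.smul_mem _ _ ha, fun j hj => by
      rw [Pi.smul_apply, Pi.smul_apply, ha' j hj]⟩

/-- A function `y` in the lattice for `e + 1` is corrected by a combination `z` of the new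
intersections so that `y - z` lies in the lattice for `e`, which `S` spans. This prescribes `z` on
each representative `j`: `y - z` must be `0` there if one earlier path passes `j`, and otherwise `y
(alt j)`, the value off the path, where `z` vanishes. The values of `z` on `reps e` can be chosen at
will by `Merge.single_mem`. -/
theorem Merge.good {e : ℕ} {S S' : Finset (ℕ × ℕ)} {κ : ℕ → ℕ} (hS : D.Good e S)
    (h : Merge D e S e κ S') (he : e < D.m) (het : ¬ D.IsTree e) : D.Good (e + 1) S' where
  lt p hp := by
    rcases h.new p hp with hp | hp
    · have := hS.lt p hp; omega
    · omega
  nontree p hp := by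
    rcases h.new p hp with hp | hp
    · exact hS.nontree p hp
    · exact ⟨hp.2.2.1, by rw [hp.1]; exact het⟩
  inter p hp := by
    rcases h.new p hp with hp | hp
    · exact hS.inter p hp
    · exact hp.2.2.2
  indep := h.indep
  span := by
    intro y hy1 hy2
    choose alt halt using exists_alt (D := D) e
    set δ : ℕ → ℤ := fun j => if (D.cov e j).card = 1 then y j else y j - y (alt j) with hδ
    have h1 : ∑ j ∈ D.reps e, δ j • (Pi.single j 1 : ℕ → ℤ) ∈
        Submodule.span ℤ (D.repVec e '' {f | (f, e) ∈ S'}) :=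
      Submodule.sum_mem _ fun j hj => Submodule.smul_mem _ _ (h.single_mem he hj)
    obtain ⟨z, hz, hzδ⟩ := exists_of_mem_span_repVec h1
    have hzr : ∀ j ∈ D.reps e, z j = δ j := by
      intro j hj
      rw [hzδ j hj, Finset.sum_apply, Finset.sum_eq_single j]
      · simp
      · intro i _ hij
        simp [hij.symm]
      · intro h'; exact absurd hj h'
    have hnew : ∀ f ∈ {f | (f, e) ∈ S'}, f < e ∧ ¬ D.IsTree f := by
      intro f hf
      rcases h.new _ hf with hp | hp
      · exact absurd (hS.lt _ hp).2 (lt_irrefl _)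
      · exact ⟨hp.2.1, hp.2.2.1⟩
    obtain ⟨hz0, hzc⟩ := span_both_props hnew hz
    have hzS : z ∈ Submodule.span ℤ (D.both '' (S' : Set (ℕ × ℕ))) := by
      refine Submodule.span_mono (Set.image_mono ?_) hz
      rintro _ ⟨f, hf, rfl⟩
      exact hf
    have hcov : ∀ i j, 0 < i → i < D.n → 0 < j → j < D.n → D.cov e i = D.cov e j →
        (i ∈ D.path e ↔ j ∈ D.path e) → y i = y j := by
      intro i j hi hin hj hjn hij hp
      refine hy2 i j hi hin hj hjn ?_
      by_cases hip : i ∈ D.path e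
      · rw [cov_succ_of_mem het hip, cov_succ_of_mem het (hp.1 hip), hij]
      · rw [cov_succ_of_notMem hip, cov_succ_of_notMem (fun h => hip (hp.2 h)), hij]
    have hlow : ∀ j, 0 < j → j < D.n → (D.cov e j).card ≤ 1 → y j = z j := by
      intro j hj hjn hc
      by_cases hjp : j ∈ D.path e
      · rcases Nat.le_one_iff_eq_zero_or_eq_one.1 hc with hc | hc
        · rw [hz0 j (Or.inr (Finset.card_eq_zero.1 hc))]
          by_contra hyj
          have := (hy1 j hyj).2.2
          rw [cov_succ_of_mem het hjp, Finset.card_insert_of_notMem (notMem_cov_self e j)] at this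
          omega
        · obtain ⟨r, hr, hrj⟩ := D.exists_rep hjp (Finset.card_pos.1 (by omega)) (Or.inl hc)
          have hrp := reps_subset hr
          have hrb := D.path_bounds he hrp
          rw [hzc j hjp r hrp hrj.symm, hzr r hr, hδ]
          simp only [hrj, hc, if_true]
          exact hcov j r hj hjn hrb.1 hrb.2 hrj.symm (by simp [hjp, hrp])
      · rw [hz0 j (Or.inl hjp)]
        by_contra hyj
        have := (hy1 j hyj).2.2
        rw [cov_succ_of_notMem hjp] at this
        omega
    have hmix : ∀ i j, 0 < i → i < D.n → 0 < j → j < D.n → D.cov e i = D.cov e j →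
        i ∈ D.path e → j ∉ D.path e → y i - z i = y j - z j := by
      intro i j hi hin hj hjn hij hip hjp
      by_cases hc : (D.cov e i).card ≤ 1
      · rw [hlow i hi hin hc, hlow j hj hjn (hij ▸ hc)]; ring
      · obtain ⟨r, hr, hri⟩ := D.exists_rep hip (Finset.card_pos.1 (by omega))
          (Or.inr ⟨j, hj, hjn, hjp, hij.symm⟩)
        have hrp := reps_subset hr
        have hrb := D.path_bounds he hrp
        have hrc : (D.cov e r).card ≠ 1 := by rw [hri]; omega
        obtain ⟨ha0, han, hap, hac⟩ := halt r hr hrc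
        rw [hz0 j (Or.inl hjp), hzc i hip r hrp hri.symm, hzr r hr, hδ]
        simp only [hrc, if_false]
        rw [hcov i r hi hin hrb.1 hrb.2 hri.symm (by simp [hip, hrp]),
          hcov (alt r) j ha0 han hj hjn (hac.trans (hri.trans hij)) (by simp [hap, hjp])]
        ring
    have hmem := Submodule.span_mono (R := ℤ) (Set.image_mono (f := D.both)
      (Finset.coe_subset.2 h.subset)) (hS.span (y - z) ?_ ?_)
    · have := Submodule.add_mem _ hmem hzS
      rwa [sub_add_cancel] at this
    · intro j hj
      rw [Pi.sub_apply] at hj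
      have hb : 0 < j ∧ j < D.n := by
        by_cases hyj : y j = 0
        · have hjp : j ∈ D.path e := by
            by_contra hjp
            exact hj (by rw [hyj, hz0 j (Or.inl hjp), sub_self])
          exact D.path_bounds he hjp
        · have := hy1 j hyj; exact ⟨this.1, this.2.1⟩
      refine ⟨hb.1, hb.2, ?_⟩
      by_contra hc
      exact hj (by rw [hlow j hb.1 hb.2 (by omega), sub_self])
    · intro i j hi hin hj hjn hij
      rw [Pi.sub_apply, Pi.sub_apply]
      by_cases hip : i ∈ D.path e <;> by_cases hjp : j ∈ D.path e
      · rw [hzc i hip j hjp hij, hcov i j hi hin hj hjn hij (by simp [hip, hjp])]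
      · exact hmix i j hi hin hj hjn hij hip hjp
      · exact (hmix j i hj hjn hi hin hij.symm hjp hip).symm
      · rw [hz0 i (Or.inl hip), hz0 j (Or.inl hjp),
          hcov i j hi hin hj hjn hij (by simp [hip, hjp])]

/-- If there are no representatives, then no pair is needed. -/
lemma Good.succ_of_reps_eq_empty {e : ℕ} {S : Finset (ℕ × ℕ)} (hS : D.Good e S) (he : e < D.m)
    (het : ¬ D.IsTree e) (hR : D.reps e = ∅) : D.Good (e + 1) S := by
  -- Without representatives the whole tree is one component, so a single label is already the final
  -- stage.
  have h : Merge D e S e (fun _ => 0) S :=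
    { subset := Finset.Subset.refl _
      new := fun p hp => Or.inl hp
      tree := fun _ _ _ _ => rfl
      merged := fun _ _ _ => rfl
      conn := fun u v _ _ _ => by
        have : D.repDiff e u v = 0 := by
          ext j; simp [repDiff, hR]
        rw [this]
        exact Submodule.zero_mem _
      indep := hS.indep }
  exact h.good hS he het

end TreeData

/-! ### Cycles, parity in fundamental cuts, and fundamental cycles. -/

/-- A set of edges is a cycle if it consists of the edges of a walk which first meets itself at its
end. -/
lemma isCycle_of_walk {α β : Type*} {G : Graph α β} (x : ℕ → α) (d : ℕ → β)
    (hl : ∀ i, G.IsLink (d (i + 1)) (x i) (x (i + 1))) (hne : ∀ i, d (i + 1) ≠ d i)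
    {i j : ℕ} (hij : i < j) (hx : x i = x j) (hmin : ∀ a b, a < b → b < j → x a ≠ x b) :
    ∃ C, IsCycle G C ∧ C ⊆ Set.range d := by
  obtain ⟨k, rfl⟩ : ∃ k, j = i + (k + 1) := ⟨j - i - 1, by omega⟩
  have hinj : ∀ a b, a < i + (k + 1) → b < i + (k + 1) → x a = x b → a = b := by
    intro a b ha hb hab
    rcases lt_trichotomy a b with h | h | h
    · exact absurd hab (hmin a b h hb)
    · exact h
    · exact absurd hab.symm (hmin b a h ha)
  -- An edge used twice is traversed in opposite directions, because its starting points differ.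
  -- This forces the second use to follow the first at once, and `hne` forbids turning back.
  have hdne : ∀ a b, i ≤ a → a < b → b < i + (k + 1) → d (a + 1) ≠ d (b + 1) := by
    intro a b hia hab hb heq
    have h1 := hl a
    have h2 := hl b
    rw [heq] at h1
    rcases h1.eq_and_eq_or_eq_and_eq h2 with ⟨h3, -⟩ | ⟨-, h4⟩
    · exact hmin a b hab hb h3
    · have := hinj (a + 1) b (by omega) hb h4
      exact hne (a + 1) (by rw [heq, this])
  refine ⟨Set.range fun a : Fin (k + 1) => d (i + a + 1), ⟨k, fun a => x (i + a),
    fun a => d (i + a + 1), ?_, ?_, ?_, rfl⟩, ?_⟩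
  · intro a b hab
    have := hinj _ _ (by omega) (by omega) hab
    exact Fin.ext (by omega)
  · intro a b hab
    rcases lt_trichotomy a.1 b.1 with h | h | h
    · exact absurd hab (hdne _ _ (by omega) (by omega) (by omega))
    · exact Fin.ext h
    · exact absurd hab.symm (hdne _ _ (by omega) (by omega) (by omega))
  · intro a
    have h1 := hl (i + a)
    by_cases ha : a = Fin.last k
    · subst ha
      rw [Fin.last_add_one]
      simp only [Fin.val_last, Fin.val_zero, add_zero] at h1 ⊢
      rw [hx]
      exact h1
    · have h2 : ((a + 1 : Fin (k + 1)) : ℕ) = a + 1 :=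
        Fin.val_add_one_of_lt (Fin.lt_last_iff_ne_last.2 ha)
      simp only [h2]
      exact h1
  · rintro _ ⟨a, rfl⟩
    exact ⟨_, rfl⟩

lemma sum_symmDiff {ι : Type*} [DecidableEq ι] (A B : Finset ι) (f : ι → ZMod 2) :
    ∑ i ∈ symmDiff A B, f i = ∑ i ∈ A, f i + ∑ i ∈ B, f i := by
  have h1 : symmDiff A B = (A \ B) ∪ (B \ A) := rfl
  rw [h1, Finset.sum_union, ← Finset.sum_sdiff (Finset.inter_subset_left : A ∩ B ⊆ A),
    ← Finset.sum_sdiff (Finset.inter_subset_right : A ∩ B ⊆ B), Finset.sdiff_inter_self_left,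
    Finset.sdiff_inter_self_right]
  · have := CharTwo.add_self_eq_zero (∑ i ∈ A ∩ B, f i)
    linear_combination -this
  · rw [Finset.disjoint_left]
    intro i hi hi'
    rw [Finset.mem_sdiff] at hi hi'
    exact hi.2 hi'.1

namespace TreeData

/-- The vertex `i` of the tree is the vertex `vt i` of the graph `G`, and the edges are the same. -/
structure Models (D : TreeData) (G : Graph ℕ ℕ) (vt : ℕ → ℕ) : Prop where
  inj : ∀ i < D.n, ∀ j < D.n, vt i = vt j → i = j
  vertexSet_eq : V(G) = vt '' Set.Iio D.n
  edgeSet_eq : E(G) = Set.Iio D.m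
  isLink : ∀ e < D.m, G.IsLink e (vt (D.X e)) (vt (D.Y e))

variable {D : TreeData} {G : Graph ℕ ℕ} {vt : ℕ → ℕ}

lemma IsTree.lt {e : ℕ} (h : D.IsTree e) : e < D.m := by
  obtain ⟨i, hi, hin, rfl⟩ := h
  exact D.pe_lt i hi hin

/-- The incidence of the edge `e` and the vertex `x`, modulo two. -/
def bd (D : TreeData) (x e : ℕ) : ZMod 2 :=
  (if D.X e = x then 1 else 0) + if D.Y e = x then 1 else 0

/-- If all degrees in a nonempty set of edges are even, a walk can leave every vertex by an edge
other than the one it came by, and its first return closes a cycle. Loops are treated apart since a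
loop contributes two to the degree and does not force a second edge. -/
lemma Models.exists_isCycle (hM : D.Models G vt) {S : Finset ℕ} (hS : S.Nonempty)
    (hSm : ∀ e ∈ S, e < D.m) (hbd : ∀ x, ∑ e ∈ S, D.bd x e = 0) :
    ∃ C, IsCycle G C ∧ C ⊆ S := by
  by_cases hloop : ∃ e ∈ S, D.X e = D.Y e
  · obtain ⟨e, he, hXY⟩ := hloop
    refine ⟨{e}, ⟨0, fun _ => vt (D.X e), fun _ => e, fun _ _ _ => Fin.ext (by omega),
      fun _ _ _ => Fin.ext (by omega), fun i => ?_, ?_⟩, by simpa using he⟩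
    · have := hM.isLink e (hSm e he)
      rwa [← hXY] at this
    · ext; simp [eq_comm]
  · push Not at hloop
    -- A dart `(x, e)` stands for the vertex `x`, reached through the edge `e`.
    let Dart := {p : ℕ × ℕ // p.2 ∈ S ∧ (D.X p.2 = p.1 ∨ D.Y p.2 = p.1)}
    have hnext : ∀ p : Dart, ∃ q : Dart, q.1.2 ≠ p.1.2 ∧
        G.IsLink q.1.2 (vt p.1.1) (vt q.1.1) := by
      rintro ⟨⟨x, e⟩, he, hx⟩
      simp only at he hx ⊢
      obtain ⟨f, hf, hfe, hfx⟩ : ∃ f ∈ S, f ≠ e ∧ (D.X f = x ∨ D.Y f = x) := by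
        by_contra! hcon
        have h1 := hbd x
        rw [Finset.sum_eq_single_of_mem e he] at h1
        · have := hloop e he
          rcases hx with hx | hx
          · rw [bd, if_pos hx, if_neg (by rw [← hx]; exact this.symm)] at h1
            simp at h1
          · rw [bd, if_pos hx, if_neg (by rw [← hx]; exact this)] at h1
            simp at h1
        · intro f hf hfe
          have := hcon f hf hfe
          simp [bd, this.1, this.2]
      have hl := hM.isLink f (hSm f hf)
      rcases hfx with hfx | hfx
      · exact ⟨⟨(D.Y f, f), hf, Or.inr rfl⟩, hfe, by rw [← hfx]; exact hl⟩
      · exact ⟨⟨(D.X f, f), hf, Or.inl rfl⟩, hfe, by rw [← hfx]; exact hl.symm⟩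
    choose next hnext using hnext
    obtain ⟨e₀, he₀⟩ := hS
    let p : ℕ → Dart := fun i => next^[i] ⟨(D.X e₀, e₀), he₀, Or.inl rfl⟩
    have hp : ∀ i, p (i + 1) = next (p i) := fun i => Function.iterate_succ_apply' _ _ _
    have hlt : ∀ i, (p i).1.1 < D.n := by
      intro i
      obtain ⟨h1, h2 | h2⟩ := (p i).2
      · rw [← h2]; exact D.X_lt _ (hSm _ h1)
      · rw [← h2]; exact D.Y_lt _ (hSm _ h1)
    have hrep : ∃ j i, i < j ∧ vt (p i).1.1 = vt (p j).1.1 := by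
      obtain ⟨i, j, hij, h⟩ := Finite.exists_ne_map_eq_of_infinite
        (fun i : ℕ => (⟨(p i).1.1, hlt i⟩ : Fin D.n))
      have h' : (p i).1.1 = (p j).1.1 := congrArg Fin.val h
      rcases lt_or_gt_of_ne hij with hij | hij
      · exact ⟨j, i, hij, by rw [h']⟩
      · exact ⟨i, j, hij, by rw [h']⟩
    classical
    obtain ⟨i, hij, hx⟩ := Nat.find_spec hrep
    obtain ⟨C, hC, hCd⟩ := isCycle_of_walk (G := G) (fun i => vt (p i).1.1) (fun i => (p i).1.2)
      (fun i => by rw [hp]; exact (hnext _).2) (fun i => by rw [hp]; exact (hnext _).1) hij hx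
      (fun a b hab hb h => Nat.find_min hrep hb ⟨a, hab, h⟩)
    refine ⟨C, hC, hCd.trans ?_⟩
    rintro _ ⟨i, rfl⟩
    exact (p i).2.1

/-- The indicator of `j ∈ path e`, modulo two. -/
def cross (D : TreeData) (j e : ℕ) : ZMod 2 := if j ∈ D.path e then 1 else 0

lemma cross_eq (j e : ℕ) : D.cross j e =
    (if j ∈ D.anc (D.X e) then 1 else 0) + if j ∈ D.anc (D.Y e) then 1 else 0 := by
  rw [cross]
  simp only [mem_path]
  by_cases h1 : j ∈ D.anc (D.X e) <;> by_cases h2 : j ∈ D.anc (D.Y e) <;> simp [h1, h2]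
  exact (CharTwo.add_self_eq_zero (1 : ZMod 2)).symm

/-- Modulo two, an edge crosses the cut of `j` as often as its ends lie below `j`. Around a cycle
every vertex is counted twice. -/
lemma Models.sum_cross (hM : D.Models G vt) {C : Set ℕ} (hC : IsCycle G C) :
    ∃ F : Finset ℕ, (F : Set ℕ) = C ∧ F.Nonempty ∧ (∀ e ∈ F, e < D.m) ∧
      ∀ j, ∑ e ∈ F, D.cross j e = 0 := by
  obtain ⟨k, v, d, hv, hd, hl, rfl⟩ := hC
  have hdm : ∀ i, d i < D.m := by
    intro i
    have := (hl i).edge_mem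
    rw [hM.edgeSet_eq] at this
    exact this
  refine ⟨Finset.univ.image d, by simp, ⟨d 0, by simp⟩, ?_, fun j => ?_⟩
  · intro e he
    obtain ⟨i, -, rfl⟩ := Finset.mem_image.1 he
    exact hdm i
  · rw [Finset.sum_image fun a _ b _ h => hd h]
    have hw : ∀ i, ∃ w < D.n, vt w = v i := by
      intro i
      have := (hl i).left_mem
      rw [hM.vertexSet_eq] at this
      exact this
    choose w hwn hw using hw
    set a : Fin (k + 1) → ZMod 2 := fun i => if j ∈ D.anc (w i) then 1 else 0 with ha
    have h1 : ∀ i, D.cross j (d i) = a i + a (i + 1) := by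
      intro i
      rw [cross_eq, ha]
      have h2 := hM.isLink _ (hdm i)
      have hX := D.X_lt _ (hdm i)
      have hY := D.Y_lt _ (hdm i)
      rcases h2.eq_and_eq_or_eq_and_eq (hl i) with ⟨h3, h4⟩ | ⟨h3, h4⟩
      · rw [← hw] at h3 h4
        rw [hM.inj _ hX _ (hwn _) h3, hM.inj _ hY _ (hwn _) h4]
      · rw [← hw] at h3 h4
        rw [hM.inj _ hX _ (hwn _) h3, hM.inj _ hY _ (hwn _) h4, add_comm]
    simp only [h1]
    have h2 : ∑ i, a (i + 1) = ∑ i, a i := Equiv.sum_comp (Equiv.addRight (1 : Fin (k + 1))) a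
    rw [Finset.sum_add_distrib, h2]
    exact CharTwo.add_self_eq_zero _

/-- A cycle meets the fundamental cut of every tree edge in an even number of edges. -/
lemma Models.cycle_parity (hM : D.Models G vt) {F : Finset ℕ} (hF : IsCycle G F) {j : ℕ}
    (hj : 0 < j) (hjn : j < D.n) :
    (if D.pe j ∈ F then 1 else 0 : ZMod 2) = (((D.cov D.m j ∩ F).card : ℕ) : ZMod 2) := by
  obtain ⟨F', hF', -, hm, hsum⟩ := hM.sum_cross hF
  obtain rfl : F' = F := Finset.coe_injective hF'
  have h1 := hsum j
  classical
  rw [← Finset.sum_filter_add_sum_filter_not F' D.IsTree] at h1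
  -- The only tree edge in the cut of `j` is `pe j`.
  have h2 : ∑ e ∈ F' with D.IsTree e, D.cross j e = if D.pe j ∈ F' then 1 else 0 := by
    have h3 : ∀ e ∈ F'.filter D.IsTree, D.cross j e = if e = D.pe j then 1 else 0 := by
      intro e he
      obtain ⟨i, hi, hin, rfl⟩ := (Finset.mem_filter.1 he).2
      simp only [cross, D.path_pe hi hin, Finset.mem_singleton]
      by_cases hji : j = i
      · simp [hji]
      · rw [if_neg hji, if_neg fun h => hji (D.pe_inj hi hin hj hjn h).symm]
    rw [Finset.sum_congr rfl h3, Finset.sum_ite_eq']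
    refine if_congr ?_ rfl rfl
    rw [Finset.mem_filter]
    exact ⟨fun h => h.1, fun h => ⟨h, j, hj, hjn, rfl⟩⟩
  have h3 : ∑ e ∈ F' with ¬ D.IsTree e, D.cross j e = (((D.cov D.m j ∩ F').card : ℕ) : ZMod 2) := by
    simp only [cross]
    rw [← Finset.sum_filter, Finset.sum_const, nsmul_one]
    congr 2
    ext e
    simp only [Finset.mem_filter, Finset.mem_inter, mem_cov]
    constructor
    · rintro ⟨⟨h4, h5⟩, h6⟩
      exact ⟨⟨hm e h4, h5, h6⟩, h4⟩
    · rintro ⟨⟨_, h5, h6⟩, h4⟩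
      exact ⟨⟨h4, h5⟩, h6⟩
  rw [h2, h3] at h1
  exact CharTwo.add_eq_zero.1 h1

/-- The fundamental cycle of `e`. -/
def ci (D : TreeData) (e : ℕ) : Finset ℕ := insert e ((D.path e).image D.pe)

lemma mem_ci_of_not_isTree {e f : ℕ} (he : e < D.m) (hf : ¬ D.IsTree f) :
    f ∈ D.ci e ↔ f = e := by
  rw [ci, Finset.mem_insert, or_iff_left]
  intro h
  obtain ⟨j, hj, rfl⟩ := Finset.mem_image.1 h
  have := D.path_bounds he hj
  exact hf ⟨j, this.1, this.2, rfl⟩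

lemma mem_ci_pe {e j : ℕ} (he : e < D.m) (het : ¬ D.IsTree e) (hj : 0 < j) (hjn : j < D.n) :
    D.pe j ∈ D.ci e ↔ j ∈ D.path e := by
  rw [ci, Finset.mem_insert, or_iff_right]
  · constructor
    · intro h
      obtain ⟨i, hi, hij⟩ := Finset.mem_image.1 h
      have := D.path_bounds he hi
      rwa [← D.pe_inj this.1 this.2 hj hjn hij]
    · exact Finset.mem_image_of_mem _
  · rintro rfl
    exact het ⟨j, hj, hjn, rfl⟩

lemma mem_ci_self (e : ℕ) : e ∈ D.ci e := Finset.mem_insert_self _ _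

lemma mem_ci_lt {e f : ℕ} (he : e < D.m) (hf : f ∈ D.ci e) : f < D.m := by
  by_cases h : D.IsTree f
  · exact h.lt
  · rwa [(mem_ci_of_not_isTree he h).1 hf]

/-- The boundary of the tree path telescopes to the two ends of `e` and cancels the boundary of `e`
modulo two. -/
lemma sum_bd_ci {e : ℕ} (he : e < D.m) (het : ¬ D.IsTree e) (x : ℕ) :
    ∑ f ∈ D.ci e, D.bd x f = 0 := by
  have hb : ∀ {j}, j ∈ D.path e → 0 < j ∧ j < D.n := fun h => D.path_bounds he h
  rw [ci, Finset.sum_insert, Finset.sum_image]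
  · set g : ℕ → ZMod 2 := fun v => if v = x then 1 else 0 with hg
    have h1 : ∀ j ∈ D.path e, D.bd x (D.pe j) = g j - g (D.par j) := by
      intro j hj
      have := hb hj
      rw [CharTwo.sub_eq_add, bd]
      rcases D.ends_pe j this.1 this.2 with ⟨h2, h3⟩ | ⟨h2, h3⟩ <;> rw [h2, h3]
      rw [add_comm]
    rw [Finset.sum_congr rfl h1, path, sum_symmDiff, D.sum_anc, D.sum_anc]
    change g (D.X e) + g (D.Y e) + _ = 0
    have h2 := CharTwo.add_self_eq_zero (g (D.X e))
    have h3 := CharTwo.add_self_eq_zero (g (D.Y e))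
    have h4 := CharTwo.add_self_eq_zero (g 0)
    linear_combination h2 + h3 - h4
  · intro i hi j hj hij
    have h1 := hb hi
    have h2 := hb hj
    exact D.pe_inj h1.1 h1.2 h2.1 h2.2 hij
  · intro h
    obtain ⟨j, hj, hje⟩ := Finset.mem_image.1 h
    have := hb hj
    exact het ⟨j, this.1, this.2, hje⟩

/-- A cycle containing a tree edge needs, by parity, a non-tree edge in the cut of this tree edge.
-/
lemma Models.not_subset_tree (hM : D.Models G vt) {C : Set ℕ} (hC : IsCycle G C) :
    ¬ C ⊆ {e | D.IsTree e} := by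
  intro hCt
  obtain ⟨F, rfl, ⟨e, he⟩, -, -⟩ := hM.sum_cross hC
  obtain ⟨j, hj, hjn, rfl⟩ := hCt he
  have h1 := hM.cycle_parity hC hj hjn
  have h2 : D.cov D.m j ∩ F = ∅ := by
    ext f
    simp only [Finset.mem_inter, Finset.notMem_empty, iff_false, not_and]
    intro hf hfF
    exact (D.mem_cov.1 hf).2.1 (hCt hfF)
  rw [if_pos (by exact_mod_cast he), h2] at h1
  simp at h1

/-- The cycle must contain `e`, and parity in every fundamental cut then decides which tree edges it
contains. -/
lemma Models.eq_ci (hM : D.Models G vt) {e : ℕ} (he : e < D.m) (het : ¬ D.IsTree e) {C : Set ℕ}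
    (hC : IsCycle G C) (hCt : C ⊆ insert e {f | D.IsTree f}) : C = D.ci e := by
  obtain ⟨F, rfl, -, hm, -⟩ := hM.sum_cross hC
  have heF : e ∈ F := by
    by_contra h
    refine hM.not_subset_tree hC fun f hf => (hCt hf).resolve_left ?_
    rintro rfl
    exact h hf
  have key : ∀ j, 0 < j → j < D.n → (D.pe j ∈ F ↔ j ∈ D.path e) := by
    intro j hj hjn
    have h1 := hM.cycle_parity hC hj hjn
    have h2 : D.cov D.m j ∩ F = if j ∈ D.path e then {e} else ∅ := by
      ext f
      rw [Finset.mem_inter, mem_cov]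
      split_ifs with h
      · rw [Finset.mem_singleton]
        constructor
        · rintro ⟨h3, h4⟩
          exact (hCt h4).resolve_right h3.2.1
        · rintro rfl
          exact ⟨⟨he, het, h⟩, heF⟩
      · simp only [Finset.notMem_empty, iff_false]
        rintro ⟨h3, h4⟩
        have := (hCt h4).resolve_right h3.2.1
        rw [this] at h3
        exact h h3.2.2
    rw [h2] at h1
    by_cases h3 : j ∈ D.path e <;> by_cases h4 : D.pe j ∈ F <;> simp [h3, h4] at h1 ⊢
  congr 1
  ext f
  by_cases hf : D.IsTree f
  · obtain ⟨j, hj, hjn, rfl⟩ := hf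
    rw [key j hj hjn, mem_ci_pe he het hj hjn]
  · rw [mem_ci_of_not_isTree he hf]
    constructor
    · intro h; exact (hCt h).resolve_right hf
    · rintro rfl; exact heF

lemma ci_subset {e : ℕ} (he : e < D.m) : (D.ci e : Set ℕ) ⊆ insert e {f | D.IsTree f} := by
  intro f hf
  by_cases h : D.IsTree f
  · exact Or.inr h
  · exact Or.inl ((mem_ci_of_not_isTree he h).1 hf)

/-- All degrees in `ci e` are even, so it contains a cycle, and `eq_ci` leaves no choice for this
cycle. -/
lemma Models.isCycle_ci (hM : D.Models G vt) {e : ℕ} (he : e < D.m) (het : ¬ D.IsTree e) :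
    IsCycle G (D.ci e) := by
  obtain ⟨C, hC, hCe⟩ := hM.exists_isCycle ⟨e, D.mem_ci_self e⟩ (fun f hf => mem_ci_lt he hf)
    (sum_bd_ci he het)
  rwa [← hM.eq_ci he het hC (hCe.trans (ci_subset he))]

lemma Models.isFundamentalCycle_iff (hM : D.Models G vt) {e : ℕ} {C : Set ℕ} :
    IsFundamentalCycle G {f | D.IsTree f} e C ↔ e < D.m ∧ ¬ D.IsTree e ∧ C = D.ci e := by
  constructor
  · intro h
    have he : e < D.m := by
      have := h.mem
      rw [hM.edgeSet_eq] at this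
      exact this
    exact ⟨he, h.notMem, hM.eq_ci he h.notMem h.isCycle h.subset⟩
  · rintro ⟨he, het, rfl⟩
    exact ⟨by rw [hM.edgeSet_eq]; exact he, het, hM.isCycle_ci he het, ci_subset he⟩

/-- The symmetric difference has even degrees and hence contains a cycle. If this cycle missed `e`
or `f`, it would be the fundamental cycle of the other edge and contain the common tree edge, which
has been cancelled. So it contains both, and parity in the fundamental cuts forces every tree edge
of the symmetric difference into it. -/
lemma Models.isCycle_symmDiff (hM : D.Models G vt) {e f : ℕ} (he : e < D.m) (het : ¬ D.IsTree e)
    (hf : f < D.m) (hft : ¬ D.IsTree f) (hef : f ≠ e) (h : (D.path f ∩ D.path e).Nonempty) :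
    IsCycle G (symmDiff (D.ci f) (D.ci e) : Finset ℕ) := by
  set S := symmDiff (D.ci f) (D.ci e) with hS
  have memS : ∀ {x}, x ∈ S ↔ x ∈ D.ci f ∧ x ∉ D.ci e ∨ x ∈ D.ci e ∧ x ∉ D.ci f := by
    intro x; rw [hS, Finset.mem_symmDiff]
  have hnt : ∀ {x}, ¬ D.IsTree x → (x ∈ S ↔ x = f ∨ x = e) := by
    intro x hx
    rw [memS, mem_ci_of_not_isTree he hx, mem_ci_of_not_isTree hf hx]
    constructor
    · rintro (h | h)
      · exact Or.inl h.1
      · exact Or.inr h.1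
    · rintro (rfl | rfl)
      · exact Or.inl ⟨rfl, hef⟩
      · exact Or.inr ⟨rfl, hef.symm⟩
  obtain ⟨C, hC, hCS⟩ := hM.exists_isCycle (S := S) ⟨f, (hnt hft).2 (Or.inl rfl)⟩
    (fun x hx => by
      rcases memS.1 hx with hx | hx
      · exact mem_ci_lt hf hx.1
      · exact mem_ci_lt he hx.1)
    (fun x => by rw [hS, sum_symmDiff, sum_bd_ci he het, sum_bd_ci hf hft, add_zero])
  obtain ⟨F, rfl, -, hm, -⟩ := hM.sum_cross hC
  obtain ⟨i, hi⟩ := h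
  rw [Finset.mem_inter] at hi
  have hib := D.path_bounds he hi.2
  have hiS : D.pe i ∉ S := by
    rw [memS, mem_ci_pe he het hib.1 hib.2, mem_ci_pe hf hft hib.1 hib.2]
    tauto
  have hnt' : ∀ {x}, x ∈ F → ¬ D.IsTree x → x = f ∨ x = e := fun hx hxt =>
    (hnt hxt).1 (by exact_mod_cast hCS hx)
  have heF : e ∈ F := by
    by_contra hcon
    have h1 := hM.eq_ci hf hft hC (fun x hx => by
      by_cases hxt : D.IsTree x
      · exact Or.inr hxt
      · rcases hnt' hx hxt with h | h
        · exact Or.inl h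
        · exact absurd (h ▸ hx) hcon)
    rw [Finset.coe_inj] at h1
    rw [h1] at hCS
    exact hiS (hCS (by exact_mod_cast (mem_ci_pe hf hft hib.1 hib.2).2 hi.1))
  have hfF : f ∈ F := by
    by_contra hcon
    have h1 := hM.eq_ci he het hC (fun x hx => by
      by_cases hxt : D.IsTree x
      · exact Or.inr hxt
      · rcases hnt' hx hxt with h | h
        · exact absurd (h ▸ hx) hcon
        · exact Or.inl h)
    rw [Finset.coe_inj] at h1
    rw [h1] at hCS
    exact hiS (hCS (by exact_mod_cast (mem_ci_pe he het hib.1 hib.2).2 hi.2))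
  suffices F = S by rwa [← this]
  refine Finset.Subset.antisymm (by exact_mod_cast hCS) fun x hx => ?_
  by_cases hxt : D.IsTree x
  · obtain ⟨j, hj, hjn, rfl⟩ := hxt
    rw [memS, mem_ci_pe he het hj hjn, mem_ci_pe hf hft hj hjn] at hx
    have h1 := hM.cycle_parity hC hj hjn
    have h2 : (D.cov D.m j ∩ F).card = 1 := by
      rw [Finset.card_eq_one]
      rcases hx with hx | hx
      · refine ⟨f, ?_⟩
        ext y
        rw [Finset.mem_inter, mem_cov, Finset.mem_singleton]
        constructor
        · rintro ⟨h3, h4⟩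
          rcases hnt' h4 h3.2.1 with h | rfl
          · exact h
          · exact absurd h3.2.2 hx.2
        · rintro rfl
          exact ⟨⟨hf, hft, hx.1⟩, hfF⟩
      · refine ⟨e, ?_⟩
        ext y
        rw [Finset.mem_inter, mem_cov, Finset.mem_singleton]
        constructor
        · rintro ⟨h3, h4⟩
          rcases hnt' h4 h3.2.1 with rfl | h
          · exact absurd h3.2.2 hx.2
          · exact h
        · rintro rfl
          exact ⟨⟨he, het, hx.1⟩, heF⟩
    rw [h2] at h1
    by_contra hcon
    rw [if_neg hcon] at h1
    simp at h1
  · rcases (hnt hxt).1 hx with rfl | rfl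
    · exact hfF
    · exact heF

end TreeData

/-! ### From intersections of paths to bases of the cycle lattice. -/

namespace TreeData

variable {D : TreeData} {G : Graph ℕ ℕ} {vt : ℕ → ℕ}

/-- The edges outside of the tree. -/
noncomputable def nontree (D : TreeData) : Finset ℕ :=
  @Finset.filter _ (fun e => ¬ D.IsTree e) (Classical.decPred _) (Finset.range D.m)

lemma mem_nontree {e : ℕ} : e ∈ D.nontree ↔ e < D.m ∧ ¬ D.IsTree e := by
  simp only [nontree, Finset.mem_filter, Finset.mem_range]

/-- The member of the basis given by an edge outside of the tree, or by a pair of such edges. -/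
def member (D : TreeData) : ℕ ⊕ ℕ × ℕ → Finset ℕ
  | .inl e => D.ci e
  | .inr p => symmDiff (D.ci p.1) (D.ci p.2)

/-- The characteristic vector of a member of the basis. -/
noncomputable def memberVec (D : TreeData) (k : ℕ ⊕ ℕ × ℕ) : ℕ → ℤ := indVec (D.member k : Set ℕ)

lemma indVec_apply (A : Finset ℕ) (x : ℕ) : indVec (A : Set ℕ) x = if x ∈ A then 1 else 0 := by
  rw [indVec, Set.indicator_apply]
  simp

lemma indVec_symmDiff (A B : Finset ℕ) : indVec ((symmDiff A B : Finset ℕ) : Set ℕ) =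
    indVec (A : Set ℕ) + indVec (B : Set ℕ) - (2 : ℤ) • indVec ((A ∩ B : Finset ℕ) : Set ℕ) := by
  ext x
  simp only [Pi.sub_apply, Pi.add_apply, Pi.smul_apply, indVec_apply, Finset.mem_symmDiff,
    Finset.mem_inter]
  by_cases h1 : x ∈ A <;> by_cases h2 : x ∈ B <;> simp [h1, h2]

/-- The functional that vanishes on fundamental cycles and takes the value `-1` on the tree edge
`j`. -/
noncomputable def excess (D : TreeData) (j : ℕ) : (ℕ → ℤ) →ₗ[ℤ] ℤ :=
  ∑ e ∈ D.nontree, (if j ∈ D.path e then (1 : ℤ) else 0) • (LinearMap.proj e : (ℕ → ℤ) →ₗ[ℤ] ℤ) -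
    (LinearMap.proj (D.pe j) : (ℕ → ℤ) →ₗ[ℤ] ℤ)

lemma excess_apply (j : ℕ) (y : ℕ → ℤ) : D.excess j y =
    ∑ e ∈ D.nontree, (if j ∈ D.path e then (1 : ℤ) else 0) * y e - y (D.pe j) := by
  simp only [excess, LinearMap.sub_apply, LinearMap.sum_apply, LinearMap.smul_apply,
    LinearMap.proj_apply, smul_eq_mul]

lemma excess_ci {e j : ℕ} (he : e ∈ D.nontree) (hj : 0 < j) (hjn : j < D.n) :
    D.excess j (indVec (D.ci e : Set ℕ)) = 0 := by
  have he' := mem_nontree.1 he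
  rw [excess_apply, Finset.sum_eq_single e]
  · simp only [indVec_apply, mem_ci_self, mem_ci_pe he'.1 he'.2 hj hjn]
    simp
  · intro f hf hfe
    have : f ∉ D.ci e := by rwa [mem_ci_of_not_isTree he'.1 (mem_nontree.1 hf).2]
    rw [indVec_apply, if_neg this, mul_zero]
  · intro h; exact absurd he h

lemma excess_inter {e f j : ℕ} (he : e ∈ D.nontree) (hf : f ∈ D.nontree) (hef : f ≠ e)
    (hj : 0 < j) (hjn : j < D.n) :
    D.excess j (indVec ((D.ci f ∩ D.ci e : Finset ℕ) : Set ℕ)) = - D.both (f, e) j := by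
  have he' := mem_nontree.1 he
  have hf' := mem_nontree.1 hf
  rw [excess_apply, Finset.sum_eq_zero]
  · simp only [indVec_apply, both, Finset.mem_inter, mem_ci_pe he'.1 he'.2 hj hjn,
      mem_ci_pe hf'.1 hf'.2 hj hjn, zero_sub]
  · intro x hx
    have hx' := (mem_nontree.1 hx).2
    have : x ∉ D.ci f ∩ D.ci e := by
      rw [Finset.mem_inter, mem_ci_of_not_isTree he'.1 hx', mem_ci_of_not_isTree hf'.1 hx']
      rintro ⟨rfl, rfl⟩
      exact hef rfl
    rw [indVec_apply, if_neg this, mul_zero]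

/-- The indices of the members of the basis given by the pairs in `S`. -/
noncomputable def keys (D : TreeData) (S : Finset (ℕ × ℕ)) : Finset (ℕ ⊕ ℕ × ℕ) :=
  D.nontree.disjSum S

lemma Good.mem_nontree {k : ℕ} {S : Finset (ℕ × ℕ)} (hS : D.Good k S) (hk : k ≤ D.m)
    {p : ℕ × ℕ} (hp : p ∈ S) : p.1 ∈ D.nontree ∧ p.2 ∈ D.nontree ∧ p.1 ≠ p.2 := by
  have h1 := hS.lt p hp
  have h2 := hS.nontree p hp
  exact ⟨TreeData.mem_nontree.2 ⟨by omega, h2.1⟩, TreeData.mem_nontree.2 ⟨by omega, h2.2⟩,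
    by omega⟩

/-- The functionals `excess j` kill fundamental cycles and map the member given by the pair `p` to
`2 * both p j`, so a relation among members becomes one among intersections and the pair
coefficients vanish. The coordinate of a non-tree edge `e` then isolates the coefficient of `ci e`.
-/
lemma Good.linearIndepOn {S : Finset (ℕ × ℕ)} (hS : D.Good D.m S) :
    LinearIndepOn ℤ D.memberVec (D.keys S : Set (ℕ ⊕ ℕ × ℕ)) := by
  rw [linearIndepOn_finset_iff]
  intro c hc
  rw [keys, Finset.sum_disjSum] at hc
  have hr : ∀ p ∈ S, c (.inr p) = 0 := by
    have h1 := hS.indep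
    rw [linearIndepOn_finset_iff] at h1
    refine h1 (fun p => c (.inr p)) ?_
    ext j
    rw [Finset.sum_apply, Pi.zero_apply]
    by_cases hb : 0 < j ∧ j < D.n
    · have h2 := congrArg (D.excess j) hc
      rw [map_add, map_sum, map_sum, map_zero, Finset.sum_eq_zero, zero_add] at h2
      · have h3 : ∀ p ∈ S, D.excess j (c (.inr p) • D.memberVec (.inr p)) =
            2 * (c (.inr p) • D.both p) j := by
          intro p hp
          obtain ⟨h3, h4, h5⟩ := hS.mem_nontree le_rfl hp
          rw [map_smul, memberVec, member, indVec_symmDiff, map_sub, map_add, map_smul,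
            excess_ci h3 hb.1 hb.2, excess_ci h4 hb.1 hb.2, excess_inter h4 h3 h5 hb.1 hb.2]
          simp only [smul_eq_mul, Pi.smul_apply]
          ring
        rw [Finset.sum_congr rfl h3, ← Finset.mul_sum] at h2
        omega
      · intro e he
        rw [map_smul, memberVec, member, excess_ci he hb.1 hb.2, smul_zero]
    · refine Finset.sum_eq_zero fun p hp => ?_
      obtain ⟨h3, h4, h5⟩ := hS.mem_nontree le_rfl hp
      rw [Pi.smul_apply, both_eq_zero, smul_zero]
      intro h
      exact hb (D.path_bounds (TreeData.mem_nontree.1 h4).1 h)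
  have hl : ∀ e ∈ D.nontree, c (.inl e) = 0 := by
    intro e he
    have h1 := congrFun hc e
    rw [Pi.add_apply, Finset.sum_apply, Finset.sum_apply, Pi.zero_apply, Finset.sum_eq_single e,
      Finset.sum_eq_zero, add_zero] at h1
    · rwa [Pi.smul_apply, memberVec, member, indVec_apply, if_pos (D.mem_ci_self e), smul_eq_mul,
        mul_one] at h1
    · intro p hp
      rw [hr p hp, zero_smul, Pi.zero_apply]
    · intro f hf hfe
      rw [Pi.smul_apply, memberVec, member, indVec_apply, if_neg, smul_zero]
      rw [mem_ci_of_not_isTree (TreeData.mem_nontree.1 hf).1 (TreeData.mem_nontree.1 he).2]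
      exact hfe.symm
    · intro h; exact absurd he h
  rintro (e | p) hk
  · exact hl e (Finset.inl_mem_disjSum.1 hk)
  · exact hr p (Finset.inr_mem_disjSum.1 hk)

lemma Good.member_injOn {S : Finset (ℕ × ℕ)} (hS : D.Good D.m S) :
    Set.InjOn D.member (D.keys S) := by
  intro a ha b hb hab
  exact hS.linearIndepOn.injOn ha hb (by rw [memberVec, hab, memberVec])

/-- A function on the vertices, as a function on the tree edges. -/
noncomputable def treeVec (D : TreeData) : (ℕ → ℤ) →ₗ[ℤ] (ℕ → ℤ) :=
  ∑ j ∈ Finset.Ioo 0 D.n, (LinearMap.proj j : (ℕ → ℤ) →ₗ[ℤ] ℤ).smulRight (Pi.single (D.pe j) 1)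

lemma treeVec_apply (y : ℕ → ℤ) (x : ℕ) :
    D.treeVec y x = ∑ j ∈ Finset.Ioo 0 D.n, if x = D.pe j then y j else 0 := by
  simp [treeVec, LinearMap.sum_apply, Finset.sum_apply, Pi.single_apply]

lemma treeVec_pe (y : ℕ → ℤ) {j : ℕ} (hj : 0 < j) (hjn : j < D.n) :
    D.treeVec y (D.pe j) = y j := by
  rw [treeVec_apply, Finset.sum_eq_single_of_mem j (Finset.mem_Ioo.2 ⟨hj, hjn⟩), if_pos rfl]
  intro i hi hij
  rw [Finset.mem_Ioo] at hi
  rw [if_neg]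
  intro h
  exact hij (D.pe_inj hj hjn hi.1 hi.2 h).symm

lemma treeVec_of_not_isTree (y : ℕ → ℤ) {x : ℕ} (hx : ¬ D.IsTree x) : D.treeVec y x = 0 := by
  rw [treeVec_apply]
  refine Finset.sum_eq_zero fun j hj => ?_
  rw [Finset.mem_Ioo] at hj
  rw [if_neg]
  rintro rfl
  exact hx ⟨j, hj.1, hj.2, rfl⟩

lemma treeVec_both {e f : ℕ} (he : e ∈ D.nontree) (hf : f ∈ D.nontree) (hef : f ≠ e) :
    D.treeVec (D.both (f, e)) = indVec ((D.ci f ∩ D.ci e : Finset ℕ) : Set ℕ) := by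
  have he' := mem_nontree.1 he
  have hf' := mem_nontree.1 hf
  ext x
  rw [indVec_apply]
  by_cases hx : D.IsTree x
  · obtain ⟨j, hj, hjn, rfl⟩ := hx
    rw [treeVec_pe _ hj hjn, both]
    refine if_congr ?_ rfl rfl
    rw [Finset.mem_inter, Finset.mem_inter, mem_ci_pe he'.1 he'.2 hj hjn,
      mem_ci_pe hf'.1 hf'.2 hj hjn]
  · rw [treeVec_of_not_isTree _ hx, if_neg]
    rw [Finset.mem_inter, mem_ci_of_not_isTree he'.1 hx, mem_ci_of_not_isTree hf'.1 hx]
    rintro ⟨rfl, rfl⟩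
    exact hef rfl

/-- Twice the indicator of an intersection is the sum of the two fundamental vectors minus the
vector of their symmetric difference. -/
lemma Good.two_treeVec_mem {S : Finset (ℕ × ℕ)} (hS : D.Good D.m S) {y : ℕ → ℤ}
    (hy : y ∈ Submodule.span ℤ (D.both '' (S : Set (ℕ × ℕ)))) :
    (2 : ℤ) • D.treeVec y ∈ Submodule.span ℤ (D.memberVec '' (D.keys S)) := by
  have hle : Submodule.span ℤ (D.both '' (S : Set (ℕ × ℕ))) ≤
      (Submodule.span ℤ (D.memberVec '' (D.keys S))).comap ((2 : ℤ) • D.treeVec) := by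
    rw [Submodule.span_le]
    rintro _ ⟨p, hp, rfl⟩
    obtain ⟨h3, h4, h5⟩ := hS.mem_nontree le_rfl hp
    have h : (2 : ℤ) • D.treeVec (D.both p) =
        D.memberVec (.inl p.1) + D.memberVec (.inl p.2) - D.memberVec (.inr p) := by
      rw [treeVec_both h4 h3 h5]
      simp only [memberVec, member]
      rw [indVec_symmDiff]
      abel
    change (2 : ℤ) • D.treeVec (D.both p) ∈ Submodule.span ℤ (D.memberVec '' (D.keys S))
    rw [h]
    refine Submodule.sub_mem _ (Submodule.add_mem _ ?_ ?_) ?_ <;>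
      refine Submodule.subset_span (Set.mem_image_of_mem _ ?_)
    · exact Finset.inl_mem_disjSum.2 h3
    · exact Finset.inl_mem_disjSum.2 h4
    · exact Finset.inr_mem_disjSum.2 hp
  exact hle hy

/-- At the tree edge `j`, the sum of the fundamental vectors of the non-tree edges of `C` is the
number of these edges whose paths contain `j`. By parity it exceeds the entry of `C` by twice the
half of this number, rounded down. The halves depend only on `cov` and vanish where it has at most
one element, so `Good.span` applies to them. -/
lemma Models.indVec_mem_span (hM : D.Models G vt) {S : Finset (ℕ × ℕ)} (hS : D.Good D.m S)
    {C : Set ℕ} (hC : IsCycle G C) :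
    indVec C ∈ Submodule.span ℤ (D.memberVec '' (D.keys S)) := by
  obtain ⟨F, rfl, -, hm, -⟩ := hM.sum_cross hC
  set y : ℕ → ℤ := fun j =>
    if 0 < j ∧ j < D.n then (((D.cov D.m j ∩ F).card / 2 : ℕ) : ℤ) else 0 with hy
  have hyS : y ∈ Submodule.span ℤ (D.both '' (S : Set (ℕ × ℕ))) := by
    refine hS.span y (fun j hj => ?_) (fun i j hi hin hj hjn hij => ?_)
    · by_cases hb : 0 < j ∧ j < D.n
      · refine ⟨hb.1, hb.2, ?_⟩
        simp only [hy, if_pos hb] at hj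
        have := Finset.card_le_card (Finset.inter_subset_left : D.cov D.m j ∩ F ⊆ _)
        by_contra hlt
        apply hj
        rw [Nat.div_eq_of_lt (by omega)]
        rfl
      · simp only [hy, if_neg hb] at hj
        exact absurd rfl hj
    · simp only [hy, hi, hin, hj, hjn, hij]
  have key : indVec (F : Set ℕ) =
      ∑ e ∈ D.nontree ∩ F, D.memberVec (.inl e) - (2 : ℤ) • D.treeVec y := by
    ext x
    rw [indVec_apply, Pi.sub_apply, Finset.sum_apply, Pi.smul_apply]
    by_cases hx : D.IsTree x
    · obtain ⟨j, hj, hjn, rfl⟩ := hx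
      rw [treeVec_pe _ hj hjn]
      have h1 : ∑ e ∈ D.nontree ∩ F, D.memberVec (.inl e) (D.pe j) =
          ((D.cov D.m j ∩ F).card : ℤ) := by
        have h2 : ∀ e ∈ D.nontree ∩ F, D.memberVec (.inl e) (D.pe j) =
            if j ∈ D.path e then 1 else 0 := by
          intro e he
          have he' := mem_nontree.1 (Finset.mem_inter.1 he).1
          rw [memberVec, member, indVec_apply]
          simp only [mem_ci_pe he'.1 he'.2 hj hjn]
        rw [Finset.sum_congr rfl h2, ← Finset.sum_filter, Finset.sum_const, nsmul_one]
        congr 2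
        ext e
        simp only [Finset.mem_filter, Finset.mem_inter, mem_cov, mem_nontree]
        tauto
      rw [h1]
      simp only [hy, hj, hjn, and_self, if_true, smul_eq_mul]
      have h2 := hM.cycle_parity hC hj hjn
      have h3 : (D.cov D.m j ∩ F).card % 2 = if D.pe j ∈ F then 1 else 0 := by
        have h4 : (((D.cov D.m j ∩ F).card : ℕ) : ZMod 2) =
            ((if D.pe j ∈ F then 1 else 0 : ℕ) : ZMod 2) := by
          rw [← h2]; split_ifs <;> simp
        rw [ZMod.natCast_eq_natCast_iff'] at h4
        rw [h4]; split_ifs <;> rfl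
      split_ifs at h3 ⊢ <;> omega
    · rw [treeVec_of_not_isTree _ hx, smul_zero, sub_zero]
      have h2 : ∀ e ∈ D.nontree ∩ F, D.memberVec (.inl e) x = if x = e then 1 else 0 := by
        intro e he
        have he' := mem_nontree.1 (Finset.mem_inter.1 he).1
        rw [memberVec, member, indVec_apply]
        simp only [mem_ci_of_not_isTree he'.1 hx]
      rw [Finset.sum_congr rfl h2, Finset.sum_ite_eq]
      refine if_congr ?_ rfl rfl
      rw [Finset.mem_inter, mem_nontree]
      exact ⟨fun h => ⟨⟨hm x h, hx⟩, h⟩, fun h => h.2⟩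
  rw [key]
  refine Submodule.sub_mem _ (Submodule.sum_mem _ fun e he => ?_) (hS.two_treeVec_mem hyS)
  exact Submodule.subset_span ⟨_, Finset.inl_mem_disjSum.2 (Finset.mem_inter.1 he).1, rfl⟩

lemma Models.isCycle_member (hM : D.Models G vt) {S : Finset (ℕ × ℕ)} (hS : D.Good D.m S)
    {k : ℕ ⊕ ℕ × ℕ} (hk : k ∈ D.keys S) : IsCycle G (D.member k) := by
  rcases k with e | p
  · have he := mem_nontree.1 (Finset.inl_mem_disjSum.1 hk)
    exact hM.isCycle_ci he.1 he.2
  · have hp := Finset.inr_mem_disjSum.1 hk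
    obtain ⟨h3, h4, h5⟩ := hS.mem_nontree le_rfl hp
    rw [mem_nontree] at h3 h4
    exact hM.isCycle_symmDiff h4.1 h4.2 h3.1 h3.2 h5 (hS.inter p hp)

theorem Models.isSemiFundamentalBasis (hM : D.Models G vt) {S : Finset (ℕ × ℕ)}
    (hS : D.Good D.m S) : IsSemiFundamentalBasis G {e | D.IsTree e}
      ((fun k => (D.member k : Set ℕ)) '' (D.keys S)) where
  isLatticeCycleBasis :=
    { isCycle := by
        rintro _ ⟨k, hk, rfl⟩
        exact hM.isCycle_member hS hk
      linearIndependent := LinearIndepOn.image_of_comp (fun k => (D.member k : Set ℕ)) indVec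
        hS.linearIndepOn
      span_eq := by
        rw [Set.image_image]
        refine le_antisymm (Submodule.span_mono ?_) (Submodule.span_le.2 ?_)
        · rintro _ ⟨k, hk, rfl⟩
          exact ⟨_, hM.isCycle_member hS hk, rfl⟩
        · rintro _ ⟨C, hC, rfl⟩
          exact hM.indVec_mem_span hS hC }
  fundamental_mem e C h := by
    obtain ⟨he, het, rfl⟩ := hM.isFundamentalCycle_iff.1 h
    exact ⟨.inl e, Finset.inl_mem_disjSum.2 (mem_nontree.2 ⟨he, het⟩), rfl⟩
  mem_cases := by
    rintro _ ⟨e | p, hk, rfl⟩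
    · have he := mem_nontree.1 (Finset.inl_mem_disjSum.1 hk)
      exact Or.inl ⟨e, hM.isFundamentalCycle_iff.2 ⟨he.1, he.2, rfl⟩⟩
    · have hp := Finset.inr_mem_disjSum.1 hk
      obtain ⟨h3, h4, h5⟩ := hS.mem_nontree le_rfl hp
      rw [mem_nontree] at h3 h4
      refine Or.inr ⟨p.1, p.2, D.ci p.1, D.ci p.2, h5,
        hM.isFundamentalCycle_iff.2 ⟨h3.1, h3.2, rfl⟩,
        hM.isFundamentalCycle_iff.2 ⟨h4.1, h4.2, rfl⟩, ?_, Finset.coe_symmDiff⟩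
      obtain ⟨i, hi⟩ := hS.inter p hp
      rw [Finset.mem_inter] at hi
      have hb := D.path_bounds h3.1 hi.1
      exact ⟨D.pe i, ⟨(mem_ci_pe h3.1 h3.2 hb.1 hb.2).2 hi.1,
        (mem_ci_pe h4.1 h4.2 hb.1 hb.2).2 hi.2⟩, i, hb.1, hb.2, rfl⟩

end TreeData

/-! ### Reasoning about programs -/

/-- The program `p` halts when started in `s`, and the number of steps and the final state
satisfy `Q`. -/
def WP (p : Program) (s : State) (Q : ℕ → State → Prop) : Prop :=
  ∃ t s', Runs p s t s' ∧ Q t s'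

lemma WP.mono {p : Program} {s : State} {Q Q' : ℕ → State → Prop} (h : WP p s Q)
    (hQ : ∀ t s', Q t s' → Q' t s') : WP p s Q' := by
  obtain ⟨t, s', hr, hq⟩ := h
  exact ⟨t, s', hr, hQ _ _ hq⟩

@[simp] lemma wp_instr {c : Instr} {s : State} {Q : ℕ → State → Prop} :
    WP (.instr c) s Q ↔ Q 1 (c.apply s) := by
  constructor
  · rintro ⟨t, s', ⟨⟩, h⟩
    exact h
  · intro h
    exact ⟨_, _, .instr c s, h⟩

@[simp] lemma wp_seq {p q : Program} {s : State} {Q : ℕ → State → Prop} :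
    WP (.seq p q) s Q ↔ WP p s fun t s₁ => WP q s₁ fun t' s₂ => Q (t + t') s₂ := by
  constructor
  · rintro ⟨t, s', h | h, hq⟩
    exact ⟨_, _, ‹_›, _, _, ‹_›, hq⟩
  · rintro ⟨t, s₁, h₁, t', s₂, h₂, hq⟩
    exact ⟨_, _, .seq h₁ h₂, hq⟩

@[simp] lemma wp_ite {b : Test} {p q : Program} {s : State} {Q : ℕ → State → Prop} :
    WP (.ite b p q) s Q ↔ (b.holds s → WP p s fun t => Q (t + 1)) ∧
      (¬ b.holds s → WP q s fun t => Q (t + 1)) := by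
  constructor
  · rintro ⟨t, s', h, hq⟩
    cases h with
    | ite_true hb hr => exact ⟨fun _ => ⟨_, _, hr, hq⟩, fun h => absurd hb h⟩
    | ite_false hb hr => exact ⟨fun h => absurd h hb, fun _ => ⟨_, _, hr, hq⟩⟩
  · rintro ⟨h₁, h₂⟩
    by_cases hb : b.holds s
    · obtain ⟨t, s', hr, hq⟩ := h₁ hb
      exact ⟨_, _, .ite_true hb hr, hq⟩
    · obtain ⟨t, s', hr, hq⟩ := h₂ hb
      exact ⟨_, _, .ite_false hb hr, hq⟩

lemma wp_loop_true {b : Test} {p : Program} {s : State} {Q : ℕ → State → Prop} (hb : b.holds s)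
    (h : WP p s fun t s₁ => WP (.loop b p) s₁ fun t' s₂ => Q (t + t' + 1) s₂) :
    WP (.loop b p) s Q := by
  obtain ⟨t, s₁, h₁, t', s₂, h₂, hq⟩ := h
  exact ⟨_, _, .loop_true hb h₁ h₂, hq⟩

lemma wp_loop_false {b : Test} {p : Program} {s : State} {Q : ℕ → State → Prop}
    (hb : ¬ b.holds s) (h : Q 1 s) : WP (.loop b p) s Q :=
  ⟨_, _, .loop_false hb, h⟩

/-- The rule for loops that count from `a` to `b`. The invariant `Inv k T s` states what holds in
the state `s` after `T` steps when the counter is `k`. -/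
theorem wp_for {i N a b : ℕ} {body : Program} {s : State} {Q : ℕ → State → Prop}
    (Inv : ℕ → ℕ → State → Prop) (hab : a ≤ b) (h0 : Inv a 0 s)
    (hreg : ∀ k T s, Inv k T s → s.reg i = k ∧ s.reg N = b)
    (hstep : ∀ k T s, a ≤ k → k < b → Inv k T s →
      WP body s fun t s' => Inv (k + 1) (T + t + 1) s')
    (hpost : ∀ T s, Inv b T s → Q (T + 1) s) :
    WP (.loop (.lt i N) body) s Q := by
  -- Induction on the number `d` of remaining rounds, with the steps `T` made so far as an
  -- accumulator.
  suffices key : ∀ d k T s, k + d = b → a ≤ k → Inv k T s →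
      WP (.loop (.lt i N) body) s fun t s' => Q (T + t) s' by
    have := key (b - a) a 0 s (by omega) le_rfl h0
    simpa using this
  intro d
  induction d with
  | zero =>
    intro k T s hk _ hI
    obtain ⟨h1, h2⟩ := hreg k T s hI
    refine wp_loop_false ?_ ?_
    · simp only [Test.holds]; omega
    · obtain rfl : k = b := by omega
      exact hpost T s hI
  | succ d ih =>
    intro k T s hk hak hI
    obtain ⟨h1, h2⟩ := hreg k T s hI
    refine wp_loop_true ?_ ?_
    · simp only [Test.holds]; omega
    · refine (hstep k T s hak (by omega) hI).mono fun t s₁ hI' => ?_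
      refine (ih (k + 1) _ s₁ (by omega) (by omega) hI').mono fun t' s₂ hq => ?_
      rwa [show T + (t + t' + 1) = T + t + 1 + t' by omega]

/-- `s` with the number `v` written into cell `i` of array `a`. -/
def State.setArr (s : State) (a i v : ℕ) : State :=
  { s with arr := Function.update s.arr a (Function.update (s.arr a) i v) }

@[simp] lemma reg_setReg (s : State) (x k y : ℕ) :
    (s.setReg x k).reg y = if y = x then k else s.reg y := by
  simp [State.setReg, Function.update_apply]

@[simp] lemma arr_setReg (s : State) (x k : ℕ) : (s.setReg x k).arr = s.arr := rfl

@[simp] lemma reg_setArr (s : State) (a i v : ℕ) : (s.setArr a i v).reg = s.reg := rfl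

@[simp] lemma arr_setArr (s : State) (a i v b : ℕ) :
    (s.setArr a i v).arr b = if b = a then Function.update (s.arr a) i v else s.arr b := by
  by_cases h : b = a
  · subst h; simp [State.setArr]
  · simp [State.setArr, h]

@[simp] lemma apply_const (x k : ℕ) (s : State) : (Instr.const x k).apply s = s.setReg x k := rfl
@[simp] lemma apply_copy (x y : ℕ) (s : State) :
    (Instr.copy x y).apply s = s.setReg x (s.reg y) := rfl
@[simp] lemma apply_incr (x : ℕ) (s : State) :
    (Instr.incr x).apply s = s.setReg x (s.reg x + 1) := rfl
@[simp] lemma apply_decr (x : ℕ) (s : State) :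
    (Instr.decr x).apply s = s.setReg x (s.reg x - 1) := rfl
@[simp] lemma apply_load (x a y : ℕ) (s : State) :
    (Instr.load x a y).apply s = s.setReg x (s.arr a (s.reg y)) := rfl
@[simp] lemma apply_store (a x y : ℕ) (s : State) :
    (Instr.store a x y).apply s = s.setArr a (s.reg x) (s.reg y) := rfl

@[simp] lemma holds_eq (x y : ℕ) (s : State) : (Test.eq x y).holds s ↔ s.reg x = s.reg y := Iff.rfl
@[simp] lemma holds_ne (x y : ℕ) (s : State) : (Test.ne x y).holds s ↔ s.reg x ≠ s.reg y := Iff.rfl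

/-- Registers below `20` that are not in `R`, and arrays that are not in `A`, are the same in both
states. Registers from `20` on are scratch space. -/
def Keeps (R A : List ℕ) (s s' : State) : Prop :=
  (∀ r < 20, r ∉ R → s'.reg r = s.reg r) ∧ ∀ a, a ∉ A → s'.arr a = s.arr a

lemma Keeps.refl {R A : List ℕ} (s : State) : Keeps R A s s := ⟨fun _ _ _ => rfl, fun _ _ => rfl⟩

lemma Keeps.trans {R A R' A' R'' A'' : List ℕ} {s s' s'' : State} (h : Keeps R A s s')
    (h' : Keeps R' A' s' s'') (hR : R ⊆ R'' := by simp) (hA : A ⊆ A'' := by simp)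
    (hR' : R' ⊆ R'' := by simp) (hA' : A' ⊆ A'' := by simp) : Keeps R'' A'' s s'' :=
  ⟨fun r hr hrR => (h'.1 r hr fun h => hrR (hR' h)).trans (h.1 r hr fun h => hrR (hR h)),
    fun a ha => (h'.2 a fun h => ha (hA' h)).trans (h.2 a fun h => ha (hA h))⟩

lemma Keeps.reg {R A : List ℕ} {s s' : State} (h : Keeps R A s s') (r : ℕ)
    (hr : r < 20 := by norm_num) (hR : r ∉ R := by simp) : s'.reg r = s.reg r := h.1 r hr hR

lemma Keeps.arr {R A : List ℕ} {s s' : State} (h : Keeps R A s s') (a : ℕ)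
    (ha : a ∉ A := by simp) : s'.arr a = s.arr a := h.2 a ha

/-- Sequential composition. -/
infixr:60 " ;; " => Program.seq

/-- An instruction without effect. -/
def skip : Program := .instr (.copy 20 20)

@[simp] lemma wp_skip {s : State} {Q : ℕ → State → Prop} : WP skip s Q ↔ Q 1 s := by
  rw [skip, wp_instr, apply_copy]
  suffices s.setReg 20 (s.reg 20) = s by rw [this]
  simp [State.setReg]

/-! ### The state of the computation after the tree has been found -/

/-- The state `s` holds the data `D`: registers `3` and `4` hold the constants `0` and `1`, arrays
`8` and `9` the parents and the tree edges, array `10` marks the tree edges, and arrays `11` and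
`12` hold the ends of the edges. -/
structure Base (D : TreeData) (s : State) : Prop where
  reg0 : s.reg 0 = D.n
  reg1 : s.reg 1 = D.m
  reg3 : s.reg 3 = 0
  reg4 : s.reg 4 = 1
  par : s.arr 8 = D.par
  pe : s.arr 9 = D.pe
  tree : ∀ e, s.arr 10 e = 0 ↔ ¬ D.IsTree e
  X : s.arr 11 = D.X
  Y : s.arr 12 = D.Y

lemma Base.keeps {D : TreeData} {s s' : State} {R A : List ℕ} (h : Base D s) (hk : Keeps R A s s')
    (hR : 0 ∉ R ∧ 1 ∉ R ∧ 3 ∉ R ∧ 4 ∉ R := by simp)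
    (hA : 8 ∉ A ∧ 9 ∉ A ∧ 10 ∉ A ∧ 11 ∉ A ∧ 12 ∉ A := by simp) : Base D s' where
  reg0 := (hk.reg 0 (by norm_num) hR.1).trans h.reg0
  reg1 := (hk.reg 1 (by norm_num) hR.2.1).trans h.reg1
  reg3 := (hk.reg 3 (by norm_num) hR.2.2.1).trans h.reg3
  reg4 := (hk.reg 4 (by norm_num) hR.2.2.2).trans h.reg4
  par := (hk.arr 8 hA.1).trans h.par
  pe := (hk.arr 9 hA.2.1).trans h.pe
  tree := by rw [hk.arr 10 hA.2.2.1]; exact h.tree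
  X := (hk.arr 11 hA.2.2.2.1).trans h.X
  Y := (hk.arr 12 hA.2.2.2.2).trans h.Y

/-- Array `13` marks the members of `M`. -/
def Marks (s : State) (M : Finset ℕ) : Prop := ∀ j, s.arr 13 j = if j ∈ M then 1 else 0

lemma Marks.keeps {s s' : State} {M : Finset ℕ} {R A : List ℕ} (h : Marks s M)
    (hk : Keeps R A s s') (hA : 13 ∉ A := by simp) : Marks s' M := by
  intro j
  rw [hk.arr 13 hA]
  exact h j

/-- Switch the marks of all vertices between the root and the vertex in register `x`. -/
def toggle (x : ℕ) : Program :=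
  .instr (.copy 20 x) ;;
  .loop (.ne 20 3)
    (.instr (.load 21 13 20) ;;
    .ite (.eq 21 3) (.instr (.store 13 20 4)) (.instr (.store 13 20 3)) ;;
    .instr (.load 20 8 20))

/-- Labels decrease towards the root, so the climb takes at most `s.reg x` rounds of five steps.
Toggling from both ends of an edge changes exactly the marks on its path, since the common ancestors
are switched twice. -/
lemma wp_toggle {D : TreeData} {s : State} {M : Finset ℕ} (x : ℕ) (hs : Base D s)
    (hM : Marks s M) : WP (toggle x) s fun t s' =>
      t ≤ 5 * s.reg x + 2 ∧ Keeps [] [13] s s' ∧ Marks s' (symmDiff M (D.anc (s.reg x))) := by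
  rw [toggle, wp_seq, wp_instr, apply_copy]
  suffices key : ∀ u s M, s.reg 20 = u → Base D s → Marks s M →
      WP (.loop (.ne 20 3)
        (.instr (.load 21 13 20) ;;
        .ite (.eq 21 3) (.instr (.store 13 20 4)) (.instr (.store 13 20 3)) ;;
        .instr (.load 20 8 20))) s fun t s' =>
      t ≤ 5 * u + 1 ∧ Keeps [] [13] s s' ∧ Marks s' (symmDiff M (D.anc u)) by
    have hk : Keeps [] [] s (s.setReg 20 (s.reg x)) := by
      refine ⟨fun r hr _ => ?_, fun a _ => rfl⟩
      rw [reg_setReg, if_neg (by omega)]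
    refine (key (s.reg x) _ M (by simp) (hs.keeps hk) (hM.keeps hk)).mono ?_
    rintro t s' ⟨h1, h2, h3⟩
    exact ⟨by omega, hk.trans h2, h3⟩
  intro u
  induction u using Nat.strong_induction_on with
  | _ u ih =>
    intro s M hu hs hM
    rcases Nat.eq_zero_or_pos u with rfl | hu0
    · refine wp_loop_false (by simp [hu, hs.reg3]) ⟨by omega, Keeps.refl s, ?_⟩
      rwa [D.anc_zero, show symmDiff M ∅ = M from symmDiff_bot M]
    · refine wp_loop_true (by simp [hu, hs.reg3]; omega) ?_
      have hpar := D.par_lt u hu0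
      have step : ∀ s', s'.reg 20 = D.par u → Keeps [] [13] s s' →
          Marks s' (symmDiff M {u}) → WP (.loop (.ne 20 3)
            (.instr (.load 21 13 20) ;;
            .ite (.eq 21 3) (.instr (.store 13 20 4)) (.instr (.store 13 20 3)) ;;
            .instr (.load 20 8 20))) s' fun t s'' =>
          4 + t + 1 ≤ 5 * u + 1 ∧ Keeps [] [13] s s'' ∧ Marks s'' (symmDiff M (D.anc u)) := by
        intro s' hr hk hM'
        refine (ih _ hpar s' _ hr (hs.keeps hk) hM').mono ?_
        rintro t s'' ⟨h1, h2, h3⟩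
        refine ⟨by omega, hk.trans h2, ?_⟩
        rw [symmDiff_assoc] at h3
        have h4 : D.anc u = symmDiff {u} (D.anc (D.par u)) := by
          ext j
          rw [D.anc_of_pos hu0]
          simp only [Finset.mem_insert, Finset.mem_symmDiff, Finset.mem_singleton]
          constructor
          · rintro (rfl | h)
            · exact Or.inl ⟨rfl, D.notMem_anc_par hu0⟩
            · refine Or.inr ⟨h, ?_⟩
              rintro rfl
              exact D.notMem_anc_par hu0 h
          · tauto
        rwa [h4]
      simp only [wp_seq, wp_instr, wp_ite, apply_load, apply_store, holds_eq, reg_setReg,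
        arr_setReg, reg_setArr, arr_setArr, hu, hs.reg3, hs.reg4, hM u]
      simp only [if_true, if_false, Nat.reduceEqDiff]
      constructor
      · intro h
        refine step _ (by simp [hs.par]) ⟨?_, ?_⟩ ?_
        · intro r hr _
          simp only [reg_setReg, reg_setArr]
          rw [if_neg (by omega), if_neg (by omega)]
        · intro a ha
          simp only [List.mem_singleton] at ha
          simp [ha]
        · intro j
          have huM : u ∉ M := by by_contra h'; simp [h'] at h
          simp only [arr_setReg, arr_setArr, if_true, Function.update_apply, Finset.mem_symmDiff,
            Finset.mem_singleton]
          by_cases hj : j = u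
          · simp [hj, huM]
          · simp [hj, hM j]
      · intro h
        refine step _ (by simp [hs.par]) ⟨?_, ?_⟩ ?_
        · intro r hr _
          simp only [reg_setReg, reg_setArr]
          rw [if_neg (by omega), if_neg (by omega)]
        · intro a ha
          simp only [List.mem_singleton] at ha
          simp [ha]
        · intro j
          have huM : u ∈ M := by by_contra h'; simp [h'] at h
          simp only [arr_setReg, arr_setArr, if_true, Function.update_apply, Finset.mem_symmDiff,
            Finset.mem_singleton]
          by_cases hj : j = u
          · simp [hj, huM]
          · simp [hj, hM j]

lemma Keeps.setReg {R A : List ℕ} {s s' : State} (h : Keeps R A s s') {x k : ℕ}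
    (hx : x ∈ R ∨ 20 ≤ x) : Keeps R A s (s'.setReg x k) := by
  refine ⟨fun r hr hR => ?_, h.2⟩
  rw [reg_setReg, if_neg]
  · exact h.1 r hr hR
  · rintro rfl
    rcases hx with hx | hx
    · exact hR hx
    · omega

lemma Keeps.setArr {R A : List ℕ} {s s' : State} (h : Keeps R A s s') {a i v : ℕ}
    (ha : a ∈ A) : Keeps R A s (s'.setArr a i v) := by
  refine ⟨h.1, fun b hb => ?_⟩
  rw [arr_setArr, if_neg]
  · exact h.2 b hb
  · rintro rfl
    exact hb ha

/-! ### Writing the output -/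

/-- The lists `Ls` are stored in `off` and `cells`, and the list `L` is being written behind them. -/
structure Stored (off cells : ℕ → ℕ) (cnt wp : ℕ) (Ls : List (List ℕ)) (L : List ℕ) : Prop where
  cnt_eq : cnt = Ls.length
  wp_eq : wp = off cnt + L.length
  mono : ∀ i ≤ cnt, ∀ j ≤ i, off j ≤ off i
  lists : ∀ i (h : i < Ls.length),
    (List.range' (off i) (off (i + 1) - off i)).map cells = Ls[i]
  last : (List.range' (off cnt) L.length).map cells = L

lemma Stored.push {off cells : ℕ → ℕ} {cnt wp : ℕ} {Ls : List (List ℕ)} {L : List ℕ}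
    (h : Stored off cells cnt wp Ls L) (v : ℕ) :
    Stored off (Function.update cells wp v) cnt (wp + 1) Ls (L ++ [v]) where
  cnt_eq := h.cnt_eq
  wp_eq := by rw [h.wp_eq]; simp; omega
  mono := h.mono
  lists i hi := by
    rw [← h.lists i hi]
    refine List.map_congr_left fun x hx => ?_
    rw [List.mem_range'_1] at hx
    have h1 := h.mono cnt le_rfl (i + 1) (by rw [h.cnt_eq]; omega)
    have h2 := h.wp_eq
    exact Function.update_of_ne (by omega) _ _
  last := by
    rw [List.length_append, List.length_singleton, List.range'_1_concat, List.map_append,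
      ← h.wp_eq, List.map_singleton, Function.update_self]
    congr 1
    refine (List.map_congr_left fun x hx => ?_).trans h.last
    rw [List.mem_range'_1] at hx
    have h2 := h.wp_eq
    exact Function.update_of_ne (by omega) _ _

lemma Stored.close {off cells : ℕ → ℕ} {cnt wp : ℕ} {Ls : List (List ℕ)} {L : List ℕ}
    (h : Stored off cells cnt wp Ls L) :
    Stored (Function.update off (cnt + 1) wp) cells (cnt + 1) wp (Ls ++ [L]) [] where
  cnt_eq := by simp [h.cnt_eq]
  wp_eq := by simp
  mono i hi j hj := by
    have hw := h.wp_eq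
    by_cases hi' : i = cnt + 1
    · subst hi'
      rw [Function.update_self]
      by_cases hj' : j = cnt + 1
      · rw [hj', Function.update_self]
      · rw [Function.update_of_ne hj']
        have := h.mono cnt le_rfl j (by omega)
        omega
    · rw [Function.update_of_ne hi', Function.update_of_ne (by omega)]
      exact h.mono i (by omega) j hj
  lists i hi := by
    have hc := h.cnt_eq
    rw [List.length_append, List.length_singleton] at hi
    rw [Function.update_of_ne (by omega)]
    by_cases hi' : i = cnt
    · subst hi'
      rw [Function.update_self, List.getElem_append_right (by omega)]
      simp only [hc, Nat.sub_self, List.getElem_singleton]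
      have h1 := h.last
      have h2 := h.wp_eq
      rw [hc] at h1 h2
      rw [h2, Nat.add_sub_cancel_left]
      exact h1
    · rw [Function.update_of_ne (by omega), List.getElem_append_left (by omega)]
      exact h.lists i (by omega)
  last := rfl

/-- The output part of the state `s` holds the lists `Ls`, and behind them the list `L`. -/
def Out (s : State) (Ls : List (List ℕ)) (L : List ℕ) : Prop :=
  Stored (s.arr 5) (s.arr 6) (s.reg 2) (s.reg 5) Ls L

lemma Out.keeps {s s' : State} {Ls : List (List ℕ)} {L : List ℕ} {R A : List ℕ}
    (h : Out s Ls L) (hk : Keeps R A s s') (hR : 2 ∉ R ∧ 5 ∉ R := by simp)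
    (hA : 5 ∉ A ∧ 6 ∉ A := by simp) : Out s' Ls L := by
  rw [Out, hk.arr 5 hA.1, hk.arr 6 hA.2, hk.reg 2 (by norm_num) hR.1, hk.reg 5 (by norm_num) hR.2]
  exact h

/-- The list of the tree edges below the vertices in `M`. -/
def treeList (D : TreeData) (M : Finset ℕ) (k : ℕ) : List ℕ :=
  ((List.range' 1 (k - 1)).filter (· ∈ M)).map D.pe

lemma mem_treeList {D : TreeData} {M : Finset ℕ} {x : ℕ} :
    x ∈ treeList D M D.n ↔ ∃ j, 0 < j ∧ j < D.n ∧ j ∈ M ∧ D.pe j = x := by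
  simp only [treeList, List.mem_map, List.mem_filter, List.mem_range'_1, decide_eq_true_eq]
  constructor
  · rintro ⟨j, ⟨h1, h2⟩, h3⟩
    exact ⟨j, by omega, by omega, h2, h3⟩
  · rintro ⟨j, h1, h2, h3, h4⟩
    exact ⟨j, ⟨by omega, h3⟩, h4⟩

lemma nodup_treeList (D : TreeData) (M : Finset ℕ) : (treeList D M D.n).Nodup := by
  refine List.Nodup.map_on ?_ (List.Nodup.filter _ (List.nodup_range' (step := 1)))
  intro i hi j hj hij
  rw [List.mem_filter, List.mem_range'_1] at hi hj
  exact D.pe_inj (by omega) (by omega) (by omega) (by omega) hij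

/-- Write the tree edges below the marked vertices. -/
def emitTree : Program :=
  .instr (.const 20 1) ;;
  .loop (.lt 20 0)
    (.instr (.load 21 13 20) ;;
    .ite (.eq 21 4)
      (.instr (.load 22 9 20) ;; .instr (.store 6 5 22) ;; .instr (.incr 5)) skip ;;
    .instr (.incr 20))

lemma wp_emitTree {D : TreeData} {s : State} {M : Finset ℕ} {Ls : List (List ℕ)}
    (hs : Base D s) (hM : Marks s M) (hO : Out s Ls []) :
    WP emitTree s fun t s' =>
      t ≤ 7 * D.n + 2 ∧ Keeps [5] [6] s s' ∧ Out s' Ls (treeList D M D.n) := by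
  rw [emitTree, wp_seq, wp_instr, apply_const]
  refine wp_for (a := 1) (b := D.n) (fun k T s₁ => T ≤ 7 * k ∧ s₁.reg 20 = k ∧
    Keeps [5] [6] s s₁ ∧ Out s₁ Ls (treeList D M k)) D.n_pos ?_ ?_ ?_ ?_
  · exact ⟨by omega, by simp, (Keeps.refl s).setReg (by decide),
      hO.keeps ((Keeps.refl (R := []) (A := []) s).setReg (by decide))⟩
  · rintro k T s₁ ⟨h1, h2, h3, h4⟩
    exact ⟨h2, (h3.reg 0).trans hs.reg0⟩
  · rintro k T s₁ hk hkn ⟨h1, h2, h3, h4⟩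
    have hm := (hM.keeps h3) k
    have e4 := (h3.reg 4).trans hs.reg4
    have e9 := (h3.arr 9).trans hs.pe
    have hlist : treeList D M (k + 1) = treeList D M k ++ if k ∈ M then [D.pe k] else [] := by
      obtain ⟨k, rfl⟩ := Nat.exists_eq_add_of_le' hk
      simp only [treeList, Nat.add_sub_cancel, List.range'_1_concat, List.filter_append,
        List.map_append, List.append_cancel_left_eq]
      rw [Nat.add_comm 1 k]
      split_ifs with h <;> simp [h]
    simp only [wp_seq, wp_instr, wp_ite, apply_load, apply_store, apply_incr, holds_eq, reg_setReg,
      arr_setReg, reg_setArr, wp_skip, if_true, if_false, Nat.reduceEqDiff, h2, e4, e9,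
      hm]
    constructor
    · intro h
      have hkM : k ∈ M := by by_contra h'; simp [h'] at h
      refine ⟨by omega, trivial, ?_, ?_⟩
      · exact ((((h3.setReg (by decide)).setReg (by decide)).setArr (by decide)).setReg
          (by decide)).setReg (by decide)
      · rw [if_pos hkM] at hlist
        rw [hlist]
        simpa [Out] using h4.push (D.pe k)
    · intro h
      have hkM : k ∉ M := by intro h'; simp [h'] at h
      refine ⟨by omega, trivial, (h3.setReg (by decide)).setReg (by decide), ?_⟩
      rw [if_neg hkM, List.append_nil] at hlist
      rw [hlist]
      simpa [Out] using h4
  · rintro T s₁ ⟨h1, h2, h3, h4⟩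
    exact ⟨by omega, h3, h4⟩

/-- Write the edge in register `r`. -/
def emitEdge (r : ℕ) : Program := .instr (.store 6 5 r) ;; .instr (.incr 5)

lemma wp_emitEdge {s : State} {Ls : List (List ℕ)} {L : List ℕ} (r : ℕ) (hO : Out s Ls L) :
    WP (emitEdge r) s fun t s' =>
      t = 2 ∧ Keeps [5] [6] s s' ∧ Out s' Ls (L ++ [s.reg r]) := by
  simp only [emitEdge, wp_seq, wp_instr, apply_store, apply_incr]
  refine ⟨trivial, ((Keeps.refl s).setArr (by decide)).setReg (by decide), ?_⟩
  simpa [Out] using hO.push (s.reg r)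

/-- Finish the list that is being written. -/
def closeList : Program := .instr (.incr 2) ;; .instr (.store 5 2 5)

lemma wp_closeList {s : State} {Ls : List (List ℕ)} {L : List ℕ} (hO : Out s Ls L) :
    WP closeList s fun t s' =>
      t = 2 ∧ Keeps [2] [5] s s' ∧ Out s' (Ls ++ [L]) [] := by
  simp only [closeList, wp_seq, wp_instr, apply_store, apply_incr]
  refine ⟨trivial, ((Keeps.refl s).setReg (by decide)).setArr (by decide), ?_⟩
  simpa [Out] using hO.close

/-- The output consists of the members of the basis with indices `Ks`. -/
def OutKeys (D : TreeData) (s : State) (Ks : List (ℕ ⊕ ℕ × ℕ)) : Prop :=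
  ∃ Ls, Out s Ls [] ∧ List.Forall₂ (fun L k => L.Nodup ∧ ∀ x, x ∈ L ↔ x ∈ D.member k) Ls Ks

lemma OutKeys.keeps {D : TreeData} {s s' : State} {Ks : List (ℕ ⊕ ℕ × ℕ)} {R A : List ℕ}
    (h : OutKeys D s Ks) (hk : Keeps R A s s') (hR : 2 ∉ R ∧ 5 ∉ R := by simp)
    (hA : 5 ∉ A ∧ 6 ∉ A := by simp) : OutKeys D s' Ks := by
  obtain ⟨Ls, h1, h2⟩ := h
  exact ⟨Ls, h1.keeps hk hR hA, h2⟩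

lemma forall₂_concat {α β : Type*} {r : α → β → Prop} {l : List α} {l' : List β} {a : α} {b : β}
    (h : List.Forall₂ r l l') (hab : r a b) : List.Forall₂ r (l ++ [a]) (l' ++ [b]) := by
  induction h with
  | nil => exact .cons hab .nil
  | cons h _ ih => exact .cons h ih

/-- Write the fundamental cycle of the edge in register `7`. -/
def emitFundamental : Program := emitTree ;; emitEdge 7 ;; closeList

lemma wp_emitFundamental {D : TreeData} {s : State} {e : ℕ} {Ks : List (ℕ ⊕ ℕ × ℕ)}
    (hs : Base D s) (hM : Marks s (D.path e)) (hO : OutKeys D s Ks) (he : e < D.m)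
    (het : ¬ D.IsTree e) (h7 : s.reg 7 = e) :
    WP emitFundamental s fun t s' =>
      t ≤ 7 * D.n + 6 ∧ Keeps [2, 5] [5, 6] s s' ∧ OutKeys D s' (Ks ++ [.inl e]) := by
  obtain ⟨Ls, hL, hLK⟩ := hO
  rw [emitFundamental, wp_seq]
  refine (wp_emitTree hs hM hL).mono ?_
  rintro t₁ s₁ ⟨ht₁, hk₁, hO₁⟩
  rw [wp_seq]
  refine (wp_emitEdge 7 hO₁).mono ?_
  rintro t₂ s₂ ⟨ht₂, hk₂, hO₂⟩
  refine (wp_closeList hO₂).mono ?_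
  rintro t₃ s₃ ⟨ht₃, hk₃, hO₃⟩
  refine ⟨by omega, (hk₁.trans (R'' := [2, 5]) (A'' := [5, 6]) hk₂).trans hk₃, _, hO₃,
    forall₂_concat hLK ⟨?_, fun x => ?_⟩⟩
  · rw [hk₁.reg 7, h7]
    refine List.Nodup.append (nodup_treeList D _) (List.nodup_singleton e) ?_
    intro x hx hxe
    rw [List.mem_singleton] at hxe
    subst hxe
    obtain ⟨j, hj, hjn, -, h⟩ := mem_treeList.1 hx
    exact het ⟨j, hj, hjn, h⟩
  · rw [hk₁.reg 7, h7, List.mem_append, List.mem_singleton, mem_treeList, TreeData.member,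
      TreeData.ci, Finset.mem_insert, Finset.mem_image, or_comm]
    refine or_congr_right ⟨?_, ?_⟩
    · rintro ⟨j, _, _, h1, h2⟩
      exact ⟨j, h1, h2⟩
    · rintro ⟨j, h1, h2⟩
      have := D.path_bounds he h1
      exact ⟨j, this.1, this.2, h1, h2⟩

/-- Write the symmetric difference of the fundamental cycles of the edges in registers `12` and
`7`. -/
def emitPair : Program := emitTree ;; emitEdge 12 ;; emitEdge 7 ;; closeList

/-- The marked vertices give the tree part of the symmetric difference; outside of the tree it
consists of `f` and `e` alone. -/
lemma wp_emitPair {D : TreeData} {s : State} {e f : ℕ} {Ks : List (ℕ ⊕ ℕ × ℕ)}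
    (hs : Base D s) (hM : Marks s (symmDiff (D.path f) (D.path e))) (hO : OutKeys D s Ks)
    (he : e < D.m) (het : ¬ D.IsTree e) (hfe : f < e) (hft : ¬ D.IsTree f) (h7 : s.reg 7 = e)
    (h12 : s.reg 12 = f) :
    WP emitPair s fun t s' =>
      t ≤ 7 * D.n + 8 ∧ Keeps [2, 5] [5, 6] s s' ∧ OutKeys D s' (Ks ++ [.inr (f, e)]) := by
  obtain ⟨Ls, hL, hLK⟩ := hO
  rw [emitPair, wp_seq]
  refine (wp_emitTree hs hM hL).mono ?_
  rintro t₁ s₁ ⟨ht₁, hk₁, hO₁⟩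
  rw [wp_seq]
  refine (wp_emitEdge 12 hO₁).mono ?_
  rintro t₂ s₂ ⟨ht₂, hk₂, hO₂⟩
  rw [wp_seq]
  refine (wp_emitEdge 7 hO₂).mono ?_
  rintro t₃ s₃ ⟨ht₃, hk₃, hO₃⟩
  refine (wp_closeList hO₃).mono ?_
  rintro t₄ s₄ ⟨ht₄, hk₄, hO₄⟩
  refine ⟨by omega, ((hk₁.trans (R'' := [2, 5]) (A'' := [5, 6]) hk₂).trans
    (R'' := [2, 5]) (A'' := [5, 6]) hk₃).trans hk₄, _, hO₄,
    forall₂_concat hLK ⟨?_, fun x => ?_⟩⟩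
  · rw [hk₂.reg 7, hk₁.reg 12, hk₁.reg 7, h7, h12, List.append_assoc]
    refine List.Nodup.append (nodup_treeList D _) (by simp; omega) ?_
    intro x hx hxe
    obtain ⟨j, hj, hjn, -, h⟩ := mem_treeList.1 hx
    simp only [List.singleton_append, List.mem_cons, List.not_mem_nil, or_false] at hxe
    rcases hxe with rfl | rfl
    · exact hft ⟨j, hj, hjn, h⟩
    · exact het ⟨j, hj, hjn, h⟩
  · rw [hk₂.reg 7, hk₁.reg 12, hk₁.reg 7, h7, h12, TreeData.member, Finset.mem_symmDiff]
    simp only [List.mem_append, List.mem_singleton, mem_treeList]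
    have hf := hfe.trans he
    by_cases hx : D.IsTree x
    · obtain ⟨j, hj, hjn, rfl⟩ := hx
      rw [TreeData.mem_ci_pe he het hj hjn, TreeData.mem_ci_pe hf hft hj hjn,
        ← Finset.mem_symmDiff]
      constructor
      · rintro ((⟨i, hi, hin, h1, h2⟩ | h) | h)
        · rwa [← D.pe_inj hi hin hj hjn h2]
        · exact absurd ⟨j, hj, hjn, h⟩ hft
        · exact absurd ⟨j, hj, hjn, h⟩ het
      · intro h
        exact Or.inl (Or.inl ⟨j, hj, hjn, h, rfl⟩)
    · rw [TreeData.mem_ci_of_not_isTree he hx, TreeData.mem_ci_of_not_isTree hf hx]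
      constructor
      · rintro ((⟨i, hi, hin, h1, h2⟩ | h) | h)
        · exact absurd ⟨i, hi, hin, h2⟩ hx
        · exact Or.inl ⟨h, by omega⟩
        · exact Or.inr ⟨h, by omega⟩
      · rintro (h | h)
        · exact Or.inl (Or.inr h.1)
        · exact Or.inr h.1

open TreeData

/-! ### Maintaining the classes of tree edges -/

/-- `c` labels the classes of tree edges passed by the same paths of edges `< k`, with labels less
than `f`, and `d` gives the number of these paths. -/
structure IsClasses (D : TreeData) (k : ℕ) (c d : ℕ → ℕ) (f : ℕ) : Prop where
  eq_iff : ∀ i j, 0 < i → i < D.n → 0 < j → j < D.n → (c i = c j ↔ D.cov k i = D.cov k j)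
  lt : ∀ i, 0 < i → i < D.n → c i < f
  deg : ∀ i, 0 < i → i < D.n → d i = (D.cov k i).card

lemma IsClasses.succ_of_isTree {D : TreeData} {e : ℕ} {c d : ℕ → ℕ} {f : ℕ}
    (h : IsClasses D e c d f) (he : D.IsTree e) : IsClasses D (e + 1) c d f where
  eq_iff := by simpa only [cov_succ_of_isTree he] using h.eq_iff
  lt := h.lt
  deg := by simpa only [cov_succ_of_isTree he] using h.deg

/-- The classes for the edges `< e` are refined by the path of `e`, and the tree edges below the
vertices `< k` have been treated: `cl`, `dg` are the new labels and degrees, `sn` marks the old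
classes that the path of `e` has been found to meet, and `nd` gives the label for the common part
of the path and such a class, `rp` marks the representatives, and `fl = 1` if there are some. -/
structure Refining (D : TreeData) (e : ℕ) (c d : ℕ → ℕ) (f k : ℕ) (cl dg sn nd rp : ℕ → ℕ)
    (fr fl : ℕ) : Prop where
  cl_ge : ∀ i, k ≤ i → cl i = c i
  dg_ge : ∀ i, k ≤ i → dg i = d i
  cl_lt : ∀ i, 0 < i → i < k → cl i = if i ∈ D.path e then nd (c i) else c i
  dg_lt : ∀ i, 0 < i → i < k → dg i = d i + if i ∈ D.path e then 1 else 0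
  sn_le : ∀ a, sn a ≤ e + 1
  sn_iff : ∀ a, sn a = e + 1 ↔ ∃ i, 0 < i ∧ i < k ∧ i ∈ D.path e ∧ c i = a
  nd_lt : ∀ a, sn a = e + 1 → f ≤ nd a ∧ nd a < fr
  nd_inj : ∀ a b, sn a = e + 1 → sn b = e + 1 → nd a = nd b → a = b
  fr_ge : f ≤ fr
  rp_lt : ∀ i, 0 < i → i < k → rp i = if i ∈ D.reps e then 1 else 0
  fl_iff : fl = 1 ↔ ∃ i, 0 < i ∧ i < k ∧ i ∈ D.reps e

namespace Refining

variable {D : TreeData} {e f k : ℕ} {c d cl dg sn nd rp : ℕ → ℕ} {fr fl : ℕ}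

/-- Earlier stamps are at most `e`, so the stamp `e + 1` is fresh and the array need not be cleared.
-/
lemma init (hsn : ∀ a, sn a ≤ e) : Refining D e c d f 1 c d sn nd rp f 0 where
  cl_ge _ _ := rfl
  dg_ge _ _ := rfl
  cl_lt i h1 h2 := by omega
  dg_lt i h1 h2 := by omega
  sn_le a := (hsn a).trans (Nat.le_succ e)
  sn_iff a := by
    have := hsn a
    constructor
    · omega
    · rintro ⟨i, h1, h2, -⟩; omega
  nd_lt a h := by have := hsn a; omega
  nd_inj a b h := by have := hsn a; omega
  fr_ge := le_rfl
  rp_lt i h1 h2 := by omega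
  fl_iff := by
    constructor
    · omega
    · rintro ⟨i, h1, h2, -⟩; omega

lemma exists_lt_succ {p : ℕ → Prop} (hk : 0 < k) :
    (∃ i, 0 < i ∧ i < k + 1 ∧ p i) ↔ (∃ i, 0 < i ∧ i < k ∧ p i) ∨ p k := by
  constructor
  · rintro ⟨i, h1, h2, h3⟩
    rcases Nat.lt_succ_iff_lt_or_eq.1 h2 with h | rfl
    · exact Or.inl ⟨i, h1, h, h3⟩
    · exact Or.inr h3
  · rintro (⟨i, h1, h2, h3⟩ | h)
    · exact ⟨i, h1, by omega, h3⟩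
    · exact ⟨k, hk, by omega, h⟩

lemma step_off (h : Refining D e c d f k cl dg sn nd rp fr fl) (hk : 0 < k) (hkP : k ∉ D.path e) :
    Refining D e c d f (k + 1) cl dg sn nd (Function.update rp k 0) fr fl where
  cl_ge i hi := h.cl_ge i (by omega)
  dg_ge i hi := h.dg_ge i (by omega)
  cl_lt i h1 h2 := by
    rcases Nat.lt_succ_iff_lt_or_eq.1 h2 with h' | rfl
    · exact h.cl_lt i h1 h'
    · rw [if_neg hkP, h.cl_ge i le_rfl]
  dg_lt i h1 h2 := by
    rcases Nat.lt_succ_iff_lt_or_eq.1 h2 with h' | rfl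
    · exact h.dg_lt i h1 h'
    · rw [if_neg hkP, h.dg_ge i le_rfl, add_zero]
  sn_le := h.sn_le
  sn_iff a := by
    rw [h.sn_iff, exists_lt_succ hk, or_iff_left]
    exact fun h' => hkP h'.1
  nd_lt := h.nd_lt
  nd_inj := h.nd_inj
  fr_ge := h.fr_ge
  rp_lt i h1 h2 := by
    rcases Nat.lt_succ_iff_lt_or_eq.1 h2 with h' | rfl
    · rw [Function.update_of_ne (by omega)]
      exact h.rp_lt i h1 h'
    · rw [Function.update_self, if_neg fun h' => hkP (reps_subset h')]
  fl_iff := by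
    rw [h.fl_iff, exists_lt_succ hk, or_iff_left]
    exact fun h' => hkP (reps_subset h')

lemma step_seen (h : Refining D e c d f k cl dg sn nd rp fr fl) (hk : 0 < k) (hkn : k < D.n)
    (hc : IsClasses D e c d f) (hkP : k ∈ D.path e) (hs : sn (c k) = e + 1) :
    Refining D e c d f (k + 1) (Function.update cl k (nd (c k))) (Function.update dg k (d k + 1))
      sn nd (Function.update rp k 0) fr fl := by
  -- A smaller edge of the same class on the path takes precedence.
  have hkR : k ∉ D.reps e := by
    intro hkR
    obtain ⟨i, hi, hik, hiP, hci⟩ := (h.sn_iff _).1 hs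
    exact (D.mem_reps.1 hkR).2.2.2 i hiP hik ((hc.eq_iff i k hi (by omega) hk hkn).1 hci)
  exact
  { cl_ge := fun i hi => by rw [Function.update_of_ne (by omega)]; exact h.cl_ge i (by omega)
    dg_ge := fun i hi => by rw [Function.update_of_ne (by omega)]; exact h.dg_ge i (by omega)
    cl_lt := fun i h1 h2 => by
      rcases Nat.lt_succ_iff_lt_or_eq.1 h2 with h' | rfl
      · rw [Function.update_of_ne (by omega)]; exact h.cl_lt i h1 h'
      · rw [Function.update_self, if_pos hkP]
    dg_lt := fun i h1 h2 => by
      rcases Nat.lt_succ_iff_lt_or_eq.1 h2 with h' | rfl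
      · rw [Function.update_of_ne (by omega)]; exact h.dg_lt i h1 h'
      · rw [Function.update_self, if_pos hkP]
    sn_le := h.sn_le
    sn_iff := fun a => by
      rw [exists_lt_succ hk, ← h.sn_iff, or_iff_left_of_imp]
      rintro ⟨-, rfl⟩
      exact hs
    nd_lt := h.nd_lt
    nd_inj := h.nd_inj
    fr_ge := h.fr_ge
    rp_lt := fun i h1 h2 => by
      rcases Nat.lt_succ_iff_lt_or_eq.1 h2 with h' | rfl
      · rw [Function.update_of_ne (by omega)]
        exact h.rp_lt i h1 h'
      · rw [Function.update_self, if_neg hkR]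
    fl_iff := by
      rw [h.fl_iff, exists_lt_succ hk, or_iff_left hkR] }

/-- Here `k` is the first edge of its class on the path, so it opens a new class with the unused
label `fr`; only such an edge can be a representative. -/
lemma step_new (h : Refining D e c d f k cl dg sn nd rp fr fl) (hk : 0 < k)
    (hkP : k ∈ D.path e) (hs : sn (c k) ≠ e + 1) {ρ fl' : ℕ}
    (hρ : ρ = 1 ∧ fl' = 1 ∧ k ∈ D.reps e ∨ ρ = 0 ∧ fl' = fl ∧ k ∉ D.reps e) :
    Refining D e c d f (k + 1) (Function.update cl k fr) (Function.update dg k (d k + 1))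
      (Function.update sn (c k) (e + 1)) (Function.update nd (c k) fr) (Function.update rp k ρ)
      (fr + 1) fl' := by
  have hne : ∀ {a}, sn a = e + 1 → a ≠ c k := by
    rintro a ha rfl
    exact hs ha
  have hsn : ∀ {a}, Function.update sn (c k) (e + 1) a = e + 1 → a ≠ c k → sn a = e + 1 := by
    intro a ha hac
    rwa [Function.update_of_ne hac] at ha
  exact
  { cl_ge := fun i hi => by rw [Function.update_of_ne (by omega)]; exact h.cl_ge i (by omega)
    dg_ge := fun i hi => by rw [Function.update_of_ne (by omega)]; exact h.dg_ge i (by omega)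
    cl_lt := fun i h1 h2 => by
      rcases Nat.lt_succ_iff_lt_or_eq.1 h2 with h' | rfl
      · rw [Function.update_of_ne (by omega), h.cl_lt i h1 h']
        split_ifs with hiP
        · rw [Function.update_of_ne (hne ((h.sn_iff _).2 ⟨i, h1, h', hiP, rfl⟩))]
        · rfl
      · rw [Function.update_self, if_pos hkP, Function.update_self]
    dg_lt := fun i h1 h2 => by
      rcases Nat.lt_succ_iff_lt_or_eq.1 h2 with h' | rfl
      · rw [Function.update_of_ne (by omega)]; exact h.dg_lt i h1 h'
      · rw [Function.update_self, if_pos hkP]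
    sn_le := fun a => by
      by_cases ha : a = c k
      · rw [ha, Function.update_self]
      · rw [Function.update_of_ne ha]; exact h.sn_le a
    sn_iff := fun a => by
      rw [exists_lt_succ hk, ← h.sn_iff]
      by_cases ha : a = c k
      · rw [ha, Function.update_self]
        exact ⟨fun _ => Or.inr ⟨hkP, rfl⟩, fun _ => rfl⟩
      · rw [Function.update_of_ne ha, or_iff_left]
        exact fun h' => ha h'.2.symm
    nd_lt := fun a ha => by
      have hfr := h.fr_ge
      by_cases hac : a = c k
      · rw [hac, Function.update_self]; omega
      · have := h.nd_lt a (hsn ha hac)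
        rw [Function.update_of_ne hac]; omega
    nd_inj := fun a b ha hb hab => by
      by_cases hac : a = c k <;> by_cases hbc : b = c k
      · rw [hac, hbc]
      · have := h.nd_lt b (hsn hb hbc)
        rw [hac, Function.update_self, Function.update_of_ne hbc] at hab
        omega
      · have := h.nd_lt a (hsn ha hac)
        rw [hbc, Function.update_self, Function.update_of_ne hac] at hab
        omega
      · rw [Function.update_of_ne hac, Function.update_of_ne hbc] at hab
        exact h.nd_inj a b (hsn ha hac) (hsn hb hbc) hab
    fr_ge := by have := h.fr_ge; omega
    rp_lt := fun i h1 h2 => by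
      rcases Nat.lt_succ_iff_lt_or_eq.1 h2 with h' | rfl
      · rw [Function.update_of_ne (by omega)]
        exact h.rp_lt i h1 h'
      · rw [Function.update_self]
        rcases hρ with h' | h'
        · rw [if_pos h'.2.2, h'.1]
        · rw [if_neg h'.2.2, h'.1]
    fl_iff := by
      rw [exists_lt_succ hk, ← h.fl_iff]
      rcases hρ with h' | h'
      · simp [h'.2.1, h'.2.2]
      · simp [h'.2.1, h'.2.2] }

/-- For the first edge of a class on the path the minimality required in `reps` is automatic. The
other conditions are read off from the degree and from the stamps `o` of the classes with a member
off the path. -/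
lemma mem_reps_iff (h : Refining D e c d f k cl dg sn nd rp fr fl) (hk : 0 < k) (hkn : k < D.n)
    (hc : IsClasses D e c d f) (he : e < D.m) {o : ℕ → ℕ}
    (ho : ∀ a, o a = e + 1 ↔ ∃ j, 0 < j ∧ j < D.n ∧ j ∉ D.path e ∧ c j = a)
    (hkP : k ∈ D.path e) (hs : sn (c k) ≠ e + 1) :
    k ∈ D.reps e ↔ d k ≠ 0 ∧ (d k = 1 ∨ o (c k) = e + 1) := by
  rw [mem_reps, hc.deg k hk hkn, Finset.card_ne_zero, ho]
  constructor
  · rintro ⟨-, h1, h2, -⟩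
    refine ⟨h1, h2.imp_right ?_⟩
    rintro ⟨j, hj, hjn, hjP, hjc⟩
    exact ⟨j, hj, hjn, hjP, (hc.eq_iff j k hj hjn hk hkn).2 hjc⟩
  · rintro ⟨h1, h2⟩
    refine ⟨hkP, h1, h2.imp_right ?_, fun i hiP hik hcov => ?_⟩
    · rintro ⟨j, hj, hjn, hjP, hjc⟩
      exact ⟨j, hj, hjn, hjP, (hc.eq_iff j k hj hjn hk hkn).1 hjc⟩
    · have hb := D.path_bounds he hiP
      exact hs ((h.sn_iff _).2 ⟨i, hb.1, hik, hiP,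
        (hc.eq_iff i k hb.1 hb.2 hk hkn).2 hcov⟩)

/-- New labels are at least `f` and old ones are below `f`, so an edge on the path never shares a
label with one off it. On either side the old classes stay apart, by injectivity of `nd` on the
path. -/
lemma isClasses (h : Refining D e c d f D.n cl dg sn nd rp fr fl) (hc : IsClasses D e c d f)
    (het : ¬ D.IsTree e) : IsClasses D (e + 1) cl dg fr where
  eq_iff i j hi hin hj hjn := by
    have hsn : ∀ i, 0 < i → i < D.n → i ∈ D.path e → sn (c i) = e + 1 := fun i hi hin hiP =>
      (h.sn_iff _).2 ⟨i, hi, hin, hiP, rfl⟩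
    rw [h.cl_lt i hi hin, h.cl_lt j hj hjn]
    by_cases hiP : i ∈ D.path e <;> by_cases hjP : j ∈ D.path e
    · rw [if_pos hiP, if_pos hjP, cov_succ_of_mem het hiP, cov_succ_of_mem het hjP]
      have h1 : nd (c i) = nd (c j) ↔ c i = c j :=
        ⟨h.nd_inj _ _ (hsn i hi hin hiP) (hsn j hj hjn hjP), fun h' => by rw [h']⟩
      rw [h1, hc.eq_iff i j hi hin hj hjn]
      constructor
      · intro h'; rw [h']
      · intro h'
        rw [← Finset.erase_insert (notMem_cov_self e i), h',
          Finset.erase_insert (notMem_cov_self e j)]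
    · rw [if_pos hiP, if_neg hjP, cov_succ_of_mem het hiP, cov_succ_of_notMem hjP]
      have h1 := (h.nd_lt _ (hsn i hi hin hiP)).1
      have h2 := hc.lt j hj hjn
      refine iff_of_false (by omega) fun h' => notMem_cov_self (D := D) e j ?_
      rw [← h']; exact Finset.mem_insert_self _ _
    · rw [if_neg hiP, if_pos hjP, cov_succ_of_notMem hiP, cov_succ_of_mem het hjP]
      have h1 := (h.nd_lt _ (hsn j hj hjn hjP)).1
      have h2 := hc.lt i hi hin
      refine iff_of_false (by omega) fun h' => notMem_cov_self (D := D) e i ?_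
      rw [h']; exact Finset.mem_insert_self _ _
    · rw [if_neg hiP, if_neg hjP, cov_succ_of_notMem hiP, cov_succ_of_notMem hjP]
      exact hc.eq_iff i j hi hin hj hjn
  lt i hi hin := by
    rw [h.cl_lt i hi hin]
    split_ifs with hiP
    · exact (h.nd_lt _ ((h.sn_iff _).2 ⟨i, hi, hin, hiP, rfl⟩)).2
    · exact (hc.lt i hi hin).trans_le h.fr_ge
  deg i hi hin := by
    rw [h.dg_lt i hi hin, hc.deg i hi hin]
    split_ifs with hiP
    · rw [cov_succ_of_mem het hiP, Finset.card_insert_of_notMem (notMem_cov_self e i)]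
    · rw [cov_succ_of_notMem hiP, add_zero]

end Refining

/-- Stamp the classes that contain an unmarked tree edge. -/
def stampLoop : Program :=
  .instr (.const 20 1) ;;
  .loop (.lt 20 0)
    (.instr (.load 21 13 20) ;;
    .ite (.ne 21 4) (.instr (.load 22 14 20) ;; .instr (.store 16 22 10)) skip ;;
    .instr (.incr 20))

/-- This is a separate pass because it must be known whether a class has members off the path when
its first edge on the path is met. -/
lemma wp_stampLoop {D : TreeData} {s : State} {P : Finset ℕ} {e : ℕ} (hs : Base D s)
    (hP : Marks s P) (h10 : s.reg 10 = e + 1) (ho : ∀ a, s.arr 16 a ≤ e) :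
    WP stampLoop s fun t s' => t ≤ 6 * D.n + 2 ∧ Keeps [] [16] s s' ∧
      (∀ a, s'.arr 16 a ≤ e + 1) ∧
      ∀ a, s'.arr 16 a = e + 1 ↔ ∃ j, 0 < j ∧ j < D.n ∧ j ∉ P ∧ s.arr 14 j = a := by
  rw [stampLoop, wp_seq, wp_instr, apply_const]
  refine wp_for (a := 1) (b := D.n) (fun k T s₁ => T ≤ 6 * k ∧ s₁.reg 20 = k ∧
    Keeps [] [16] s s₁ ∧ (∀ a, s₁.arr 16 a ≤ e + 1) ∧
      ∀ a, s₁.arr 16 a = e + 1 ↔ ∃ j, 0 < j ∧ j < k ∧ j ∉ P ∧ s.arr 14 j = a) D.n_pos ?_ ?_ ?_ ?_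
  · refine ⟨by omega, by simp, (Keeps.refl s).setReg (by decide), fun a => ?_, fun a => ?_⟩
    · exact (ho a).trans (Nat.le_succ e)
    · have := ho a
      refine iff_of_false (by rw [arr_setReg]; omega) ?_
      rintro ⟨j, h1, h2, -⟩
      omega
  · rintro k T s₁ ⟨h1, h2, h3, h4⟩
    exact ⟨h2, (h3.reg 0).trans hs.reg0⟩
  · rintro k T s₁ hk hkn ⟨h1, h2, h3, h4, h5⟩
    have hm := (hP.keeps h3) k
    have e4 := (h3.reg 4).trans hs.reg4
    have e10 := (h3.reg 10).trans h10
    have e14 := h3.arr 14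
    simp only [wp_seq, wp_instr, wp_ite, apply_load, apply_store, apply_incr, holds_ne, reg_setReg,
      arr_setReg, reg_setArr, arr_setArr, wp_skip, if_true, if_false, Nat.reduceEqDiff, h2, e4, e10,
      e14, hm]
    constructor
    · intro h
      have hkM : k ∉ P := by intro h'; simp [h'] at h
      refine ⟨by omega, trivial, ?_, fun a => ?_, fun a => ?_⟩
      · exact (((h3.setReg (by decide)).setReg (by decide)).setArr (by decide)).setReg (by decide)
      · rw [Function.update_apply]
        split_ifs
        · exact le_rfl
        · exact h4 a
      · rw [Refining.exists_lt_succ hk, ← h5, Function.update_apply]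
        split_ifs with ha
        · simp [ha, hkM]
        · rw [or_iff_left]
          exact fun h' => ha h'.2.symm
    · intro h
      have hkM : k ∈ P := by by_contra h'; simp [h'] at h
      refine ⟨by omega, trivial, (h3.setReg (by decide)).setReg (by decide), h4, fun a => ?_⟩
      rw [Refining.exists_lt_succ hk, ← h5, or_iff_left]
      exact fun h' => h'.1 hkM
  · rintro T s₁ ⟨h1, h2, h3, h4, h5⟩
    exact ⟨by omega, h3, h4, h5⟩

/-- Refine the classes of tree edges by the marked path, and mark the representatives. -/
def refineLoop : Program :=
  .instr (.const 11 0) ;;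
  .instr (.const 20 1) ;;
  .loop (.lt 20 0)
    (.instr (.store 19 20 3) ;;
    .instr (.load 21 13 20) ;;
    .ite (.eq 21 4)
      (.instr (.load 22 14 20) ;;
      .instr (.load 23 17 22) ;;
      .instr (.load 25 15 20) ;;
      .ite (.ne 23 10)
        (.instr (.store 17 22 10) ;;
        .instr (.store 18 22 6) ;;
        .instr (.incr 6) ;;
        .instr (.load 24 16 22) ;;
        .ite (.eq 25 3) skip
          (.ite (.eq 25 4) (.instr (.store 19 20 4) ;; .instr (.const 11 1))
            (.ite (.eq 24 10) (.instr (.store 19 20 4) ;; .instr (.const 11 1)) skip)))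
        skip ;;
      .instr (.load 24 18 22) ;;
      .instr (.store 14 20 24) ;;
      .instr (.incr 25) ;;
      .instr (.store 15 20 25))
      skip ;;
    .instr (.incr 20))

/-- The state version of `Refining`. -/
def RefiningState (D : TreeData) (e : ℕ) (c d : ℕ → ℕ) (f k : ℕ) (s : State) : Prop :=
  Refining D e c d f k (s.arr 14) (s.arr 15) (s.arr 17) (s.arr 18) (s.arr 19) (s.reg 6) (s.reg 11)

-- The branches of the loop body match `step_off`, `step_seen`, and the cases of `step_new`: no
-- earlier path, exactly one, or several, with or without a class member off the path.
set_option maxHeartbeats 1000000 in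
lemma wp_refineLoop {D : TreeData} {s : State} {e : ℕ} (hs : Base D s)
    (hP : Marks s (D.path e)) (h10 : s.reg 10 = e + 1) (he : e < D.m)
    (hc : IsClasses D e (s.arr 14) (s.arr 15) (s.reg 6)) (hsn : ∀ a, s.arr 17 a ≤ e)
    (ho : ∀ a, s.arr 16 a = e + 1 ↔ ∃ j, 0 < j ∧ j < D.n ∧ j ∉ D.path e ∧ s.arr 14 j = a) :
    WP refineLoop s fun t s' => t ≤ 25 * D.n + 3 ∧
      Keeps [6, 11] [14, 15, 17, 18, 19] s s' ∧
      RefiningState D e (s.arr 14) (s.arr 15) (s.reg 6) D.n s' := by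
  rw [refineLoop, wp_seq, wp_instr, apply_const, wp_seq, wp_instr, apply_const]
  refine wp_for (a := 1) (b := D.n) (fun k T s₁ => T ≤ 25 * k ∧ s₁.reg 20 = k ∧
    Keeps [6, 11] [14, 15, 17, 18, 19] s s₁ ∧
    RefiningState D e (s.arr 14) (s.arr 15) (s.reg 6) k s₁) D.n_pos ?_ ?_ ?_ ?_
  · refine ⟨by omega, by simp, ((Keeps.refl s).setReg (by decide)).setReg (by decide), ?_⟩
    have h := Refining.init (D := D) (e := e) (c := s.arr 14) (d := s.arr 15) (f := s.reg 6)
      (nd := s.arr 18) (rp := s.arr 19) hsn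
    simpa [RefiningState] using h
  · rintro k T s₁ ⟨h1, h2, h3, h4⟩
    exact ⟨h2, (h3.reg 0).trans hs.reg0⟩
  · rintro k T s₁ hk hkn ⟨h1, h2, h3, h4⟩
    have hm := (hP.keeps h3) k
    have e3 := (h3.reg 3).trans hs.reg3
    have e4 := (h3.reg 4).trans hs.reg4
    have e10 := (h3.reg 10).trans h10
    have e14 := h4.cl_ge k le_rfl
    have e15 := h4.dg_ge k le_rfl
    have e16 := h3.arr 16
    simp only [wp_seq, wp_instr, wp_ite, apply_load, apply_store, apply_incr, apply_const, holds_ne,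
      holds_eq, reg_setReg, arr_setReg, reg_setArr, arr_setArr, wp_skip, if_true, if_false,
      Nat.reduceEqDiff, Function.update_self, h2, e3, e4, e10, e14, e15, e16, hm]
    refine ⟨fun hkm => ?_, fun hkm => ?_⟩
    · have hkP : k ∈ D.path e := by by_contra h'; simp [h'] at hkm
      refine ⟨fun hseen => ?_, fun hseen => ?_⟩
      · have hrep := h4.mem_reps_iff hk hkn hc he ho hkP hseen
        refine ⟨fun hd => ?_, fun hd => ⟨fun hd1 => ?_, fun hd1 => ⟨fun ho1 => ?_, fun ho1 => ?_⟩⟩⟩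
        · refine ⟨by omega, trivial, ?_, ?_⟩
          · repeat' first | exact h3 | refine Keeps.setReg ?_ (by decide) |
              refine Keeps.setArr ?_ (by decide)
          · have h := h4.step_new (ρ := 0) (fl' := s₁.reg 11) hk hkP hseen
              (Or.inr ⟨rfl, rfl, fun h' => (hrep.1 h').1 hd⟩)
            simpa [RefiningState] using h
        · refine ⟨by omega, trivial, ?_, ?_⟩
          · repeat' first | exact h3 | refine Keeps.setReg ?_ (by decide) |
              refine Keeps.setArr ?_ (by decide)
          · have h := h4.step_new (ρ := 1) (fl' := 1) hk hkP hseen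
              (Or.inl ⟨rfl, rfl, hrep.2 ⟨hd, Or.inl hd1⟩⟩)
            simpa [RefiningState] using h
        · refine ⟨by omega, trivial, ?_, ?_⟩
          · repeat' first | exact h3 | refine Keeps.setReg ?_ (by decide) |
              refine Keeps.setArr ?_ (by decide)
          · have h := h4.step_new (ρ := 1) (fl' := 1) hk hkP hseen
              (Or.inl ⟨rfl, rfl, hrep.2 ⟨hd, Or.inr ho1⟩⟩)
            simpa [RefiningState] using h
        · refine ⟨by omega, trivial, ?_, ?_⟩
          · repeat' first | exact h3 | refine Keeps.setReg ?_ (by decide) |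
              refine Keeps.setArr ?_ (by decide)
          · have h := h4.step_new (ρ := 0) (fl' := s₁.reg 11) hk hkP hseen
              (Or.inr ⟨rfl, rfl, fun h' => (hrep.1 h').2.elim hd1 ho1⟩)
            simpa [RefiningState] using h
      · rw [not_not] at hseen
        refine ⟨by omega, trivial, ?_, ?_⟩
        · repeat' first | exact h3 | refine Keeps.setReg ?_ (by decide) |
            refine Keeps.setArr ?_ (by decide)
        · have h := h4.step_seen hk hkn hc hkP hseen
          simpa [RefiningState] using h
    · have hkP : k ∉ D.path e := by intro h'; simp [h'] at hkm
      refine ⟨by omega, trivial, ?_, ?_⟩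
      · repeat' first | exact h3 | refine Keeps.setReg ?_ (by decide) |
          refine Keeps.setArr ?_ (by decide)
      · have h := h4.step_off hk hkP
        simpa [RefiningState] using h
  · rintro T s₁ ⟨h1, h2, h3, h4⟩
    exact ⟨by omega, h3, h4⟩

open TreeData

/-! ### Choosing the pairs for an edge -/

/-- Label the components of the tree without the representatives. -/
def compLoop : Program :=
  .instr (.const 20 0) ;;
  .loop (.lt 20 0)
    (.ite (.eq 20 3) (.instr (.store 20 20 20))
      (.instr (.load 21 19 20) ;;
      .ite (.eq 21 4) (.instr (.store 20 20 20))
        (.instr (.load 22 8 20) ;; .instr (.load 23 20 22) ;; .instr (.store 20 20 23))) ;;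
    .instr (.incr 20))

/-- Parents precede their children, so the label of the parent is final when it is copied, and one
pass suffices. -/
lemma wp_compLoop {D : TreeData} {s : State} {R : Finset ℕ} (hs : Base D s)
    (hR : ∀ i, 0 < i → i < D.n → s.arr 19 i = if i ∈ R then 1 else 0) :
    WP compLoop s fun t s' => t ≤ 8 * D.n + 2 ∧ Keeps [] [20] s s' ∧
      ∀ i, i < D.n → s'.arr 20 i = if i = 0 ∨ i ∈ R then i else s'.arr 20 (D.par i) := by
  rw [compLoop, wp_seq, wp_instr, apply_const]
  refine wp_for (a := 0) (b := D.n) (fun k T s₁ => T ≤ 8 * k ∧ s₁.reg 20 = k ∧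
    Keeps [] [20] s s₁ ∧
      ∀ i, i < k → s₁.arr 20 i = if i = 0 ∨ i ∈ R then i else s₁.arr 20 (D.par i))
    (Nat.zero_le _) ?_ ?_ ?_ ?_
  · exact ⟨by omega, by simp, (Keeps.refl s).setReg (by decide), fun i hi => by omega⟩
  · rintro k T s₁ ⟨h1, h2, h3, h4⟩
    exact ⟨h2, (h3.reg 0).trans hs.reg0⟩
  · rintro k T s₁ - hkn ⟨h1, h2, h3, h4⟩
    have e3 := (h3.reg 3).trans hs.reg3
    have e4 := (h3.reg 4).trans hs.reg4
    have e8 := (h3.arr 8).trans hs.par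
    have e19 := h3.arr 19
    have upd : ∀ v, v = (if k = 0 ∨ k ∈ R then k else s₁.arr 20 (D.par k)) →
        ∀ i, i < k + 1 → Function.update (s₁.arr 20) k v i =
          if i = 0 ∨ i ∈ R then i else Function.update (s₁.arr 20) k v (D.par i) := by
      intro v hv i hi
      -- The root is treated apart because `par 0` is arbitrary.
      by_cases hi0 : i = 0
      · subst hi0
        by_cases hk0 : k = 0
        · subst hk0; simp [hv]
        · rw [Function.update_of_ne (by omega), h4 0 (by omega)]
          simp
      · have hpar := D.par_lt i (by omega)
        rw [Function.update_of_ne (show D.par i ≠ k by omega)]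
        by_cases hik : i = k
        · subst hik; rw [Function.update_self, hv]
        · rw [Function.update_of_ne hik, h4 i (by omega)]
    simp only [wp_seq, wp_instr, wp_ite, apply_load, apply_store, apply_incr, holds_eq, reg_setReg,
      arr_setReg, reg_setArr, arr_setArr, if_true, if_false, Nat.reduceEqDiff, h2, e3, e4, e8, e19]
    refine ⟨fun hk => ?_, fun hk => ⟨fun hr => ?_, fun hr => ?_⟩⟩
    · refine ⟨by omega, trivial, (h3.setArr (by decide)).setReg (by decide), upd k ?_⟩
      rw [if_pos (Or.inl hk)]
    · refine ⟨by omega, trivial, ((h3.setReg (by decide)).setArr (by decide)).setReg (by decide),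
        upd k ?_⟩
      rw [hR k (by omega) hkn] at hr
      rw [if_pos (Or.inr (by by_contra h'; simp [h'] at hr))]
    · refine ⟨by omega, trivial, ((((h3.setReg (by decide)).setReg (by decide)).setReg
        (by decide)).setArr (by decide)).setReg (by decide), upd _ ?_⟩
      rw [hR k (by omega) hkn] at hr
      rw [if_neg]
      rintro (h' | h')
      · exact hk h'
      · simp [h'] at hr
  · rintro T s₁ ⟨h1, h2, h3, h4⟩
    exact ⟨by omega, h3, h4⟩

/-- Replace the label in register `15` by the label in register `16`. -/
def relabelLoop : Program :=
  .instr (.const 20 0) ;;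
  .loop (.lt 20 0)
    (.instr (.load 21 20 20) ;;
    .ite (.eq 21 15) (.instr (.store 20 20 16)) skip ;;
    .instr (.incr 20))

lemma wp_relabelLoop {s : State} : WP relabelLoop s fun t s' => t ≤ 5 * s.reg 0 + 2 ∧
    Keeps [] [20] s s' ∧ ∀ i, i < s.reg 0 →
      s'.arr 20 i = if s.arr 20 i = s.reg 15 then s.reg 16 else s.arr 20 i := by
  rw [relabelLoop, wp_seq, wp_instr, apply_const]
  refine wp_for (a := 0) (b := s.reg 0) (fun k T s₁ => T ≤ 5 * k ∧ s₁.reg 20 = k ∧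
    Keeps [] [20] s s₁ ∧ ∀ i, s₁.arr 20 i =
      if i < k then if s.arr 20 i = s.reg 15 then s.reg 16 else s.arr 20 i else s.arr 20 i)
    (Nat.zero_le _) ?_ ?_ ?_ ?_
  · exact ⟨by omega, by simp, (Keeps.refl s).setReg (by decide), fun i => by simp⟩
  · rintro k T s₁ ⟨h1, h2, h3, h4⟩
    exact ⟨h2, h3.reg 0⟩
  · rintro k T s₁ - hkn ⟨h1, h2, h3, h4⟩
    have e15 := h3.reg 15
    have e16 := h3.reg 16
    have e20 := h4 k
    rw [if_neg (lt_irrefl k)] at e20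
    simp only [wp_seq, wp_instr, wp_ite, apply_load, apply_store, apply_incr, holds_eq, reg_setReg,
      arr_setReg, reg_setArr, arr_setArr, wp_skip, if_true, if_false, Nat.reduceEqDiff, h2, e15,
      e16, e20]
    refine ⟨fun hk => ?_, fun hk => ?_⟩
    · refine ⟨by omega, trivial, ((h3.setReg (by decide)).setArr (by decide)).setReg (by decide),
        fun i => ?_⟩
      by_cases hik : i = k
      · subst hik
        rw [Function.update_self, if_pos (Nat.lt_succ_self _), if_pos hk]
      · rw [Function.update_of_ne hik, h4 i]
        exact if_congr (by omega) rfl rfl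
    · refine ⟨by omega, trivial, (h3.setReg (by decide)).setReg (by decide), fun i => ?_⟩
      rw [h4 i]
      by_cases hik : i = k
      · subst hik
        rw [if_neg (lt_irrefl _), if_pos (Nat.lt_succ_self _), if_neg hk]
      · exact if_congr (by omega) rfl rfl
  · rintro T s₁ ⟨h1, h2, h3, h4⟩
    refine ⟨by omega, h3, fun i hi => ?_⟩
    rw [h4 i, if_pos hi]

/-- Use the edge in register `12` to merge two components. -/
def mergeStep : Program :=
  toggle 13 ;; toggle 14 ;; emitPair ;; toggle 13 ;; toggle 14 ;; relabelLoop

/-- Toggling from both ends of `f` turns the marks of the path of `e` into those of the symmetric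
difference; toggling a second time restores them. -/
lemma wp_mergeStep {D : TreeData} {s : State} {e f : ℕ} {Ks : List (ℕ ⊕ ℕ × ℕ)}
    (hs : Base D s) (hM : Marks s (D.path e)) (hO : OutKeys D s Ks) (he : e < D.m)
    (het : ¬ D.IsTree e) (hfe : f < e) (hft : ¬ D.IsTree f) (h7 : s.reg 7 = e)
    (h12 : s.reg 12 = f) (h13 : s.reg 13 = D.X f) (h14 : s.reg 14 = D.Y f) :
    WP mergeStep s fun t s' => t ≤ 32 * D.n + 20 ∧ Keeps [2, 5] [5, 6, 13, 20] s s' ∧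
      Marks s' (D.path e) ∧ OutKeys D s' (Ks ++ [.inr (f, e)]) ∧ ∀ i, i < D.n →
        s'.arr 20 i = if s.arr 20 i = s.reg 15 then s.reg 16 else s.arr 20 i := by
  have hX := D.X_lt f (hfe.trans he)
  have hY := D.Y_lt f (hfe.trans he)
  rw [mergeStep, wp_seq]
  refine (wp_toggle 13 hs hM).mono ?_
  rintro t₁ s₁ ⟨ht₁, hk₁, hM₁⟩
  have hs₁ := hs.keeps hk₁
  rw [wp_seq]
  refine (wp_toggle 14 hs₁ hM₁).mono ?_
  rintro t₂ s₂ ⟨ht₂, hk₂, hM₂⟩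
  rw [hk₁.reg 14, h13, h14, symmDiff_assoc, ← TreeData.path, symmDiff_comm] at hM₂
  rw [h13] at ht₁
  rw [hk₁.reg 14, h14] at ht₂
  have hs₂ := hs₁.keeps hk₂
  have hk₂' : Keeps [] [13] s s₂ := hk₁.trans hk₂
  rw [wp_seq]
  refine (wp_emitPair (f := f) hs₂ hM₂ (hO.keeps hk₂') he het hfe hft ((hk₂'.reg 7).trans h7)
    ((hk₂'.reg 12).trans h12)).mono ?_
  rintro t₃ s₃ ⟨ht₃, hk₃, hO₃⟩
  have hs₃ := hs₂.keeps hk₃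
  have hk₃' : Keeps [2, 5] [5, 6, 13] s s₃ := hk₂'.trans hk₃
  rw [wp_seq]
  refine (wp_toggle 13 hs₃ (hM₂.keeps hk₃)).mono ?_
  rintro t₄ s₄ ⟨ht₄, hk₄, hM₄⟩
  have hs₄ := hs₃.keeps hk₄
  rw [hk₃'.reg 13, h13] at hM₄ ht₄
  have hk₄' : Keeps [2, 5] [5, 6, 13] s s₄ := hk₃'.trans hk₄
  rw [wp_seq]
  refine (wp_toggle 14 hs₄ hM₄).mono ?_
  rintro t₅ s₅ ⟨ht₅, hk₅, hM₅⟩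
  rw [hk₄'.reg 14, h14] at hM₅ ht₅
  rw [symmDiff_assoc, ← TreeData.path, symmDiff_comm, symmDiff_symmDiff_cancel_left] at hM₅
  have hk₅' : Keeps [2, 5] [5, 6, 13] s s₅ := hk₄'.trans hk₅
  have hO₅ := (hO₃.keeps hk₄).keeps hk₅
  refine wp_relabelLoop.mono ?_
  rintro t₆ s₆ ⟨ht₆, hk₆, hr⟩
  rw [hk₅'.reg 0, hs.reg0] at ht₆ hr
  refine ⟨by omega, hk₅'.trans hk₆, hM₅.keeps hk₆, hO₅.keeps hk₆, fun i hi => ?_⟩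
  rw [hr i hi, hk₅'.arr 20, hk₅'.reg 15, hk₅'.reg 16]

/-- The program controls the labels only at vertices below `n`, and nothing else enters `Merge`. -/
lemma TreeData.Merge.congr {D : TreeData} {e f : ℕ} {S S' : Finset (ℕ × ℕ)} {κ κ' : ℕ → ℕ}
    (h : Merge D e S f κ S') (hf : f ≤ D.m) (hκ : ∀ i, i < D.n → κ' i = κ i) :
    Merge D e S f κ' S' where
  subset := h.subset
  new := h.new
  tree i hi hin hir := by
    have := D.par_lt i hi
    rw [hκ i hin, hκ _ (by omega), h.tree i hi hin hir]
  merged f' hf' hft := by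
    rw [hκ _ (D.X_lt f' (by omega)), hκ _ (D.Y_lt f' (by omega)), h.merged f' hf' hft]
  conn u v hu hv huv := h.conn u v hu hv (by rwa [hκ u hu, hκ v hv] at huv)
  indep := h.indep

/-- `Ks` lists the indices of the members of the basis for the edges `< k` outside of the tree and
the pairs in `S`. -/
structure IsKeys (D : TreeData) (k : ℕ) (S : Finset (ℕ × ℕ)) (Ks : List (ℕ ⊕ ℕ × ℕ)) : Prop where
  nodup : Ks.Nodup
  inl : ∀ e, .inl e ∈ Ks ↔ e < k ∧ ¬ D.IsTree e
  inr : ∀ p, .inr p ∈ Ks ↔ p ∈ S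

lemma IsKeys.insert_inr {D : TreeData} {k : ℕ} {S : Finset (ℕ × ℕ)} {Ks : List (ℕ ⊕ ℕ × ℕ)}
    (h : IsKeys D k S Ks) {p : ℕ × ℕ} (hp : p ∉ S) :
    IsKeys D k (insert p S) (Ks ++ [.inr p]) where
  nodup := by
    refine List.Nodup.append h.nodup (List.nodup_singleton _) ?_
    intro x hx hx'
    rw [List.mem_singleton] at hx'
    subst hx'
    exact hp ((h.inr p).1 hx)
  inl e := by simp [h.inl]
  inr q := by simp [h.inr, or_comm]

lemma IsKeys.insert_inl {D : TreeData} {e : ℕ} {S : Finset (ℕ × ℕ)} {Ks : List (ℕ ⊕ ℕ × ℕ)}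
    (h : IsKeys D e S Ks) (he : ¬ D.IsTree e) : IsKeys D (e + 1) S (Ks ++ [.inl e]) where
  nodup := by
    refine List.Nodup.append h.nodup (List.nodup_singleton _) ?_
    intro x hx hx'
    rw [List.mem_singleton] at hx'
    subst hx'
    exact lt_irrefl _ ((h.inl e).1 hx).1
  inl f := by
    simp only [List.mem_append, h.inl, List.mem_singleton, Sum.inl.injEq]
    constructor
    · rintro (h' | rfl)
      · exact ⟨by omega, h'.2⟩
      · exact ⟨by omega, he⟩
    · rintro ⟨h1, h2⟩
      rcases Nat.lt_succ_iff_lt_or_eq.1 h1 with h' | rfl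
      · exact Or.inl ⟨h', h2⟩
      · exact Or.inr rfl
  inr p := by simp [h.inr]

lemma IsKeys.succ_of_isTree {D : TreeData} {e : ℕ} {S : Finset (ℕ × ℕ)} {Ks : List (ℕ ⊕ ℕ × ℕ)}
    (h : IsKeys D e S Ks) (he : D.IsTree e) : IsKeys D (e + 1) S Ks where
  nodup := h.nodup
  inl f := by
    rw [h.inl]
    constructor
    · rintro ⟨h1, h2⟩
      exact ⟨by omega, h2⟩
    · rintro ⟨h1, h2⟩
      refine ⟨lt_of_le_of_ne (by omega) ?_, h2⟩
      rintro rfl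
      exact h2 he
  inr := h.inr

/-- Choose the pairs for the edge in register `7`. -/
def pairLoop : Program :=
  .instr (.const 12 0) ;;
  .loop (.lt 12 7)
    (.instr (.load 21 10 12) ;;
    .ite (.eq 21 3)
      (.instr (.load 13 11 12) ;;
      .instr (.load 14 12 12) ;;
      .instr (.load 15 20 13) ;;
      .instr (.load 16 20 14) ;;
      .ite (.ne 15 16) mergeStep skip)
      skip ;;
    .instr (.incr 12))

/-- A scanned edge costs at most ten steps, and a merge at most `32 * n + 20` more. The latter is
charged to the growth of the set of pairs. -/
lemma wp_pairLoop {D : TreeData} {s : State} {e : ℕ} {S : Finset (ℕ × ℕ)}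
    {Ks : List (ℕ ⊕ ℕ × ℕ)} (hs : Base D s) (hM : Marks s (D.path e)) (hO : OutKeys D s Ks)
    (hK : IsKeys D (e + 1) S Ks) (hS : D.Good e S) (he : e < D.m)
    (het : ¬ D.IsTree e) (h7 : s.reg 7 = e)
    (hκ : ∀ i, i < D.n → s.arr 20 i =
      if i = 0 ∨ i ∈ D.reps e then i else s.arr 20 (D.par i)) :
    WP pairLoop s fun t s' => ∃ S' Ks' κ,
      t + (32 * D.n + 20) * S.card ≤ 10 * e + 2 + (32 * D.n + 20) * S'.card ∧
      Keeps [2, 5, 12, 13, 14, 15, 16] [5, 6, 13, 20] s s' ∧ Marks s' (D.path e) ∧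
      OutKeys D s' Ks' ∧ IsKeys D (e + 1) S' Ks' ∧ Merge D e S e κ S' := by
  rw [pairLoop, wp_seq, wp_instr, apply_const]
  refine wp_for (a := 0) (b := e) (fun f T s₁ => ∃ S' Ks',
      T + (32 * D.n + 20) * S.card ≤ 10 * f + (32 * D.n + 20) * S'.card ∧ s₁.reg 12 = f ∧
      Keeps [2, 5, 12, 13, 14, 15, 16] [5, 6, 13, 20] s s₁ ∧ Marks s₁ (D.path e) ∧
      OutKeys D s₁ Ks' ∧ IsKeys D (e + 1) S' Ks' ∧ Merge D e S f (s₁.arr 20) S')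
    (Nat.zero_le _) ?_ ?_ ?_ ?_
  · have hk : Keeps [12] [] s (s.setReg 12 0) := (Keeps.refl s).setReg (by decide)
    exact ⟨S, Ks, by omega, by simp, hk.trans (Keeps.refl (R := []) (A := []) _), hM.keeps hk,
      hO.keeps hk, hK, Merge.init hS _ hκ⟩
  · rintro f T s₁ ⟨S', Ks', h1, h2, h3, h4⟩
    exact ⟨h2, (h3.reg 7).trans h7⟩
  · rintro f T s₁ - hfe ⟨S', Ks', h1, h2, h3, h4, h5, h6, h8⟩
    have hs₁ := hs.keeps h3
    have e3 := hs₁.reg3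
    simp only [wp_seq, wp_instr, wp_ite, apply_load, apply_incr, holds_eq, holds_ne, reg_setReg,
      arr_setReg, wp_skip, if_true, if_false, Nat.reduceEqDiff, h2, e3, hs₁.X, hs₁.Y, hs₁.tree]
    refine ⟨fun hft => ⟨fun hne => ?_, fun heq => ?_⟩, fun hft => ?_⟩
    · set s₂ := ((((s₁.setReg 21 (s₁.arr 10 f)).setReg 13 (D.X f)).setReg 14 (D.Y f)).setReg 15
        (s₁.arr 20 (D.X f))).setReg 16 (s₁.arr 20 (D.Y f)) with hs₂
      have hk : Keeps [13, 14, 15, 16] [] s₁ s₂ :=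
        (((((Keeps.refl s₁).setReg (by decide)).setReg (by decide)).setReg (by decide)).setReg
          (by decide)).setReg (by decide)
      refine (wp_mergeStep (f := f) (hs₁.keeps hk) (h4.keeps hk) (h5.keeps hk) he het hfe hft
        ((hk.reg 7).trans ((h3.reg 7).trans h7)) ((hk.reg 12).trans h2) (by simp [hs₂])
        (by simp [hs₂])).mono ?_
      rintro t s₃ ⟨k1, k2, k3, k4, k5⟩
      have hnew : (f, e) ∉ S' := by
        intro h'
        rcases h8.new _ h' with h' | h'
        · exact lt_irrefl _ (hS.lt _ h').2
        · exact lt_irrefl _ h'.2.1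
      have e12 : s₃.reg 12 = f := (k2.reg 12).trans ((hk.reg 12).trans h2)
      have hk₃ : Keeps [12] [] s₃ (s₃.setReg 12 (f + 1)) := (Keeps.refl s₃).setReg (by decide)
      have hk₂ : Keeps [2, 5, 12, 13, 14, 15, 16] [5, 6, 13, 20] s₁ s₃ := hk.trans k2
      rw [e12]
      refine ⟨insert (f, e) S', Ks' ++ [.inr (f, e)], ?_, rfl,
        (h3.trans (R'' := [2, 5, 12, 13, 14, 15, 16]) (A'' := [5, 6, 13, 20]) hk₂).trans hk₃,
        k3.keeps hk₃, k4.keeps hk₃, h6.insert_inr hnew,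
        (h8.step hS he hfe hft hne).congr (by omega) ?_⟩
      · have hcard := Nat.mul_succ (32 * D.n + 20) S'.card
        rw [Nat.succ_eq_add_one] at hcard
        rw [Finset.card_insert_of_notMem hnew]
        omega
      · intro i hi
        rw [k5 i hi]
        simp [hs₂]
    · refine ⟨S', Ks', by omega, trivial, ?_, ?_⟩
      · repeat' first | exact h3 | refine Keeps.setReg ?_ (by decide)
      · set s₂ := ((((s₁.setReg 21 (s₁.arr 10 f)).setReg 13 (D.X f)).setReg 14 (D.Y f)).setReg 15
          (s₁.arr 20 (D.X f))).setReg 16 (s₁.arr 20 (D.Y f)) with hs₂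
        have hk : Keeps [12, 13, 14, 15, 16] [] s₁ (s₂.setReg 12 (f + 1)) :=
          ((((((Keeps.refl s₁).setReg (by decide)).setReg (by decide)).setReg (by decide)).setReg
            (by decide)).setReg (by decide)).setReg (by decide)
        exact ⟨h4.keeps hk, h5.keeps hk, h6, h8.skip fun _ => not_not.1 heq⟩
    · have hk : Keeps [12] [] s₁ ((s₁.setReg 21 (s₁.arr 10 f)).setReg 12 (f + 1)) :=
        ((Keeps.refl s₁).setReg (by decide)).setReg (by decide)
      exact ⟨S', Ks', by omega, trivial,
        h3.trans (R'' := [2, 5, 12, 13, 14, 15, 16]) (A'' := [5, 6, 13, 20]) hk,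
        h4.keeps hk, h5.keeps hk, h6, h8.skip fun h' => absurd h' hft⟩
  · rintro T s₁ ⟨S', Ks', h1, h2, h3, h4, h5, h6, h8⟩
    exact ⟨S', Ks', _, by omega, h3, h4, h5, h6, h8⟩

open TreeData

/-! ### The main loop -/

/-- Treat the edge in register `7`, which is not in the tree. -/
def processEdge : Program :=
  .instr (.load 8 11 7) ;;
  .instr (.load 9 12 7) ;;
  toggle 8 ;; toggle 9 ;; emitFundamental ;;
  .instr (.copy 10 7) ;;
  .instr (.incr 10) ;;
  stampLoop ;; refineLoop ;;
  .ite (.eq 11 4) (compLoop ;; pairLoop) skip ;;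
  toggle 8 ;; toggle 9

/-- The state before the edge `e` is treated: the pairs in `S` have been chosen, and the members of
the basis with indices `Ks` have been written. -/
structure Main (D : TreeData) (e : ℕ) (S : Finset (ℕ × ℕ)) (Ks : List (ℕ ⊕ ℕ × ℕ)) (s : State) :
    Prop where
  base : Base D s
  reg7 : s.reg 7 = e
  marks : Marks s ∅
  good : D.Good e S
  out : OutKeys D s Ks
  keys : IsKeys D e S Ks
  classes : IsClasses D e (s.arr 14) (s.arr 15) (s.reg 6)
  stamp : ∀ a, s.arr 16 a ≤ e
  seen : ∀ a, s.arr 17 a ≤ e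

/-- The number of pairs serves as a potential: the refinement is paid for by the edge, whereas the
scan of all earlier edges happens only if there is a representative, and then at least one new pair
pays for it. -/
lemma wp_processEdge {D : TreeData} {s : State} {e : ℕ} {S : Finset (ℕ × ℕ)}
    {Ks : List (ℕ ⊕ ℕ × ℕ)} (h : Main D e S Ks s) (he : e < D.m) (het : ¬ D.IsTree e) :
    WP processEdge s fun t s' => ∃ S' Ks',
      t + (40 * D.n + 10 * D.m + 24) * S.card ≤
        58 * D.n + 25 + (40 * D.n + 10 * D.m + 24) * S'.card ∧
      s'.reg 7 = e ∧ Main D (e + 1) S' Ks' (s'.setReg 7 (e + 1)) := by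
  have hX := D.X_lt e he
  have hY := D.Y_lt e he
  rw [processEdge, wp_seq, wp_instr, wp_seq, wp_instr, apply_load, apply_load]
  simp only [reg_setReg, arr_setReg, Nat.reduceEqDiff, if_false, h.reg7, h.base.X, h.base.Y]
  set s₀ := (s.setReg 8 (D.X e)).setReg 9 (D.Y e) with hs₀
  have hk₀ : Keeps [8, 9] [] s s₀ := ((Keeps.refl s).setReg (by decide)).setReg (by decide)
  have b₀ := h.base.keeps hk₀
  have r8 : s₀.reg 8 = D.X e := by simp [hs₀]
  have r9 : s₀.reg 9 = D.Y e := by simp [hs₀]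
  rw [wp_seq]
  refine (wp_toggle 8 b₀ (h.marks.keeps hk₀)).mono ?_
  rintro t₁ s₁ ⟨ht₁, hk₁, hM₁⟩
  have b₁ := b₀.keeps hk₁
  rw [wp_seq]
  refine (wp_toggle 9 b₁ hM₁).mono ?_
  rintro t₂ s₂ ⟨ht₂, hk₂, hM₂⟩
  have b₂ := b₁.keeps hk₂
  rw [hk₁.reg 9, r8, r9, symmDiff_assoc, ← TreeData.path,
    show symmDiff ∅ (D.path e) = D.path e from bot_symmDiff _] at hM₂
  rw [r8] at ht₁
  rw [hk₁.reg 9, r9] at ht₂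
  have hk₂' : Keeps [8, 9] [13] s s₂ :=
    hk₀.trans (hk₁.trans (R'' := []) (A'' := [13]) hk₂)
  rw [wp_seq]
  refine (wp_emitFundamental b₂ hM₂ (h.out.keeps hk₂') he het ((hk₂'.reg 7).trans h.reg7)).mono ?_
  rintro t₃ s₃ ⟨ht₃, hk₃, hO₃⟩
  have b₃ := b₂.keeps hk₃
  have hk₃' : Keeps [2, 5, 8, 9] [5, 6, 13] s s₃ := hk₂'.trans hk₃
  simp only [wp_seq, wp_instr, apply_copy, apply_incr, reg_setReg, if_true]
  rw [(hk₃'.reg 7).trans h.reg7]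
  set s₄ := (s₃.setReg 10 e).setReg 10 (e + 1) with hs₄
  have hk₄ : Keeps [10] [] s₃ s₄ := ((Keeps.refl s₃).setReg (by decide)).setReg (by decide)
  have b₄ := b₃.keeps hk₄
  have hk₄' : Keeps [2, 5, 8, 9, 10] [5, 6, 13] s s₄ := hk₃'.trans hk₄
  have r10 : s₄.reg 10 = e + 1 := by simp [hs₄]
  have hM₄ := (hM₂.keeps hk₃).keeps hk₄
  refine (wp_stampLoop b₄ hM₄ r10 (by rw [hk₄'.arr 16]; exact h.stamp)).mono ?_
  rintro t₅ s₅ ⟨ht₅, hk₅, ho₅, ho₅'⟩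
  have b₅ := b₄.keeps hk₅
  have hk₅' : Keeps [2, 5, 8, 9, 10] [5, 6, 13, 16] s s₅ := hk₄'.trans hk₅
  have hc : IsClasses D e (s₅.arr 14) (s₅.arr 15) (s₅.reg 6) := by
    rw [hk₅'.arr 14, hk₅'.arr 15, hk₅'.reg 6]; exact h.classes
  have hM₅ := hM₄.keeps hk₅
  refine (wp_refineLoop b₅ hM₅ ((hk₅.reg 10).trans r10) he hc
    (by rw [hk₅'.arr 17]; exact h.seen) (by rw [hk₅.arr 14]; exact ho₅')).mono ?_
  rintro t₆ s₆ ⟨ht₆, hk₆, hR⟩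
  have b₆ := b₅.keeps hk₆
  have hk₆' : Keeps [2, 5, 6, 8, 9, 10, 11] [5, 6, 13, 14, 15, 16, 17, 18, 19] s s₆ :=
    hk₅'.trans hk₆
  have hM₆ := hM₅.keeps hk₆
  have hO₆ := ((hO₃.keeps hk₄).keeps hk₅).keeps hk₆
  have hK := h.keys.insert_inl het
  have r8' : s₆.reg 8 = D.X e :=
    (hk₆.reg 8).trans ((hk₅.reg 8).trans ((hk₄.reg 8).trans ((hk₃.reg 8).trans
      ((hk₂.reg 8).trans ((hk₁.reg 8).trans r8)))))
  have r9' : s₆.reg 9 = D.Y e :=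
    (hk₆.reg 9).trans ((hk₅.reg 9).trans ((hk₄.reg 9).trans ((hk₃.reg 9).trans
      ((hk₂.reg 9).trans ((hk₁.reg 9).trans r9)))))
  have hfl : s₆.reg 11 = 1 ↔ (D.reps e).Nonempty := by
    rw [hR.fl_iff]
    constructor
    · rintro ⟨i, -, -, hi⟩
      exact ⟨i, hi⟩
    · rintro ⟨i, hi⟩
      have := D.path_bounds he (reps_subset hi)
      exact ⟨i, this.1, this.2, hi⟩
  have finish : ∀ (S' : Finset (ℕ × ℕ)) (Ks' : List (ℕ ⊕ ℕ × ℕ)) (s₇ : State),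
      Keeps [2, 5, 12, 13, 14, 15, 16] [5, 6, 13, 20] s₆ s₇ → Marks s₇ (D.path e) →
      OutKeys D s₇ Ks' → IsKeys D (e + 1) S' Ks' → D.Good (e + 1) S' →
      WP (toggle 8) s₇ fun t s₈ => WP (toggle 9) s₈ fun t' s₉ =>
        t + t' ≤ 10 * D.n + 4 ∧ s₉.reg 7 = e ∧ Main D (e + 1) S' Ks' (s₉.setReg 7 (e + 1)) := by
    intro S' Ks' s₇ hk₇ hM₇ hO₇ hK₇ hG₇
    have b₇ := b₆.keeps hk₇
    refine (wp_toggle 8 b₇ hM₇).mono ?_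
    rintro t₈ s₈ ⟨ht₈, hk₈, hM₈⟩
    have b₈ := b₇.keeps hk₈
    refine (wp_toggle 9 b₈ hM₈).mono ?_
    rintro t₉ s₉ ⟨ht₉, hk₉, hM₉⟩
    rw [hk₇.reg 8, r8'] at ht₈ hM₉
    rw [hk₈.reg 9, hk₇.reg 9, r9'] at ht₉ hM₉
    rw [symmDiff_assoc, ← TreeData.path, symmDiff_self] at hM₉
    have hk₁₀ : Keeps [7] [] s₉ (s₉.setReg 7 (e + 1)) := (Keeps.refl s₉).setReg (by decide)
    have hk : Keeps [7] [13] s₇ (s₉.setReg 7 (e + 1)) :=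
      (hk₈.trans (R'' := []) (A'' := [13]) hk₉).trans hk₁₀
    refine ⟨by omega, (hk₉.reg 7).trans ((hk₈.reg 7).trans ((hk₇.reg 7).trans
      ((hk₆'.reg 7).trans h.reg7))), b₇.keeps hk, by simp, hM₉.keeps hk₁₀, hG₇, hO₇.keeps hk, hK₇, ?_, ?_, ?_⟩
    · rw [hk.arr 14, hk.arr 15, hk.reg 6, hk₇.arr 14, hk₇.arr 15, hk₇.reg 6]
      exact hR.isClasses hc het
    · rw [hk.arr 16, hk₇.arr 16, hk₆.arr 16]
      exact ho₅
    · rw [hk.arr 17, hk₇.arr 17]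
      exact hR.sn_le
  rw [wp_ite, holds_eq, b₆.reg4, hfl]
  refine ⟨fun hne => ?_, fun hne => ?_⟩
  · rw [wp_seq]
    refine (wp_compLoop b₆ hR.rp_lt).mono ?_
    rintro t₇ s₇ ⟨ht₇, hk₇, hκ⟩
    have hk₇' : Keeps [2, 5, 6, 8, 9, 10, 11] [5, 6, 13, 14, 15, 16, 17, 18, 19, 20] s s₇ :=
      hk₆'.trans hk₇
    refine (wp_pairLoop (b₆.keeps hk₇) (hM₆.keeps hk₇) (hO₆.keeps hk₇) hK h.good he het
      ((hk₇'.reg 7).trans h.reg7) hκ).mono ?_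
    rintro t₈ s₈ ⟨S', Ks', κ, ht₈, hk₈, hM₈, hO₈, hK₈, hmerge⟩
    have hcard := hmerge.exists_new h.good he hne
    refine (finish S' Ks' s₈ (hk₇.trans hk₈) hM₈ hO₈ hK₈ (hmerge.good h.good he het)).mono ?_
    intro t₉ s₉ hw
    refine hw.mono ?_
    rintro t₁₀ s₁₀ ⟨ht₁₀, hmain⟩
    refine ⟨S', Ks', ?_, hmain⟩
    -- The weight `40 * n + 10 * m + 24` of one new pair covers the labelling (`8 * n + 2`), the
    -- scan (`10 * e + 2`) and its merge (`32 * n + 20`).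
    obtain ⟨k, hk⟩ := Nat.exists_eq_add_of_lt hcard
    rw [hk] at ht₈ ⊢
    have h1 : t₈ + (8 * D.n + 2) + (40 * D.n + 10 * D.m + 24) * S.card ≤
        (40 * D.n + 10 * D.m + 24) * (S.card + k + 1) := by
      linarith [Nat.zero_le (D.n * k), Nat.zero_le (D.m * k), Nat.zero_le k]
    omega
  · rw [wp_skip]
    refine (finish S _ s₆ (Keeps.refl _) hM₆ hO₆ hK
      (h.good.succ_of_reps_eq_empty he het (Finset.not_nonempty_iff_eq_empty.1 hne))).mono ?_
    intro t₉ s₉ hw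
    refine hw.mono ?_
    rintro t₁₀ s₁₀ ⟨ht₁₀, hmain⟩
    exact ⟨S, _, by omega, hmain⟩

lemma Main.keeps {D : TreeData} {e : ℕ} {S : Finset (ℕ × ℕ)} {Ks : List (ℕ ⊕ ℕ × ℕ)}
    {s s' : State} (h : Main D e S Ks s) (hk : Keeps [] [] s s') : Main D e S Ks s' where
  base := h.base.keeps hk
  reg7 := (hk.reg 7).trans h.reg7
  marks := h.marks.keeps hk
  good := h.good
  out := h.out.keeps hk
  keys := h.keys
  classes := by rw [hk.arr 14, hk.arr 15, hk.reg 6]; exact h.classes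
  stamp := by rw [hk.arr 16]; exact h.stamp
  seen := by rw [hk.arr 17]; exact h.seen

/-- Treat all edges outside of the tree. -/
def mainLoop : Program :=
  .instr (.const 7 0) ;;
  .loop (.lt 7 1)
    (.instr (.load 21 10 7) ;;
    .ite (.eq 21 3) processEdge skip ;;
    .instr (.incr 7))

/-- By `Good.card_le` the potential never exceeds `n` times the weight of a pair. -/
lemma wp_mainLoop {D : TreeData} {s : State} (h : Main D 0 ∅ [] (s.setReg 7 0)) :
    WP mainLoop s fun t s' => ∃ S Ks, t ≤ (58 * D.n + 30) * D.m +
      (40 * D.n + 10 * D.m + 24) * D.n + 2 ∧ Main D D.m S Ks s' := by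
  rw [mainLoop, wp_seq, wp_instr, apply_const]
  refine wp_for (a := 0) (b := D.m) (fun e T s₁ => ∃ S Ks,
      T ≤ (58 * D.n + 30) * e + (40 * D.n + 10 * D.m + 24) * S.card ∧ Main D e S Ks s₁)
    (Nat.zero_le _) ⟨∅, [], by simp, h⟩ ?_ ?_ ?_
  · rintro e T s₁ ⟨S, Ks, -, h1⟩
    exact ⟨h1.reg7, h1.base.reg1⟩
  · rintro e T s₁ - he ⟨S, Ks, hT, h1⟩
    have hmul := Nat.mul_succ (58 * D.n + 30) e
    rw [Nat.succ_eq_add_one] at hmul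
    simp only [wp_seq, wp_instr, wp_ite, apply_load, apply_incr, holds_eq, reg_setReg, wp_skip,
      if_true, if_false, Nat.reduceEqDiff, h1.reg7, h1.base.reg3, h1.base.tree]
    have hk : Keeps [] [] s₁ (s₁.setReg 21 (s₁.arr 10 e)) :=
      (Keeps.refl s₁).setReg (by decide)
    refine ⟨fun het => ?_, fun het => ?_⟩
    · refine (wp_processEdge (h1.keeps hk) he het).mono ?_
      rintro t s₂ ⟨S', Ks', ht, h7, h2⟩
      rw [h7]
      exact ⟨S', Ks', by omega, h2⟩
    · rw [not_not] at het
      have hk' : Keeps [7] [] s₁ ((s₁.setReg 21 (s₁.arr 10 e)).setReg 7 (e + 1)) :=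
        ((Keeps.refl s₁).setReg (by decide)).setReg (by decide)
      refine ⟨S, Ks, by omega, h1.base.keeps hk', by simp, h1.marks.keeps hk',
        h1.good.succ_of_isTree het, h1.out.keeps hk', h1.keys.succ_of_isTree het, ?_, ?_, ?_⟩
      · rw [hk'.arr 14, hk'.arr 15, hk'.reg 6]
        exact h1.classes.succ_of_isTree het
      · exact fun a => (h1.stamp a).trans (Nat.le_succ e)
      · exact fun a => (h1.seen a).trans (Nat.le_succ e)
  · rintro T s₁ ⟨S, Ks, hT, h1⟩
    refine ⟨S, Ks, ?_, h1⟩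
    have := Nat.mul_le_mul_left (40 * D.n + 10 * D.m + 24) (h1.good.card_le le_rfl)
    omega

/-! ### Growing a tree -/

/-- A tree with edges in `A` has been grown from the vertex `0`, for a multigraph with edges
`0, …, m - 1`, ends `U e` and `W e` of the edge `e`, and vertices `0, …, n - 1`. It has `cnt`
vertices so far, in the order `vt 0, vt 1, …`. The number `vis v` is `0` if the tree does not contain
`v`, and it is `i + 1` if `v = vt i`; the numbers `it e` mark the edges of the tree. -/
structure Grown (n m : ℕ) (U W : ℕ → ℕ) (A : Set ℕ) (cnt : ℕ) (vt vis par pe it : ℕ → ℕ) :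
    Prop where
  pos : 0 < cnt
  vis_vt : ∀ i < cnt, vis (vt i) = i + 1
  vt_lt : ∀ i < cnt, vt i < n
  exists_vt : ∀ v, vis v ≠ 0 → ∃ i < cnt, vt i = v
  par_lt : ∀ i, 0 < i → par i < i
  pe_lt : ∀ i, 0 < i → i < cnt → pe i < m
  pe_mem : ∀ i, 0 < i → i < cnt → pe i ∈ A
  ends : ∀ i, 0 < i → i < cnt → U (pe i) = vt i ∧ W (pe i) = vt (par i) ∨
    U (pe i) = vt (par i) ∧ W (pe i) = vt i
  it_iff : ∀ e, it e = 0 ↔ ¬ ∃ i, 0 < i ∧ i < cnt ∧ pe i = e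

namespace Grown

variable {n m cnt : ℕ} {U W vt vis par pe it : ℕ → ℕ} {A : Set ℕ}

lemma vis_lt (h : Grown n m U W A cnt vt vis par pe it) {v : ℕ} (hv : vis v ≠ 0) :
    vis v - 1 < cnt ∧ vt (vis v - 1) = v := by
  obtain ⟨i, hi, rfl⟩ := h.exists_vt v hv
  rw [h.vis_vt i hi]
  exact ⟨hi, rfl⟩

lemma vt_inj (h : Grown n m U W A cnt vt vis par pe it) {i j : ℕ} (hi : i < cnt) (hj : j < cnt)
    (hij : vt i = vt j) : i = j := by
  have h1 := h.vis_vt i hi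
  rw [hij, h.vis_vt j hj] at h1
  omega

lemma le_card (h : Grown n m U W A cnt vt vis par pe it) : cnt ≤ n := by
  have := Finset.card_le_card_of_injOn (s := Finset.range cnt) (t := Finset.range n) vt
    (fun i hi => Finset.mem_coe.2 (Finset.mem_range.2 (h.vt_lt i (by simpa using hi))))
    (fun i hi j hj hij => h.vt_inj (by simpa using hi) (by simpa using hj) hij)
  simpa using this

lemma init (hn : 0 < n) : Grown n m U W A 1 0 (Function.update 0 0 1) 0 0 0 where
  pos := Nat.one_pos
  vis_vt i hi := by
    obtain rfl : i = 0 := by omega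
    simp
  vt_lt i hi := hn
  exists_vt v hv := by
    refine ⟨0, Nat.one_pos, ?_⟩
    by_contra h
    exact hv (Function.update_of_ne (fun h' => h h'.symm) _ _)
  par_lt i hi := hi
  pe_lt i h1 h2 := by omega
  pe_mem i h1 h2 := by omega
  ends i h1 h2 := by omega
  it_iff e := by
    refine iff_of_true rfl ?_
    rintro ⟨i, h1, h2, -⟩
    omega

lemma add (h : Grown n m U W A cnt vt vis par pe it) {e x y : ℕ} (he : e < m) (heA : e ∈ A)
    (hx : x < n) (hxy : U e = x ∧ W e = y ∨ U e = y ∧ W e = x) (hvx : vis x = 0)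
    (hvy : vis y ≠ 0) :
    Grown n m U W A (cnt + 1) (Function.update vt cnt x) (Function.update vis x (cnt + 1))
      (Function.update par cnt (vis y - 1)) (Function.update pe cnt e)
      (Function.update it e 1) := by
  have hy := h.vis_lt hvy
  have hne : ∀ i < cnt, vt i ≠ x := by
    rintro i hi rfl
    rw [h.vis_vt i hi] at hvx
    omega
  exact
  { pos := Nat.succ_pos _
    vis_vt := fun i hi => by
      rcases Nat.lt_succ_iff_lt_or_eq.1 hi with hi | rfl
      · rw [Function.update_of_ne (a := i) (by omega), Function.update_of_ne (hne i hi),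
          h.vis_vt i hi]
      · simp
    vt_lt := fun i hi => by
      rcases Nat.lt_succ_iff_lt_or_eq.1 hi with hi | rfl
      · rw [Function.update_of_ne (by omega)]; exact h.vt_lt i hi
      · simpa
    exists_vt := fun v hv => by
      by_cases hvx' : v = x
      · exact ⟨cnt, Nat.lt_succ_self _, by simp [hvx']⟩
      · rw [Function.update_of_ne hvx'] at hv
        obtain ⟨i, hi, rfl⟩ := h.exists_vt v hv
        exact ⟨i, by omega, Function.update_of_ne (by omega) _ _⟩
    par_lt := fun i hi => by
      by_cases hic : i = cnt
      · rw [hic, Function.update_self]; exact hy.1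
      · rw [Function.update_of_ne hic]; exact h.par_lt i hi
    pe_lt := fun i hi hin => by
      by_cases hic : i = cnt
      · rw [hic, Function.update_self]; exact he
      · rw [Function.update_of_ne hic]; exact h.pe_lt i hi (by omega)
    pe_mem := fun i hi hin => by
      by_cases hic : i = cnt
      · rw [hic, Function.update_self]; exact heA
      · rw [Function.update_of_ne hic]; exact h.pe_mem i hi (by omega)
    ends := fun i hi hin => by
      by_cases hic : i = cnt
      · subst hic
        simp only [Function.update_self]
        rw [Function.update_of_ne (by omega), hy.2]
        exact hxy
      · have := h.par_lt i hi
        rw [Function.update_of_ne hic, Function.update_of_ne hic, Function.update_of_ne hic,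
          Function.update_of_ne (by omega)]
        exact h.ends i hi (by omega)
    it_iff := fun f => by
      by_cases hf : f = e
      · rw [hf, Function.update_self]
        refine iff_of_false one_ne_zero fun h' => h' ⟨cnt, h.pos, Nat.lt_succ_self _, ?_⟩
        rw [Function.update_self]
      · rw [Function.update_of_ne hf, h.it_iff]
        refine not_congr ⟨?_, ?_⟩
        · rintro ⟨i, h1, h2, h3⟩
          exact ⟨i, h1, by omega, by rwa [Function.update_of_ne (by omega)]⟩
        · rintro ⟨i, h1, h2, h3⟩
          by_cases hic : i = cnt
          · rw [hic, Function.update_self] at h3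
            exact absurd h3.symm hf
          · exact ⟨i, h1, by omega, by rwa [Function.update_of_ne hic] at h3⟩ }

end Grown

/-- Add the vertex in register `x` to the tree, as a child of the vertex whose position is one less
than register `p`. -/
def addVertex (x p : ℕ) : Program :=
  .instr (.decr p) ;;
  .instr (.store 8 17 p) ;;
  .instr (.store 9 17 7) ;;
  .instr (.store 10 7 4) ;;
  .instr (.incr 17) ;;
  .instr (.store 7 x 17)

/-- Add to the tree the edge in register `7`, if it has exactly one end in it. -/
def tryEdge : Program :=
  .instr (.load 21 0 7) ;;
  .instr (.load 22 1 7) ;;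
  .instr (.load 23 7 21) ;;
  .instr (.load 24 7 22) ;;
  .ite (.eq 23 3)
    (.ite (.eq 24 3) skip (addVertex 21 24))
    (.ite (.eq 24 3) (addVertex 22 23) skip)

/-- The state version of `Grown`. -/
def GrownState (n m : ℕ) (U W : ℕ → ℕ) (A : Set ℕ) (vt : ℕ → ℕ) (s : State) : Prop :=
  Grown n m U W A (s.reg 17) vt (s.arr 7) (s.arr 8) (s.arr 9) (s.arr 10)

/-- The state `s` holds a multigraph with a set `A` of edges in the input arrays, and the constants
`0` and `1` in registers `3` and `4`. -/
structure Holds (n m : ℕ) (U W : ℕ → ℕ) (A : Set ℕ) (s : State) : Prop where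
  reg0 : s.reg 0 = n
  reg1 : s.reg 1 = m
  reg3 : s.reg 3 = 0
  reg4 : s.reg 4 = 1
  U_eq : s.arr 0 = U
  W_eq : s.arr 1 = W
  mark : ∀ e < m, s.arr 4 e = 0 ↔ e ∉ A
  U_lt : ∀ e < m, U e < n
  W_lt : ∀ e < m, W e < n

lemma Holds.keeps {n m : ℕ} {U W : ℕ → ℕ} {A : Set ℕ} {s s' : State} {R A' : List ℕ}
    (h : Holds n m U W A s) (hk : Keeps R A' s s')
    (hR : 0 ∉ R ∧ 1 ∉ R ∧ 3 ∉ R ∧ 4 ∉ R := by simp)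
    (hA : 0 ∉ A' ∧ 1 ∉ A' ∧ 4 ∉ A' := by simp) : Holds n m U W A s' where
  reg0 := (hk.reg 0 (by norm_num) hR.1).trans h.reg0
  reg1 := (hk.reg 1 (by norm_num) hR.2.1).trans h.reg1
  reg3 := (hk.reg 3 (by norm_num) hR.2.2.1).trans h.reg3
  reg4 := (hk.reg 4 (by norm_num) hR.2.2.2).trans h.reg4
  U_eq := (hk.arr 0 hA.1).trans h.U_eq
  W_eq := (hk.arr 1 hA.2.1).trans h.W_eq
  mark := by rw [hk.arr 4 hA.2.2]; exact h.mark
  U_lt := h.U_lt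
  W_lt := h.W_lt

section

variable {n m : ℕ} {U W : ℕ → ℕ} {A : Set ℕ} {s : State}

lemma wp_tryEdge {e : ℕ} {vt : ℕ → ℕ} (hs : Holds n m U W A s)
    (hG : GrownState n m U W A vt s) (he : e < m) (heA : e ∈ A) (h7 : s.reg 7 = e) :
    WP tryEdge s fun t s' => t ≤ 12 ∧ Keeps [17] [7, 8, 9, 10] s s' ∧
      ∃ vt', GrownState n m U W A vt' s' ∧ (s.reg 17 < s'.reg 17 ∨
        s'.reg 17 = s.reg 17 ∧ s'.arr 7 = s.arr 7 ∧ (s.arr 7 (U e) = 0 ↔ s.arr 7 (W e) = 0)) := by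
  simp only [tryEdge, addVertex, wp_seq, wp_instr, wp_ite, apply_load, apply_store, apply_incr,
    apply_decr, holds_eq, reg_setReg, arr_setReg, reg_setArr, arr_setArr, wp_skip, if_true,
    if_false, Nat.reduceEqDiff, h7, hs.reg3, hs.reg4, hs.U_eq, hs.W_eq]
  refine ⟨fun h1 => ⟨fun h2 => ?_, fun h2 => ?_⟩, fun h1 => ⟨fun h2 => ?_, fun h2 => ?_⟩⟩
  · refine ⟨by omega, ?_, vt, by simpa [GrownState] using hG, Or.inr ⟨trivial, trivial, by
      simp [h1, h2]⟩⟩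
    repeat' first | exact Keeps.refl s | refine Keeps.setReg ?_ (by decide)
  · refine ⟨by omega, ?_, Function.update vt (s.reg 17) (U e), ?_,
      Or.inl (Nat.lt_succ_self _)⟩
    · repeat' first | exact Keeps.refl s | refine Keeps.setReg ?_ (by decide) |
        refine Keeps.setArr ?_ (by decide)
    · have := hG.add he heA (hs.U_lt e he) (Or.inl ⟨rfl, rfl⟩) h1 h2
      simpa [GrownState] using this
  · refine ⟨by omega, ?_, Function.update vt (s.reg 17) (W e), ?_,
      Or.inl (Nat.lt_succ_self _)⟩
    · repeat' first | exact Keeps.refl s | refine Keeps.setReg ?_ (by decide) |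
        refine Keeps.setArr ?_ (by decide)
    · have := hG.add he heA (hs.W_lt e he) (Or.inr ⟨rfl, rfl⟩) h2 h1
      simpa [GrownState] using this
  · refine ⟨by omega, ?_, vt, by simpa [GrownState] using hG, Or.inr ⟨trivial, trivial, by
      simp [h1, h2]⟩⟩
    repeat' first | exact Keeps.refl s | refine Keeps.setReg ?_ (by decide)

/-- Try all edges with a mark. -/
def growRound : Program :=
  .instr (.const 7 0) ;;
  .loop (.lt 7 1)
    (.instr (.load 20 4 7) ;;
    .ite (.ne 20 3) tryEdge skip ;;
    .instr (.incr 7))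

/-- A round without growth certifies that no edge of `A` leaves the tree. -/
lemma wp_growRound {vt : ℕ → ℕ} (hs : Holds n m U W A s) (hG : GrownState n m U W A vt s) :
    WP growRound s fun t s' => t ≤ 16 * m + 2 ∧ Keeps [7, 17] [7, 8, 9, 10] s s' ∧
      ∃ vt', GrownState n m U W A vt' s' ∧ (s.reg 17 < s'.reg 17 ∨
        s'.reg 17 = s.reg 17 ∧ ∀ e < m, e ∈ A → (s'.arr 7 (U e) = 0 ↔ s'.arr 7 (W e) = 0)) := by
  rw [growRound, wp_seq, wp_instr, apply_const]
  refine wp_for (a := 0) (b := m) (fun k T s₁ => T ≤ 16 * k ∧ s₁.reg 7 = k ∧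
    Keeps [7, 17] [7, 8, 9, 10] s s₁ ∧ ∃ vt', GrownState n m U W A vt' s₁ ∧
      (s.reg 17 < s₁.reg 17 ∨ s₁.reg 17 = s.reg 17 ∧
        ∀ e < k, e ∈ A → (s₁.arr 7 (U e) = 0 ↔ s₁.arr 7 (W e) = 0)))
    (Nat.zero_le _) ?_ ?_ ?_ ?_
  · exact ⟨by omega, by simp, (Keeps.refl s).setReg (by decide), vt,
      by simpa [GrownState] using hG, Or.inr ⟨by simp, fun e he => by omega⟩⟩
  · rintro k T s₁ ⟨h1, h2, h3, h4⟩
    exact ⟨h2, (h3.reg 1).trans hs.reg1⟩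
  · rintro k T s₁ - hkm ⟨h1, h2, h3, vt', h4, h5⟩
    have hs₁ := hs.keeps h3
    simp only [wp_seq, wp_instr, wp_ite, apply_load, apply_incr, holds_ne, reg_setReg, arr_setReg,
      wp_skip, if_true, if_false, Nat.reduceEqDiff, h2, hs₁.reg3, hs₁.mark k hkm, ne_eq, not_not]
    set s₂ := s₁.setReg 20 (s₁.arr 4 k) with hs₂
    have hk : Keeps [] [] s₁ s₂ := (Keeps.refl s₁).setReg (by decide)
    refine ⟨fun hkA => ?_, fun hkA => ?_⟩
    · refine (wp_tryEdge (hs₁.keeps hk) (vt := vt') (by simpa [GrownState, hs₂] using h4) hkm hkA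
        ((hk.reg 7).trans h2)).mono ?_
      rintro t s₃ ⟨k1, k2, vt'', k3, k4⟩
      have hk₃ : Keeps [17] [7, 8, 9, 10] s₁ s₃ := hk.trans k2
      rw [(hk₃.reg 7).trans h2]
      refine ⟨by omega, rfl, ((h3.trans (R'' := [7, 17]) (A'' := [7, 8, 9, 10]) hk₃)).setReg
        (by decide), vt'', by simpa [GrownState] using k3, ?_⟩
      rw [hk.reg 17, hk.arr 7] at k4
      rcases k4 with k4 | ⟨k4, k5, k6⟩
      · left; omega
      · refine h5.imp (fun h => by omega) fun h => ⟨k4.trans h.1, fun e he heA => ?_⟩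
        rw [k5]
        rcases Nat.lt_succ_iff_lt_or_eq.1 he with he | rfl
        · exact h.2 e he heA
        · exact k6
    · refine ⟨by omega, trivial, (h3.setReg (by decide)).setReg (by decide), vt',
        by simpa [GrownState, hs₂] using h4, ?_⟩
      refine h5.imp (fun h => h) fun h => ⟨h.1, fun e he heA => ?_⟩
      rcases Nat.lt_succ_iff_lt_or_eq.1 he with he | rfl
      · exact h.2 e he heA
      · exact absurd heA hkA
  · rintro T s₁ ⟨h1, h2, h3, h4⟩
    exact ⟨by omega, h3, h4⟩

/-- Grow a spanning tree. -/
def growTree : Program :=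
  .instr (.const 18 0) ;;
  .loop (.lt 18 0) (growRound ;; .instr (.incr 18))

/-- After `k` rounds the tree has more than `k` vertices or is spanning: a round without growth
leaves a set of vertices closed under the edges of `A`, which by connectedness contains every
vertex. Scanning all edges in each of `n` rounds is affordable within O(mn). -/
lemma wp_growTree {vt : ℕ → ℕ} (hs : Holds n m U W A s) (hG : GrownState n m U W A vt s)
    (hconn : ∀ p : ℕ → Prop, (∃ v < n, p v) → (∀ e < m, e ∈ A → (p (U e) ↔ p (W e))) →
      ∀ v < n, p v) :
    WP growTree s fun t s' => t ≤ (16 * m + 4) * n + 2 ∧ Keeps [7, 17, 18] [7, 8, 9, 10] s s' ∧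
      s'.reg 17 = n ∧ ∃ vt', GrownState n m U W A vt' s' := by
  rw [growTree, wp_seq, wp_instr, apply_const]
  refine wp_for (a := 0) (b := n) (fun k T s₁ => T ≤ (16 * m + 4) * k ∧ s₁.reg 18 = k ∧
    Keeps [7, 17, 18] [7, 8, 9, 10] s s₁ ∧ (k < s₁.reg 17 ∨ s₁.reg 17 = n) ∧
      ∃ vt', GrownState n m U W A vt' s₁) (Nat.zero_le _) ?_ ?_ ?_ ?_
  · exact ⟨by omega, by simp, (Keeps.refl s).setReg (by decide), Or.inl hG.pos, vt,
      by simpa [GrownState] using hG⟩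
  · rintro k T s₁ ⟨h1, h2, h3, h4⟩
    exact ⟨h2, (h3.reg 0).trans hs.reg0⟩
  · rintro k T s₁ - hkn ⟨h1, h2, h3, h4, vt', h5⟩
    have hmul := Nat.mul_succ (16 * m + 4) k
    rw [Nat.succ_eq_add_one] at hmul
    rw [wp_seq]
    refine (wp_growRound (hs.keeps h3) h5).mono ?_
    rintro t s₂ ⟨k1, k2, vt'', k3, k4⟩
    rw [wp_instr, apply_incr, (k2.reg 18).trans h2]
    refine ⟨by omega, by simp, (h3.trans (R'' := [7, 17, 18]) (A'' := [7, 8, 9, 10]) k2).setReg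
      (by decide), ?_, vt'', by simpa [GrownState] using k3⟩
    have hle : s₂.reg 17 ≤ n := k3.le_card
    simp only [reg_setReg, Nat.reduceEqDiff, if_false]
    rcases k4 with k4 | ⟨k4, k5⟩
    · omega
    · right
      have hall := hconn (fun v => s₂.arr 7 v ≠ 0)
        ⟨vt'' 0, k3.vt_lt 0 k3.pos, by rw [k3.vis_vt 0 k3.pos]; omega⟩
        (fun e he heA => not_congr (k5 e he heA))
      have hcard := Finset.card_le_card_of_injOn (s := Finset.range n)
        (t := Finset.range (s₂.reg 17)) (fun v => s₂.arr 7 v - 1)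
        (fun v hv => Finset.mem_coe.2 (Finset.mem_range.2
          (k3.vis_lt (hall v (by simpa using hv))).1))
        (fun v hv w hw hvw => by
          rw [← (k3.vis_lt (hall v (by simpa using hv))).2,
            ← (k3.vis_lt (hall w (by simpa using hw))).2]
          exact congrArg vt'' hvw)
      rw [Finset.card_range, Finset.card_range] at hcard
      omega
  · rintro T s₁ ⟨h1, h2, h3, h4, vt', h5⟩
    have hle : s₁.reg 17 ≤ n := h5.le_card
    exact ⟨by omega, h3, by omega, vt', h5⟩

/-- Write the ends of the edges, as positions in the tree. -/
def endsLoop : Program :=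
  .instr (.const 7 0) ;;
  .loop (.lt 7 1)
    (.instr (.load 20 0 7) ;;
    .instr (.load 20 7 20) ;;
    .instr (.decr 20) ;;
    .instr (.store 11 7 20) ;;
    .instr (.load 20 1 7) ;;
    .instr (.load 20 7 20) ;;
    .instr (.decr 20) ;;
    .instr (.store 12 7 20) ;;
    .instr (.incr 7))

lemma wp_endsLoop (hs : Holds n m U W A s) :
    WP endsLoop s fun t s' => t ≤ 10 * m + 2 ∧ Keeps [7] [11, 12] s s' ∧
      ∀ e < m, s'.arr 11 e = s.arr 7 (U e) - 1 ∧ s'.arr 12 e = s.arr 7 (W e) - 1 := by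
  rw [endsLoop, wp_seq, wp_instr, apply_const]
  refine wp_for (a := 0) (b := m) (fun k T s₁ => T ≤ 10 * k ∧ s₁.reg 7 = k ∧
    Keeps [7] [11, 12] s s₁ ∧
      ∀ e < k, s₁.arr 11 e = s.arr 7 (U e) - 1 ∧ s₁.arr 12 e = s.arr 7 (W e) - 1)
    (Nat.zero_le _) ?_ ?_ ?_ ?_
  · exact ⟨by omega, by simp, (Keeps.refl s).setReg (by decide), fun e he => by omega⟩
  · rintro k T s₁ ⟨h1, h2, h3, h4⟩
    exact ⟨h2, (h3.reg 1).trans hs.reg1⟩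
  · rintro k T s₁ - hkm ⟨h1, h2, h3, h4⟩
    have hs₁ := hs.keeps h3
    simp only [wp_seq, wp_instr, apply_load, apply_store, apply_incr, apply_decr, reg_setReg,
      arr_setReg, reg_setArr, arr_setArr, if_true, if_false, Nat.reduceEqDiff, h2, hs₁.U_eq,
      hs₁.W_eq, h3.arr 7]
    refine ⟨by omega, trivial, ?_, fun e he => ?_⟩
    · repeat' first | exact h3 | refine Keeps.setReg ?_ (by decide) |
        refine Keeps.setArr ?_ (by decide)
    · rcases Nat.lt_succ_iff_lt_or_eq.1 he with he | rfl
      · rw [Function.update_of_ne (by omega), Function.update_of_ne (by omega)]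
        exact h4 e he
      · simp
  · rintro T s₁ ⟨h1, h2, h3, h4⟩
    exact ⟨by omega, h3, h4⟩

end

open TreeData

/-! ### The algorithm -/

lemma OutKeys.isOutput {D : TreeData} {s : State} {S : Finset (ℕ × ℕ)} {Ks : List (ℕ ⊕ ℕ × ℕ)}
    (hO : OutKeys D s Ks) (hK : IsKeys D D.m S Ks) (hS : D.Good D.m S) :
    IsOutput s ((fun k => (D.member k : Set ℕ)) '' (D.keys S)) := by
  obtain ⟨Ls, hL, hLK⟩ := hO
  have hlen := hLK.length_eq
  have hcnt := hL.cnt_eq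
  have hlist : ∀ i (hi : i < Ls.length), s.list 5 6 i = Ls[i] := hL.lists
  have hmem : ∀ k, k ∈ Ks ↔ k ∈ D.keys S := by
    rintro (e | p)
    · rw [hK.inl, keys, Finset.inl_mem_disjSum, mem_nontree]
    · rw [hK.inr, keys, Finset.inr_mem_disjSum]
  have hget : ∀ i (hi : i < Ls.length), (Ls[i].Nodup ∧ ∀ x, x ∈ Ls[i] ↔ x ∈ D.member Ks[i]) :=
    fun i hi => List.Forall₂.get hLK hi (by omega)
  have hset : ∀ i (hi : i < Ls.length),
      {e | e ∈ s.list 5 6 i} = (D.member Ks[i] : Set ℕ) := by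
    intro i hi
    ext x
    rw [Set.mem_ofPred_eq, hlist i hi, (hget i hi).2, Finset.mem_coe]
  refine ⟨fun i hi => ?_, fun i hi j hj hij => ?_, ?_⟩
  · rw [hlist i (by omega)]
    exact (hget i (by omega)).1
  · rw [Set.mem_Iio] at hi hj
    simp only [hset i (by omega), hset j (by omega)] at hij
    have := hS.member_injOn ((hmem _).1 (List.getElem_mem _)) ((hmem _).1 (List.getElem_mem _))
      (Finset.coe_injective hij)
    exact (hK.nodup.getElem_inj_iff).1 this
  · ext C
    constructor
    · rintro ⟨k, hk, rfl⟩
      obtain ⟨i, hi, rfl⟩ := List.getElem_of_mem ((hmem k).2 hk)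
      exact ⟨i, by rw [Set.mem_Iio]; omega, hset i (by omega)⟩
    · rintro ⟨i, hi, rfl⟩
      rw [Set.mem_Iio] at hi
      exact ⟨Ks[i], (hmem _).1 (List.getElem_mem _), (hset i (by omega)).symm⟩

/-- An edge of `T` missing from the grown tree would close its fundamental cycle within `T`. -/
lemma TreeData.Models.isTree_eq {D : TreeData} {G : Graph ℕ ℕ} {vt : ℕ → ℕ} (hM : D.Models G vt)
    {T : Set ℕ} (hT : IsSpanningTree G T) (hDT : {e | D.IsTree e} ⊆ T) :
    {e | D.IsTree e} = T := by
  refine hDT.antisymm fun e he => ?_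
  by_contra het
  have hem : e < D.m := by
    have := hT.subset he
    rwa [hM.edgeSet_eq] at this
  refine hT.acyclic _ ((ci_subset hem).trans ?_) (hM.isCycle_ci hem het)
  exact Set.insert_subset he hDT

/-- The `n - 1` tree edges are distinct. This lets `m * n` absorb the terms in `n * n`. -/
lemma TreeData.n_le (D : TreeData) : D.n ≤ D.m + 1 := by
  have := Finset.card_le_card_of_injOn (s := Finset.Ico 1 D.n) (t := Finset.range D.m) D.pe
    (fun i hi => by
      simp only [Finset.coe_Ico, Set.mem_Ico] at hi
      simpa using D.pe_lt i (by omega) hi.2)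
    (fun i hi j hj hij => by
      simp only [Finset.coe_Ico, Set.mem_Ico] at hi hj
      exact D.pe_inj (by omega) hi.2 (by omega) hj.2 hij)
  rw [Nat.card_Ico, Finset.card_range] at this
  omega

/-- The state `s` holds the graph `G`, with marks for the edges in `A`, in registers `0` and `1` and
arrays `0`, `1` and `4`, and the memory used for the computation is blank. -/
structure IsMarkedInput (n m : ℕ) (G : Graph ℕ ℕ) (A : Set ℕ) (s : State) : Prop where
  vertexSet_eq : V(G) = Set.Iio n
  edgeSet_eq : E(G) = Set.Iio m
  reg0 : s.reg 0 = n
  reg1 : s.reg 1 = m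
  reg2 : s.reg 2 = 0
  reg5 : s.reg 5 = 0
  ends : ∀ e < m, G.IsLink e (s.arr 0 e) (s.arr 1 e)
  mark : ∀ e < m, s.arr 4 e = 0 ↔ e ∉ A
  arr_blank : ∀ a, 5 ≤ a → ∀ i, s.arr a i = 0

/-- Compute a lattice cycle basis that is semi-fundamental with respect to some spanning tree with
marked edges. -/
def basisProgram : Program :=
  .instr (.const 3 0) ;;
  .instr (.const 4 1) ;;
  .instr (.const 6 1) ;;
  .instr (.const 17 1) ;;
  .instr (.store 7 3 4) ;;
  growTree ;; endsLoop ;; mainLoop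

lemma IsMarkedInput.connected {n m : ℕ} {G : Graph ℕ ℕ} {A : Set ℕ} {s : State}
    (h : IsMarkedInput n m G A s) (hconn : IsConnected (G.restrict A)) (p : ℕ → Prop)
    (hp : ∃ v < n, p v) (hpe : ∀ e < m, e ∈ A → (p (s.arr 0 e) ↔ p (s.arr 1 e))) (w : ℕ)
    (hw : w < n) : p w := by
  obtain ⟨v, hv, hpv⟩ := hp
  have hmem : ∀ x < n, x ∈ V(G.restrict A) := by
    intro x hx
    rw [Graph.vertexSet_restrict, h.vertexSet_eq]
    exact hx
  have hstep : ∀ {x y}, (G.restrict A).Adj x y → p x → p y := by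
    rintro x y ⟨e, heA, hl⟩ hpx
    have hem : e < m := by
      have := hl.edge_mem
      rwa [h.edgeSet_eq] at this
    have h1 := hpe e hem heA
    rcases (h.ends e hem).eq_and_eq_or_eq_and_eq hl with ⟨h2, h3⟩ | ⟨h2, h3⟩
    · rw [h2, h3] at h1
      exact h1.1 hpx
    · rw [h2, h3] at h1
      exact h1.2 hpx
  have hvw := hconn.2 v (hmem v hv) w (hmem w hw)
  induction hvw with
  | refl => exact hpv
  | tail _ hxy ih =>
    have hx := hxy.left_mem
    rw [Graph.vertexSet_restrict, h.vertexSet_eq] at hx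
    exact hstep hxy (ih hx)

/-- The grown tree depends only on the marks `A`; if `A` is itself a spanning tree, then it is the
grown tree. The bound `m ≤ m * n` is recorded to absorb the cost of marking all edges beforehand. -/
theorem wp_basisProgram {n m : ℕ} {G : Graph ℕ ℕ} {A : Set ℕ} {s : State}
    (h : IsMarkedInput n m G A s) (hconn : IsConnected (G.restrict A)) :
    WP basisProgram s fun t s' => t ≤ 400 * (m * n + 1) ∧ m ≤ m * n ∧ ∃ B, IsOutput s' B ∧
      IsLatticeCycleBasis G B ∧ (IsSpanningTree G A → IsSemiFundamentalBasis G A B) := by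
  have hn : 0 < n := by
    obtain ⟨v, hv⟩ := hconn.1
    rw [Graph.vertexSet_restrict, h.vertexSet_eq] at hv
    exact (Nat.zero_le v).trans_lt hv
  have hlt : ∀ e < m, s.arr 0 e < n ∧ s.arr 1 e < n := by
    intro e he
    have h1 := (h.ends e he).left_mem
    have h2 := (h.ends e he).right_mem
    rw [h.vertexSet_eq] at h1 h2
    exact ⟨h1, h2⟩
  have blank : ∀ a, 5 ≤ a → s.arr a = 0 := fun a ha => funext (h.arr_blank a ha)
  simp only [basisProgram, wp_seq, wp_instr, apply_const, apply_store, reg_setReg,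
    Nat.reduceEqDiff, if_true, if_false]
  set s₁ := ((((s.setReg 3 0).setReg 4 1).setReg 6 1).setReg 17 1).setArr 7 0 1 with hs₁
  have hk₁ : Keeps [3, 4, 6, 17] [7] s s₁ :=
    (((((Keeps.refl s).setReg (by decide)).setReg (by decide)).setReg (by decide)).setReg
      (by decide)).setArr (by decide)
  have hH : Holds n m (s.arr 0) (s.arr 1) A s₁ :=
    { reg0 := (hk₁.reg 0).trans h.reg0
      reg1 := (hk₁.reg 1).trans h.reg1
      reg3 := by simp [hs₁]
      reg4 := by simp [hs₁]
      U_eq := hk₁.arr 0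
      W_eq := hk₁.arr 1
      mark := by rw [hk₁.arr 4]; exact h.mark
      U_lt := fun e he => (hlt e he).1
      W_lt := fun e he => (hlt e he).2 }
  -- Initially the tree is the vertex `0`; its entry in `vis` is `1`, its position plus one.
  have hG : GrownState n m (s.arr 0) (s.arr 1) A 0 s₁ := by
    have := Grown.init (n := n) (m := m) (U := s.arr 0) (W := s.arr 1) (A := A) hn
    simpa [GrownState, hs₁, blank] using this
  refine (wp_growTree hH hG (fun p hp hpe w hw => h.connected hconn p hp hpe w hw)).mono ?_
  rintro t₂ s₂ ⟨ht₂, hk₂, hcnt, vt, hG₂⟩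
  refine (wp_endsLoop (hH.keeps hk₂)).mono ?_
  rintro t₃ s₃ ⟨ht₃, hk₃, hXY⟩
  rw [GrownState, hcnt] at hG₂
  have hvis : ∀ v < n, s₂.arr 7 v ≠ 0 := by
    have himg : (Finset.range n).image vt = Finset.range n := by
      refine Finset.eq_of_subset_of_card_le ?_ ?_
      · intro v hv
        obtain ⟨i, hi, rfl⟩ := Finset.mem_image.1 hv
        exact Finset.mem_range.2 (hG₂.vt_lt i (Finset.mem_range.1 hi))
      · rw [Finset.card_image_of_injOn]
        intro i hi j hj hij
        exact hG₂.vt_inj (by simpa using hi) (by simpa using hj) hij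
    intro v hv
    have hv' := Finset.mem_range.2 hv
    rw [← himg] at hv'
    obtain ⟨i, hi, rfl⟩ := Finset.mem_image.1 hv'
    rw [hG₂.vis_vt i (Finset.mem_range.1 hi)]
    omega
  have hU : ∀ e < m, s₃.arr 11 e < n ∧ vt (s₃.arr 11 e) = s.arr 0 e := fun e he => by
    rw [(hXY e he).1]
    exact hG₂.vis_lt (hvis _ (hlt e he).1)
  have hW : ∀ e < m, s₃.arr 12 e < n ∧ vt (s₃.arr 12 e) = s.arr 1 e := fun e he => by
    rw [(hXY e he).2]
    exact hG₂.vis_lt (hvis _ (hlt e he).2)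
  -- Vertices are renamed by the order in which they joined the tree, which makes every parent
  -- smaller than its children.
  let D : TreeData :=
    { n := n
      m := m
      par := s₂.arr 8
      pe := s₂.arr 9
      X := s₃.arr 11
      Y := s₃.arr 12
      n_pos := hn
      par_lt := hG₂.par_lt
      pe_lt := hG₂.pe_lt
      X_lt := fun e he => (hU e he).1
      Y_lt := fun e he => (hW e he).1
      ends_pe := fun i hi hin => by
        have hm := hG₂.pe_lt i hi hin
        have hp := (hG₂.par_lt i hi).trans hin
        refine (hG₂.ends i hi hin).imp (fun h' => ⟨?_, ?_⟩) fun h' => ⟨?_, ?_⟩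
        · exact hG₂.vt_inj (hU _ hm).1 hin ((hU _ hm).2.trans h'.1)
        · exact hG₂.vt_inj (hW _ hm).1 hp ((hW _ hm).2.trans h'.2)
        · exact hG₂.vt_inj (hU _ hm).1 hp ((hU _ hm).2.trans h'.1)
        · exact hG₂.vt_inj (hW _ hm).1 hin ((hW _ hm).2.trans h'.2) }
  have hM : D.Models G vt :=
    { inj := fun i hi j hj hij => hG₂.vt_inj hi hj hij
      vertexSet_eq := by
        rw [h.vertexSet_eq]
        ext v
        constructor
        · intro hv
          have := hG₂.vis_lt (hvis v hv)
          exact ⟨_, this.1, this.2⟩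
        · rintro ⟨i, hi, rfl⟩
          exact hG₂.vt_lt i hi
      edgeSet_eq := h.edgeSet_eq
      isLink := fun e he => by
        have := h.ends e he
        rwa [← (hU e he).2, ← (hW e he).2] at this }
  have hDA : {e | D.IsTree e} ⊆ A := by
    rintro e ⟨i, hi, hin, rfl⟩
    exact hG₂.pe_mem i hi hin
  have hk₄ : Keeps [7] [11, 12] s₂ (s₃.setReg 7 0) := hk₃.setReg (by decide)
  have hk₂' : Keeps [3, 4, 6, 7, 17, 18] [7, 8, 9, 10] s s₂ := hk₁.trans hk₂
  have hk : Keeps [3, 4, 6, 7, 17, 18] [7, 8, 9, 10, 11, 12] s (s₃.setReg 7 0) := hk₂'.trans hk₄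
  have hcov : ∀ j, D.cov 0 j = ∅ := fun j => by
    ext f
    simp [mem_cov]
  have hmain : Main D 0 ∅ [] (s₃.setReg 7 0) :=
    { base :=
        { reg0 := (hk.reg 0).trans h.reg0
          reg1 := (hk.reg 1).trans h.reg1
          reg3 := (hk₄.reg 3).trans ((hk₂.reg 3).trans hH.reg3)
          reg4 := (hk₄.reg 4).trans ((hk₂.reg 4).trans hH.reg4)
          par := hk₄.arr 8
          pe := hk₄.arr 9
          tree := fun e => by
            rw [hk₄.arr 10]
            exact hG₂.it_iff e
          X := rfl
          Y := rfl }
      reg7 := by simp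
      marks := fun j => by rw [hk.arr 13, blank 13 (by norm_num)]; simp
      good := D.good_zero
      out := ⟨[], by
        rw [Out, hk.arr 5, hk.arr 6, hk.reg 2, hk.reg 5, blank 5 (by norm_num),
          blank 6 (by norm_num), h.reg2, h.reg5]
        exact ⟨rfl, rfl, fun i _ j _ => le_rfl, fun i hi => absurd hi (Nat.not_lt_zero i), rfl⟩,
        .nil⟩
      keys := ⟨List.nodup_nil, by simp, by simp⟩
      classes := by
        rw [hk.arr 14, hk.arr 15, blank 14 (by norm_num), blank 15 (by norm_num), hk₄.reg 6,
          hk₂.reg 6]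
        exact ⟨fun i j _ _ _ _ => by simp [hcov], fun i _ _ => by simp [hs₁],
          fun i _ _ => by simp [hcov]⟩
      stamp := fun a => by rw [hk.arr 16, blank 16 (by norm_num)]; exact le_rfl
      seen := fun a => by rw [hk.arr 17, blank 17 (by norm_num)]; exact le_rfl }
  refine (wp_mainLoop hmain).mono ?_
  rintro t₄ s₄ ⟨S, Ks, ht₄, hmain'⟩
  have hB := hM.isSemiFundamentalBasis hmain'.good
  refine ⟨?_, Nat.le_mul_of_pos_right m hn, _, hmain'.out.isOutput hmain'.keys hmain'.good,
    hB.isLatticeCycleBasis, fun hT => ?_⟩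
  · have hnm : n ≤ m * n + 1 := by
      have h1 : n ≤ m + 1 := D.n_le
      rcases Nat.eq_zero_or_pos m with rfl | hm
      · omega
      · have := Nat.le_mul_of_pos_left n hm
        omega
    have hnn : n * n ≤ m * n + n := by
      have := Nat.mul_le_mul_right n (show n ≤ m + 1 from D.n_le)
      rwa [Nat.add_mul, Nat.one_mul] at this
    have hmm := Nat.le_mul_of_pos_right m hn
    have ht₄' : t₄ ≤ (58 * n + 30) * m + (40 * n + 10 * m + 24) * n + 2 := ht₄
    have e1 : (58 * n + 30) * m + (40 * n + 10 * m + 24) * n =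
      68 * (m * n) + 30 * m + 40 * (n * n) + 24 * n := by ring
    have e2 : (16 * m + 4) * n = 16 * (m * n) + 4 * n := by ring
    omega
  · rwa [hM.isTree_eq hT hDA] at hB

/-- Mark all edges. -/
def markAll : Program :=
  .instr (.const 3 1) ;;
  .loop (.lt 7 1) (.instr (.store 4 7 3) ;; .instr (.incr 7))

lemma wp_markAll {s : State} (h7 : s.reg 7 = 0) : WP markAll s fun t s' =>
    t ≤ 3 * s.reg 1 + 2 ∧ Keeps [3, 7] [4] s s' ∧ ∀ e < s.reg 1, s'.arr 4 e = 1 := by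
  rw [markAll, wp_seq, wp_instr, apply_const]
  refine wp_for (a := 0) (b := s.reg 1) (fun k T s₁ => T ≤ 3 * k ∧ s₁.reg 7 = k ∧
    Keeps [3, 7] [4] s s₁ ∧ s₁.reg 3 = 1 ∧ ∀ e < k, s₁.arr 4 e = 1) (Nat.zero_le _) ?_ ?_ ?_ ?_
  · exact ⟨by omega, by simpa using h7, (Keeps.refl s).setReg (by decide), by simp,
      fun e he => by omega⟩
  · rintro k T s₁ ⟨h1, h2, h3, h4⟩
    exact ⟨h2, h3.reg 1⟩
  · rintro k T s₁ - hkm ⟨h1, h2, h3, h4, h5⟩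
    simp only [wp_seq, wp_instr, apply_store, apply_incr, reg_setReg, arr_setReg, reg_setArr,
      arr_setArr, if_true, if_false, Nat.reduceEqDiff, h2, h4]
    refine ⟨by omega, trivial, (h3.setArr (by decide)).setReg (by decide), trivial,
      fun e he => ?_⟩
    rcases Nat.lt_succ_iff_lt_or_eq.1 he with he | rfl
    · rw [Function.update_of_ne (by omega)]
      exact h5 e he
    · simp
  · rintro T s₁ ⟨h1, h2, h3, h4, h5⟩
    exact ⟨by omega, h3, h5⟩

lemma IsInput.isMarkedInput {n m : ℕ} {G : Graph ℕ ℕ} {T : Set ℕ} {s : State}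
    (h : IsInput n m G T s) : IsMarkedInput n m G T s where
  vertexSet_eq := h.vertexSet_eq
  edgeSet_eq := h.edgeSet_eq
  reg0 := h.reg_zero
  reg1 := h.reg_one
  reg2 := h.reg_blank 2 (by norm_num)
  reg5 := h.reg_blank 5 (by norm_num)
  ends := h.ends
  mark e _ := by
    rw [h.mark, Set.indicator_apply_eq_zero]
    simp
  arr_blank := h.arr_blank

/-- With all edges marked, the program grows a spanning tree of its own choice. -/
theorem wp_markAll_basisProgram {n m : ℕ} {G : Graph ℕ ℕ} {T : Set ℕ} {s : State}
    (h : IsInput n m G T s) (hconn : IsConnected G) :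
    WP (markAll ;; basisProgram) s fun t s' => t ≤ 405 * (m * n + 1) ∧ ∃ B, IsOutput s' B ∧
      IsLatticeCycleBasis G B := by
  rw [wp_seq]
  refine (wp_markAll (h.reg_blank 7 (by norm_num))).mono ?_
  rintro t₁ s₁ ⟨ht₁, hk₁, hmark⟩
  rw [h.reg_one] at ht₁ hmark
  have h₁ : IsMarkedInput n m G E(G) s₁ :=
    { vertexSet_eq := h.vertexSet_eq
      edgeSet_eq := h.edgeSet_eq
      reg0 := (hk₁.reg 0).trans h.reg_zero
      reg1 := (hk₁.reg 1).trans h.reg_one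
      reg2 := (hk₁.reg 2).trans (h.reg_blank 2 (by norm_num))
      reg5 := (hk₁.reg 5).trans (h.reg_blank 5 (by norm_num))
      ends := by rw [hk₁.arr 0, hk₁.arr 1]; exact h.ends
      mark := fun e he => by
        rw [hmark e he, h.edgeSet_eq]
        simpa using he
      arr_blank := fun a ha i => by
        rw [hk₁.arr a (by simp; omega)]
        exact h.arr_blank a ha i }
  refine (wp_basisProgram h₁ (by rwa [Graph.restrict_self])).mono ?_
  rintro t₂ s₂ ⟨ht₂, hmn, B, hB, hB', -⟩
  exact ⟨by omega, B, hB, hB'⟩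

/-! ### Arbitrary finite graphs -/

section

variable {α : Type u} {β : Type v} {G : Graph α β} {G' : Graph ℕ ℕ} {f : α → ℕ} {g : β → ℕ}

/-- The graph `G'` is obtained from `G` by the injective renaming `f` of the vertices and the
injective renaming `g` of the edges. -/
structure IsRenaming (G : Graph α β) (G' : Graph ℕ ℕ) (f : α → ℕ) (g : β → ℕ) : Prop where
  f_inj : Set.InjOn f V(G)
  g_inj : Set.InjOn g E(G)
  vertexSet_eq : V(G') = f '' V(G)
  isLink_iff : ∀ e' x' y', G'.IsLink e' x' y' ↔
    ∃ e x y, G.IsLink e x y ∧ g e = e' ∧ f x = x' ∧ f y = y'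

lemma exists_injOn_image_eq_Iio {γ : Type*} {s : Set γ} (hs : s.Finite) :
    ∃ (f : γ → ℕ) (n : ℕ), Set.InjOn f s ∧ f '' s = Set.Iio n := by
  classical
  have := hs.to_subtype
  obtain ⟨n, ⟨φ⟩⟩ := Finite.exists_equiv_fin s
  refine ⟨fun x => if h : x ∈ s then φ ⟨x, h⟩ else 0, n, fun x hx y hy hxy => ?_, ?_⟩
  · simp only [hx, hy, dif_pos] at hxy
    exact congrArg Subtype.val (φ.injective (Fin.ext hxy))
  · ext i
    constructor
    · rintro ⟨x, hx, rfl⟩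
      simp [hx]
    · intro hi
      refine ⟨φ.symm ⟨i, hi⟩, (φ.symm ⟨i, hi⟩).2, ?_⟩
      simp

lemma exists_isRenaming (G : Graph α β) (hV : V(G).Finite) (hE : E(G).Finite) :
    ∃ G' f g n m, IsRenaming G G' f g ∧ V(G') = Set.Iio n ∧ E(G') = Set.Iio m := by
  obtain ⟨f, n, hf, hfn⟩ := exists_injOn_image_eq_Iio hV
  obtain ⟨g, m, hg, hgm⟩ := exists_injOn_image_eq_Iio hE
  let G' : Graph ℕ ℕ :=
    { vertexSet := f '' V(G)
      edgeSet := g '' E(G)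
      IsLink := fun e' x' y' => ∃ e x y, G.IsLink e x y ∧ g e = e' ∧ f x = x' ∧ f y = y'
      isLink_symm := fun e' _ => ⟨fun x' y' ⟨e, x, y, h, h1, h2, h3⟩ =>
        ⟨e, y, x, h.symm, h1, h3, h2⟩⟩
      eq_or_eq_of_isLink_of_isLink := by
        rintro _ _ _ _ _ ⟨e, x, y, h, rfl, rfl, rfl⟩ ⟨e₁, x₁, y₁, h₁, he, rfl, rfl⟩
        obtain rfl := hg h₁.edge_mem h.edge_mem he
        exact (h.left_eq_or_eq h₁).imp (congrArg f) (congrArg f)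
      edge_mem_iff_exists_isLink := by
        intro e'
        constructor
        · rintro ⟨e, he, rfl⟩
          obtain ⟨x, y, h⟩ := G.exists_isLink_of_mem_edgeSet he
          exact ⟨_, _, e, x, y, h, rfl, rfl, rfl⟩
        · rintro ⟨_, _, e, x, y, h, rfl, rfl, rfl⟩
          exact ⟨e, h.edge_mem, rfl⟩
      left_mem_of_isLink := by
        rintro _ _ _ ⟨e, x, y, h, rfl, rfl, rfl⟩
        exact ⟨x, h.left_mem, rfl⟩ }
  exact ⟨G', f, g, n, m, ⟨hf, hg, rfl, fun _ _ _ => Iff.rfl⟩, hfn, hgm⟩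

lemma IsCycle.subset_edgeSet {C : Set β} (h : IsCycle G C) : C ⊆ E(G) := by
  obtain ⟨k, v, e, -, -, hl, rfl⟩ := h
  rintro _ ⟨i, rfl⟩
  exact (hl i).edge_mem

namespace IsRenaming

lemma edgeSet_eq (h : IsRenaming G G' f g) : E(G') = g '' E(G) := by
  ext e'
  rw [G'.edge_mem_iff_exists_isLink]
  constructor
  · rintro ⟨x', y', hl⟩
    obtain ⟨e, x, y, hxy, rfl, -, -⟩ := (h.isLink_iff _ _ _).1 hl
    exact ⟨e, hxy.edge_mem, rfl⟩
  · rintro ⟨e, he, rfl⟩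
    obtain ⟨x, y, hl⟩ := G.exists_isLink_of_mem_edgeSet he
    exact ⟨_, _, (h.isLink_iff _ _ _).2 ⟨e, x, y, hl, rfl, rfl, rfl⟩⟩

lemma image_inter_preimage (h : IsRenaming G G' f g) {C : Set ℕ} (hC : C ⊆ E(G')) :
    g '' (E(G) ∩ g ⁻¹' C) = C := by
  rw [h.edgeSet_eq] at hC
  rw [Set.image_inter_preimage, Set.inter_eq_right]
  exact hC

lemma inter_preimage_image (h : IsRenaming G G' f g) {C : Set β} (hC : C ⊆ E(G)) :
    E(G) ∩ g ⁻¹' (g '' C) = C := by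
  ext e
  constructor
  · rintro ⟨he, e₁, he₁, h'⟩
    rwa [← h.g_inj (hC he₁) he h']
  · intro he
    exact ⟨hC he, e, he, rfl⟩

lemma isCycle_image (h : IsRenaming G G' f g) {C : Set β} (hC : IsCycle G C) :
    IsCycle G' (g '' C) := by
  obtain ⟨k, v, e, hv, he, hl, rfl⟩ := hC
  refine ⟨k, f ∘ v, g ∘ e, fun i j hij => ?_, fun i j hij => ?_, fun i => ?_, ?_⟩
  · exact hv (h.f_inj (hl i).left_mem (hl j).left_mem hij)
  · exact he (h.g_inj (hl i).edge_mem (hl j).edge_mem hij)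
  · exact (h.isLink_iff _ _ _).2 ⟨_, _, _, hl i, rfl, rfl, rfl⟩
  · rw [Set.range_comp]

lemma isCycle_preimage (h : IsRenaming G G' f g) {C : Set ℕ} (hC : IsCycle G' C) :
    IsCycle G (E(G) ∩ g ⁻¹' C) := by
  obtain ⟨k, v', e', hv, he, hl, rfl⟩ := hC
  have hl' := fun i => (h.isLink_iff _ _ _).1 (hl i)
  choose e x y hxy he' hx' hy' using hl'
  refine ⟨k, x, e, fun i j hij => ?_, fun i j hij => ?_, fun i => ?_, ?_⟩
  · exact hv (by rw [← hx' i, ← hx' j, hij])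
  · exact he (by rw [← he' i, ← he' j, hij])
  · have hy : y i = x (i + 1) :=
      h.f_inj (hxy i).right_mem (hxy (i + 1)).left_mem ((hy' i).trans (hx' (i + 1)).symm)
    rw [← hy]
    exact hxy i
  · rw [← h.inter_preimage_image (C := Set.range e), ← Set.range_comp,
      show g ∘ e = e' from funext he']
    rintro _ ⟨i, rfl⟩
    exact (hxy i).edge_mem

lemma isConnected_restrict (h : IsRenaming G G' f g) {A : Set β}
    (hA : IsConnected (G.restrict A)) : IsConnected (G'.restrict (g '' A)) := by
  have hV : V(G'.restrict (g '' A)) = f '' V(G) := h.vertexSet_eq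
  rw [IsConnected, hV]
  refine ⟨hA.1.image f, ?_⟩
  rintro _ ⟨x, hx, rfl⟩ _ ⟨y, hy, rfl⟩
  refine (hA.2 x hx y hy).lift f ?_
  rintro a b ⟨e, heA, hl⟩
  exact ⟨g e, ⟨e, heA, rfl⟩, (h.isLink_iff _ _ _).2 ⟨e, a, b, hl, rfl, rfl, rfl⟩⟩

lemma isSpanningTree_image (h : IsRenaming G G' f g) {T : Set β} (hT : IsSpanningTree G T) :
    IsSpanningTree G' (g '' T) where
  subset := by
    rw [h.edgeSet_eq]
    exact Set.image_mono hT.subset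
  connected := h.isConnected_restrict hT.connected
  acyclic C hC hCG := by
    refine hT.acyclic _ ?_ (h.isCycle_preimage hCG)
    rw [← h.inter_preimage_image hT.subset]
    exact Set.inter_subset_inter_right _ (Set.preimage_mono hC)

lemma isFundamentalCycle_image (h : IsRenaming G G' f g) {T : Set β} (hT : T ⊆ E(G)) {e : β}
    {C : Set β} (hC : IsFundamentalCycle G T e C) :
    IsFundamentalCycle G' (g '' T) (g e) (g '' C) where
  mem := by
    rw [h.edgeSet_eq]
    exact ⟨e, hC.mem, rfl⟩
  notMem := by
    rintro ⟨e₁, he₁, h'⟩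
    exact hC.notMem (by rwa [← h.g_inj (hT he₁) hC.mem h'])
  isCycle := h.isCycle_image hC.isCycle
  subset := by
    rw [← Set.image_insert_eq]
    exact Set.image_mono hC.subset

lemma isFundamentalCycle_preimage (h : IsRenaming G G' f g) {T : Set β} (hT : T ⊆ E(G)) {e' : ℕ}
    {C : Set ℕ} (hC : IsFundamentalCycle G' (g '' T) e' C) :
    ∃ e, g e = e' ∧ IsFundamentalCycle G T e (E(G) ∩ g ⁻¹' C) := by
  have he' := hC.mem
  rw [h.edgeSet_eq] at he'
  obtain ⟨e, he, rfl⟩ := he'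
  refine ⟨e, rfl, he, fun heT => hC.notMem ⟨e, heT, rfl⟩, h.isCycle_preimage hC.isCycle, ?_⟩
  rw [← h.inter_preimage_image (Set.insert_subset he hT), Set.image_insert_eq]
  exact Set.inter_subset_inter_right _ (Set.preimage_mono hC.subset)

lemma isLatticeCycleBasis (h : IsRenaming G G' f g) {B : Set (Set ℕ)}
    (hB : IsLatticeCycleBasis G' B) :
    IsLatticeCycleBasis G ((fun C => E(G) ∩ g ⁻¹' C) '' B) where
  isCycle := by
    rintro _ ⟨C, hC, rfl⟩
    exact h.isCycle_preimage (hB.isCycle C hC)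
  linearIndependent := by
    classical
    -- `L` transports functions along `g`, with value zero outside of the image. It maps the vector
    -- of a set of edges to that of its image, so independence can be checked after applying it.
    let L : (β → ℤ) →ₗ[ℤ] (ℕ → ℤ) :=
      { toFun := fun y i => if hi : ∃ e ∈ E(G), g e = i then y hi.choose else 0
        map_add' := fun y z => by ext i; by_cases hi : ∃ e ∈ E(G), g e = i <;> simp [hi]
        map_smul' := fun c y => by ext i; by_cases hi : ∃ e ∈ E(G), g e = i <;> simp [hi] }
    have hL : ∀ C ⊆ E(G), L (indVec C) = indVec (g '' C) := by
      intro C hC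
      ext i
      change (if hi : ∃ e ∈ E(G), g e = i then indVec C hi.choose else 0) = indVec (g '' C) i
      rw [indVec, indVec, Set.indicator_apply]
      split_ifs with hi hiC hiC
      · obtain ⟨e, he, rfl⟩ := hiC
        have := h.g_inj hi.choose_spec.1 (hC he) hi.choose_spec.2
        rw [this, Set.indicator_of_mem he]
        rfl
      · refine Set.indicator_of_notMem (fun h' => hiC ⟨_, h', hi.choose_spec.2⟩) _
      · obtain ⟨e, he, rfl⟩ := hiC
        exact absurd ⟨e, hC he, rfl⟩ hi
      · rfl
    have hmem : ∀ C : (fun C => E(G) ∩ g ⁻¹' C) '' B, g '' (C : Set β) ∈ B := by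
      rintro ⟨_, C, hC, rfl⟩
      change g '' (E(G) ∩ g ⁻¹' C) ∈ B
      rwa [h.image_inter_preimage (hB.isCycle C hC).subset_edgeSet]
    have hsub : ∀ C : (fun C => E(G) ∩ g ⁻¹' C) '' B, (C : Set β) ⊆ E(G) := by
      rintro ⟨_, C, hC, rfl⟩
      exact Set.inter_subset_left
    refine LinearIndependent.of_comp L ?_
    have := hB.linearIndependent.comp
      (fun C : (fun C => E(G) ∩ g ⁻¹' C) '' B => (⟨g '' (C : Set β), hmem C⟩ : B)) ?_
    · convert this using 1
      ext C : 1
      exact hL _ (hsub C)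
    · intro C C₁ hCC
      have := congrArg Subtype.val hCC
      refine Subtype.ext ?_
      rw [← h.inter_preimage_image (hsub C), ← h.inter_preimage_image (hsub C₁)]
      exact congrArg (fun C => E(G) ∩ g ⁻¹' C) this
  span_eq := by
    classical
    -- `R` pulls functions back along `g`. It maps the generators of the cycle lattice of `G'` onto
    -- those of the cycle lattice of `G`, and likewise for the two bases.
    let R : (ℕ → ℤ) →ₗ[ℤ] (β → ℤ) :=
      { toFun := fun y e => if e ∈ E(G) then y (g e) else 0
        map_add' := fun y z => by ext e; by_cases he : e ∈ E(G) <;> simp [he]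
        map_smul' := fun c y => by ext e; by_cases he : e ∈ E(G) <;> simp [he] }
    have hR : ∀ S : Set (Set ℕ), R '' (indVec '' S) =
        indVec '' ((fun C => E(G) ∩ g ⁻¹' C) '' S) := by
      intro S
      rw [Set.image_image, Set.image_image]
      refine Set.image_congr fun C _ => ?_
      ext e
      change (if e ∈ E(G) then indVec C (g e) else 0) = indVec (E(G) ∩ g ⁻¹' C) e
      rw [indVec, indVec, Set.indicator_apply, Set.indicator_apply]
      by_cases he : e ∈ E(G) <;> simp [he]
    have hcyc : (fun C => E(G) ∩ g ⁻¹' C) '' {C | IsCycle G' C} = {C | IsCycle G C} := by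
      ext C
      constructor
      · rintro ⟨C, hC, rfl⟩
        exact h.isCycle_preimage hC
      · intro hC
        exact ⟨_, h.isCycle_image hC, h.inter_preimage_image hC.subset_edgeSet⟩
    rw [← hR, ← Submodule.map_span, hB.span_eq, cycleLattice, Submodule.map_span, hR, hcyc,
      cycleLattice]

lemma isSemiFundamentalBasis (h : IsRenaming G G' f g) {T : Set β} (hT : T ⊆ E(G))
    {B : Set (Set ℕ)} (hB : IsSemiFundamentalBasis G' (g '' T) B) :
    IsSemiFundamentalBasis G T ((fun C => E(G) ∩ g ⁻¹' C) '' B) where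
  isLatticeCycleBasis := h.isLatticeCycleBasis hB.isLatticeCycleBasis
  fundamental_mem e C hC := ⟨_, hB.fundamental_mem _ _ (h.isFundamentalCycle_image hT hC),
    h.inter_preimage_image hC.isCycle.subset_edgeSet⟩
  mem_cases := by
    rintro _ ⟨C, hC, rfl⟩
    rcases hB.mem_cases C hC with ⟨e', he'⟩ | ⟨e', f', C₁, C₂, hef, h₁, h₂, hne, rfl⟩
    · obtain ⟨e, -, he⟩ := h.isFundamentalCycle_preimage hT he'
      exact Or.inl ⟨e, he⟩
    · obtain ⟨e₁, rfl, he₁⟩ := h.isFundamentalCycle_preimage hT h₁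
      obtain ⟨e₂, rfl, he₂⟩ := h.isFundamentalCycle_preimage hT h₂
      refine Or.inr ⟨e₁, e₂, _, _, fun h' => hef (congrArg g h'), he₁, he₂, ?_, ?_⟩
      · obtain ⟨_, ⟨hx₁, hx₂⟩, e, he, rfl⟩ := hne
        exact ⟨e, ⟨⟨hT he, hx₁⟩, ⟨hT he, hx₂⟩⟩, he⟩
      · ext e
        simp only [Set.mem_inter_iff, Set.mem_preimage, Set.mem_symmDiff]
        tauto

end IsRenaming

/-- Every graph with vertices `0, …, n - 1` and edges `0, …, m - 1` can be stored in the memory. -/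
lemma exists_isMarkedInput {n m : ℕ} (hV : V(G') = Set.Iio n) (hE : E(G') = Set.Iio m)
    (A : Set ℕ) : ∃ s, IsMarkedInput n m G' A s := by
  classical
  have hl : ∀ e, ∃ p : ℕ × ℕ, e < m → G'.IsLink e p.1 p.2 := by
    intro e
    by_cases he : e < m
    · obtain ⟨x, y, h⟩ := G'.exists_isLink_of_mem_edgeSet (e := e) (by rw [hE]; exact he)
      exact ⟨(x, y), fun _ => h⟩
    · exact ⟨(0, 0), fun h => absurd h he⟩
  choose p hp using hl
  refine ⟨⟨fun x => if x = 0 then n else if x = 1 then m else 0, fun a e => if a = 0 then (p e).1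
    else if a = 1 then (p e).2 else if a = 4 then if e ∈ A then 1 else 0 else 0⟩, hV, hE, rfl, rfl,
    rfl, rfl, ?_, ?_, ?_⟩
  · intro e he
    simpa using hp e he
  · intro e _
    simp
  · intro a ha i
    simp only
    rw [if_neg (by omega), if_neg (by omega), if_neg (by omega)]

/-- Existence is read off from the output of the program on a copy of the graph whose vertices and
edges are natural numbers. -/
theorem exists_basis (hV : V(G).Finite) (hE : E(G).Finite) {A : Set β}
    (hA : IsConnected (G.restrict A)) : ∃ B, IsLatticeCycleBasis G B ∧
      (IsSpanningTree G A → IsSemiFundamentalBasis G A B) := by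
  obtain ⟨G', f, g, n, m, h, hV', hE'⟩ := exists_isRenaming G hV hE
  obtain ⟨s, hs⟩ := exists_isMarkedInput hV' hE' (g '' A)
  obtain ⟨-, -, -, -, -, B, -, hB, hB'⟩ := wp_basisProgram hs (h.isConnected_restrict hA)
  exact ⟨_, h.isLatticeCycleBasis hB, fun hT =>
    h.isSemiFundamentalBasis hT.subset (hB' (h.isSpanningTree_image hT))⟩

end

end CycleLattice

theorem mainTheorem2 :
    -- existence, for every finite connected multigraph and every spanning tree
    (∀ (α : Type u) (β : Type v) (G : Graph α β), V(G).Finite → E(G).Finite →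
      CycleLattice.IsConnected G →
        (∃ B, CycleLattice.IsLatticeCycleBasis G B) ∧
        ∀ T, CycleLattice.IsSpanningTree G T → ∃ B, CycleLattice.IsSemiFundamentalBasis G T B) ∧
    -- a lattice cycle basis is computed from the graph alone in time `O(mn)`
    (∃ (P : CycleLattice.Program) (c : ℕ), ∀ (n m : ℕ) (G : Graph ℕ ℕ) (s : CycleLattice.State),
      CycleLattice.IsInput n m G ∅ s → CycleLattice.IsConnected G →
        ∃ (t : ℕ) (s' : CycleLattice.State) (B : Set (Set ℕ)),
          CycleLattice.Runs P s t s' ∧ t ≤ c * (m * n + 1) ∧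
          CycleLattice.IsOutput s' B ∧ CycleLattice.IsLatticeCycleBasis G B) ∧
    -- a semi-fundamental one is computed from the graph and a spanning tree in time `O(mn)`
    (∃ (P : CycleLattice.Program) (c : ℕ), ∀ (n m : ℕ) (G : Graph ℕ ℕ) (T : Set ℕ)
        (s : CycleLattice.State),
      CycleLattice.IsInput n m G T s → CycleLattice.IsConnected G →
      CycleLattice.IsSpanningTree G T →
        ∃ (t : ℕ) (s' : CycleLattice.State) (B : Set (Set ℕ)),
          CycleLattice.Runs P s t s' ∧ t ≤ c * (m * n + 1) ∧
          CycleLattice.IsOutput s' B ∧ CycleLattice.IsSemiFundamentalBasis G T B) := by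
  refine ⟨fun α β G hV hE hG => ⟨?_, fun T hT => ?_⟩, ?_, ?_⟩
  · obtain ⟨B, hB, -⟩ := CycleLattice.exists_basis hV hE (A := E(G))
      (by rwa [Graph.restrict_self])
    exact ⟨B, hB⟩
  · obtain ⟨B, -, hB⟩ := CycleLattice.exists_basis hV hE hT.connected
    exact ⟨B, hB hT⟩
  · refine ⟨CycleLattice.Program.seq CycleLattice.markAll CycleLattice.basisProgram, 405, fun n m G s hs hG => ?_⟩
    obtain ⟨t, s', hr, ht, B, hB, hB'⟩ := CycleLattice.wp_markAll_basisProgram hs hG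
    exact ⟨t, s', B, hr, ht, hB, hB'⟩
  · refine ⟨CycleLattice.basisProgram, 400, fun n m G T s hs _ hT => ?_⟩
    obtain ⟨t, s', hr, ht, -, B, hB, -, hB'⟩ :=
      CycleLattice.wp_basisProgram hs.isMarkedInput hT.connected
    exact ⟨t, s', B, hr, ht, hB, hB' hT⟩
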